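/- **Setting.** Fix the dimension $d$. Let $S$ be a polygonal curve in $\mathbb R^d$ with $n\ge 2$ vertices $p_1,\dots,p_n$ and vertex parameters $0=\tau_1<\dots<\tau_n=1$, viewed as a map $S:[0,1]\to\mathbb R^d$ that interpolates linearly between $S(\tau_k)=p_k$ and $S(\tau_{k+1})=p_{k+1}$. Let $e_k(s)=(1-s)p_k+sp_{k+1}$ be its edges, $\lambda_k=\|p_k-p_{k+1}\|$, and $\lambda=\max_k\lambda_k$. Let $\Delta>0$ and $t_1,\dots,t_i\in[0,1]$ with $i\ge 0$. - *Candidates.* Let $X_k=\bigl([0,1]\cap\{a\,\Delta/\lambda_k: a\in\mathbb Z\}\bigr)\cup\{1\}$ (with $X_k=\{0,1\}$ if $\lambda_k=0$), and let $Z=Z_{\Delta,E(S)}=\{(x,y,k): 1\le k<n,\ x,y\in X_k\}$. The triple $(x,y,k)$ stands for the (possibly reversed) subedge $s\mapsto(1-s)e_k(x)+s\,e_k(y)$, $s\in[0,1]$. - *Feasible sets.* For $t\in[0,1]$, $F_\Delta(t)$ is the set of those $Q\in Z$ for which there are indices $1\le i'<j'\le n$ with $j'-i'\le 3$, numbers $a\le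 b$ with $a\in[\tau_{i'},\tau_{i'+1}]$, $b\in[\tau_{j'-1},\tau_{j'}]$ and $t\in[a,b]$, and continuous non-decreasing surjections $f:[0,1]\to[a,b]$ and $g:[0,1]\to[0,1]$ with $\|S(f(u))-Q(g(u))\|\le\Delta$ for all $u\in[0,1]$. - *Distribution.* Under $\mathcal D_i$, a candidate $Q\in Z$ has probability $w(Q)/\sum_{Q'\in Z}w(Q')$, where $w(Q)=2^{\#\{k\le i\,:\,Q\in F_\Delta(t_k)\}}$; that is, weights start at $1$ and are doubled on $F_\Delta(t_k)$ for $k=1,\dots,i$. **Model.** Algorithms are programs for the real RAM: cells hold real numbers; the operations $+,-,\times,/,\sqrt{\cdot}$, comparisons, memory accesses (indirect addressing by exact natural numbers, no rounding) and draws of independent uniform random numbers from $[0,1]$ take one step each. **Theorem.** For each $d$ there are real-RAM programs for building a data structure and for the following two queries such that, for all $S$, $t_1,\dots,t_i$ and $\Delta$ as above, the structure built from them supports any sequence of the queries: 1. sample and return an explicit element $(x,y,k)$ of $Z_{\Delta,E(S)}$ according to $\mathcal D_i$; 2. given $t\in[0,1]$ and $r>0$, determine whether $\Pr_{\mathcal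 D_i}[F_\Delta(t)]\le \frac1r$. Let $m=n\cdot\max(i,1)^2$ and $L=\log(2+\lambda/\Delta)$. The query time for (1) is in $O(\log m+L)$ and the query time for (2) is in $O(mL)$. The data structure is built in $O(mL)$ time and uses $O(m)$ memory cells. The time bounds hold in the worst case (for every outcome of the random draws), and the constants in the $O$-bounds depend only on $d$. -/

import Mathlib

open Set MeasureTheory

/-! ### Polygonal curves, partial traversals, feasible sets -/

/-- A polygonal curve in `ℝ^d` with `N` edges, that is, with `n = N + 1` vertices, together with its
vertex parameters `0 = t₁ < ⋯ < tₙ = 1` (so `N ≥ 1`). Vertices may coincide. -/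
structure PolygonalCurve (d N : ℕ) where
  vertex : Fin (N + 1) → EuclideanSpace ℝ (Fin d)
  param : Fin (N + 1) → ℝ
  param_strictMono : StrictMono param
  param_zero : param 0 = 0
  param_last : param (Fin.last N) = 1

/-- Candidates `(x, y, j)`: the subedge of the `j`-th edge from parameter `x` to parameter `y`
(`x > y` is allowed and gives a subedge in the reverse direction). -/
abbrev Candidate (N : ℕ) : Type := ℝ × ℝ × Fin N

namespace PolygonalCurve

variable {d N : ℕ}

/-- The `k`-th edge, `s ↦ (1 - s) p_k + s p_{k+1}`. -/
noncomputable def edge (S : PolygonalCurve d N) (k : Fin N) (s : ℝ) : EuclideanSpace ℝ (Fin d) :=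
  (1 - s) • S.vertex k.castSucc + s • S.vertex k.succ

/-- The length of the `k`-th edge. -/
noncomputable def edgeLength (S : PolygonalCurve d N) (k : Fin N) : ℝ :=
  dist (S.vertex k.castSucc) (S.vertex k.succ)

/-- The length of the longest edge. -/
noncomputable def maxEdgeLength (S : PolygonalCurve d N) : ℝ := ⨆ k : Fin N, S.edgeLength k

/-- The position of `t` relative to the parameter interval of the `k`-th edge, clamped to `[0,1]`. -/
noncomputable def progress (S : PolygonalCurve d N) (k : Fin N) (t : ℝ) : ℝ :=
  max 0 (min 1 ((t - S.param k.castSucc) / (S.param k.succ - S.param k.castSucc)))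

/-- The curve as a map `[0,1] → ℝ^d` that interpolates linearly between consecutive vertices; see
`PolygonalCurve.eval_eq_edge`. -/
noncomputable def eval (S : PolygonalCurve d N) (t : ℝ) : EuclideanSpace ℝ (Fin d) :=
  S.vertex 0 + ∑ k : Fin N, S.progress k t • (S.vertex k.succ - S.vertex k.castSucc)

theorem eval_eq_edge (S : PolygonalCurve d N) (k : Fin N) (t : ℝ)
    (ht : t ∈ Icc (S.param k.castSucc) (S.param k.succ)) :
    S.eval t = S.edge k ((t - S.param k.castSucc) / (S.param k.succ - S.param k.castSucc)) := by
  have hpos : ∀ j : Fin N, 0 < S.param j.succ - S.param j.castSucc := fun j =>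
    sub_pos.2 (S.param_strictMono Fin.castSucc_lt_succ)
  set s := (t - S.param k.castSucc) / (S.param k.succ - S.param k.castSucc) with hs
  have h0 : 0 ≤ s := div_nonneg (sub_nonneg.2 ht.1) (hpos k).le
  have h1 : s ≤ 1 := (div_le_one (hpos k)).2 (by linarith [ht.2])
  have hprog : ∀ j : Fin N, S.progress j t = if j < k then 1 else if j = k then s else 0 := by
    intro j
    unfold progress
    split_ifs with h h'
    · have : S.param j.succ ≤ S.param k.castSucc := S.param_strictMono.monotone (by
        simp only [Fin.le_def, Fin.lt_def, Fin.val_succ, Fin.val_castSucc] at *; omega)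
      rw [min_eq_left, max_eq_right zero_le_one]
      rw [one_le_div (hpos j)]
      linarith [ht.1]
    · subst h'
      rw [← hs, min_eq_right h1, max_eq_right h0]
    · have : S.param k.succ ≤ S.param j.castSucc := S.param_strictMono.monotone (by
        simp only [Fin.le_def, Fin.lt_def, Fin.ext_iff, Fin.val_succ, Fin.val_castSucc] at *
        omega)
      rw [max_eq_left]
      exact (min_le_right _ _).trans
        (div_nonpos_of_nonpos_of_nonneg (by linarith [ht.2]) (hpos j).le)
  -- telescoping along the curve
  have key : ∀ (M : ℕ) (v : Fin (M + 1) → EuclideanSpace ℝ (Fin d)) (k : Fin M),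
      v 0 + ∑ j : Fin M, (if j < k then (1 : ℝ) else if j = k then s else 0) •
        (v j.succ - v j.castSucc) = (1 - s) • v k.castSucc + s • v k.succ := by
    intro M
    induction M with
    | zero => intro v k; exact k.elim0
    | succ M ih =>
      intro v k
      rw [Fin.sum_univ_succ]
      induction k using Fin.cases with
      | zero =>
        have : ∀ j : Fin M, (if j.succ < (0 : Fin (M + 1)) then (1 : ℝ) else
            if j.succ = 0 then s else 0) = 0 := by
          intro j; simp [Fin.succ_ne_zero]
        simp only [this, zero_smul, Finset.sum_const_zero]
        simp only [lt_irrefl, if_false, if_true, Fin.castSucc_zero]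
        module
      | succ k =>
        have := ih (fun j => v j.succ) k
        simp only [Fin.succ_lt_succ_iff, Fin.succ_inj, Fin.succ_pos, if_true, Fin.castSucc_zero,
          one_smul, ← Fin.succ_castSucc] at this ⊢
        rw [← this]
        abel
  simp only [eval, hprog, edge]
  exact key N S.vertex k

/-- The subedge of the `j`-th edge from `x` to `y`, parametrized over `[0,1]`. -/
noncomputable def subedge (S : PolygonalCurve d N) (z : Candidate N) (s : ℝ) :
    EuclideanSpace ℝ (Fin d) :=
  (1 - s) • S.edge z.2.2 z.1 + s • S.edge z.2.2 z.2.1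

/-- `(f, g)` is a partial traversal from `(a, c)` to `(b, e)` that starts on the `k`-th and ends on
the `l`-th edge of `S`. In terms of vertices `t₁, …, tₙ` and 1-based indices this is an
`(i, j)`-partial traversal, where the `k`-th edge is `t_i t_{i+1}`, the `l`-th edge is `t_{j-1} t_j`,
and `i < j`. -/
structure IsPartialTraversal (S : PolygonalCurve d N) (k l : Fin N) (a b c e : ℝ)
    (f g : ℝ → ℝ) : Prop where
  edge_le : k ≤ l
  start_mem : a ∈ Icc (S.param k.castSucc) (S.param k.succ)
  end_mem : b ∈ Icc (S.param l.castSucc) (S.param l.succ)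
  le₁ : a ≤ b
  nonneg : 0 ≤ c
  le₂ : c ≤ e
  le_one : e ≤ 1
  continuousOn₁ : ContinuousOn f (Icc 0 1)
  monotoneOn₁ : MonotoneOn f (Icc 0 1)
  image₁ : f '' Icc 0 1 = Icc a b
  continuousOn₂ : ContinuousOn g (Icc 0 1)
  monotoneOn₂ : MonotoneOn g (Icc 0 1)
  image₂ : g '' Icc 0 1 = Icc c e

/-- The grid `X_k = ([0,1] ∩ (ε/λ_k) ℤ) ∪ {1}` on the `k`-th edge, where `λ_k` is its length. If
`λ_k = 0` then `ε/λ_k` is read as `0`, so that `X_k = {0, 1}`. -/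
noncomputable def grid (S : PolygonalCurve d N) (ε : ℝ) (k : Fin N) : Set ℝ :=
  (Icc 0 1 ∩ {x | ∃ a : ℤ, x = a * (ε / S.edgeLength k)}) ∪ {1}

/-- The `ε`-approximate candidate set induced by the edges of `S`. -/
def approxCandidates (S : PolygonalCurve d N) (ε : ℝ) : Set (Candidate N) :=
  {z | z.1 ∈ S.grid ε z.2.2 ∧ z.2.1 ∈ S.grid ε z.2.2}

theorem finite_grid (S : PolygonalCurve d N) {ε : ℝ} (hε : 0 < ε) (k : Fin N) :
    (S.grid ε k).Finite := by
  refine Set.Finite.union ?_ (finite_singleton 1)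
  rcases (show 0 ≤ S.edgeLength k from dist_nonneg).eq_or_lt with h | h
  · refine (finite_singleton (0 : ℝ)).subset ?_
    rintro x ⟨-, a, rfl⟩
    simp [← h]
  · have hδ : 0 < ε / S.edgeLength k := div_pos hε h
    refine ((finite_Icc (0 : ℤ) ⌈1 / (ε / S.edgeLength k)⌉).image
      fun a : ℤ => (a : ℝ) * (ε / S.edgeLength k)).subset ?_
    rintro x ⟨hx, a, rfl⟩
    refine ⟨a, ⟨?_, ?_⟩, rfl⟩
    · have := nonneg_of_mul_nonneg_left hx.1 hδ
      exact_mod_cast this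
    · have : (a : ℝ) ≤ 1 / (ε / S.edgeLength k) := (le_div_iff₀ hδ).2 hx.2
      exact_mod_cast this.trans (Int.le_ceil _)

theorem finite_approxCandidates (S : PolygonalCurve d N) {ε : ℝ} (hε : 0 < ε) :
    (S.approxCandidates ε).Finite := by
  have hU : (⋃ k, S.grid ε k).Finite := finite_iUnion fun k => S.finite_grid hε k
  refine (hU.prod (hU.prod (finite_univ (α := Fin N)))).subset ?_
  rintro ⟨x, y, k⟩ ⟨hx, hy⟩
  exact ⟨mem_iUnion.2 ⟨k, hx⟩, mem_iUnion.2 ⟨k, hy⟩, mem_univ _⟩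

/-- The feasible set `F_Δ(t)` within the candidate set `Z_Δ`: the candidates that admit a
`Δ`-feasible `(i, j)`-partial traversal with `S`, `j - i ≤ 3` (at most three edges), which covers the
whole candidate and covers `t` on `S`. -/
def feasibleSet (S : PolygonalCurve d N) (Δ t : ℝ) : Set (Candidate N) :=
  {z | z ∈ S.approxCandidates Δ ∧
    ∃ (k l : Fin N) (a b : ℝ) (f g : ℝ → ℝ), S.IsPartialTraversal k l a b 0 1 f g ∧
      (l : ℕ) ≤ k + 2 ∧ t ∈ Icc a b ∧
      ∀ u ∈ Icc (0 : ℝ) 1, dist (S.eval (f u)) (S.subedge z (g u)) ≤ Δ}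

/-- The weight `2^s` of a candidate, where `s` is the number of indices `k` such that the candidate
lies in `F_Δ(t_k)`: starting from `1`, the weight is doubled once for each such update. -/
noncomputable def weight (S : PolygonalCurve d N) (Δ : ℝ) {i : ℕ} (ts : Fin i → ℝ)
    (z : Candidate N) : ℝ :=
  2 ^ Nat.card {k : Fin i // z ∈ S.feasibleSet Δ (ts k)}

/-- The probability of `A ⊆ Z_Δ` in the distribution `𝓓_i`, in which a candidate has probability
proportional to its weight (the sums are finite by `finite_approxCandidates`). -/
noncomputable def prob (S : PolygonalCurve d N) (Δ : ℝ) {i : ℕ} (ts : Fin i → ℝ)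
    (A : Set (Candidate N)) : ℝ :=
  (∑ᶠ z ∈ A ∩ S.approxCandidates Δ, S.weight Δ ts z) /
    ∑ᶠ z ∈ S.approxCandidates Δ, S.weight Δ ts z

end PolygonalCurve

/-! ### The real RAM

Programs with finitely many registers and an indirectly addressed memory, all of whose cells hold
real numbers. Every arithmetic operation, comparison, square root, memory access, assignment, branch
and random draw costs at least one step. There is no rounding: a memory access requires an address
that is exactly a natural number. -/

namespace RealRAM

/-- The simple operations; comparisons return `0` or `1`. -/
inductive BinOp
  | add | sub | mul | div | eq | ne | lt | le | gt | ge

open Classical in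
noncomputable def BinOp.apply : BinOp → ℝ → ℝ → ℝ
  | .add, x, y => x + y
  | .sub, x, y => x - y
  | .mul, x, y => x * y
  | .div, x, y => x / y
  | .eq, x, y => if x = y then 1 else 0
  | .ne, x, y => if x ≠ y then 1 else 0
  | .lt, x, y => if x < y then 1 else 0
  | .le, x, y => if x ≤ y then 1 else 0
  | .gt, x, y => if x > y then 1 else 0
  | .ge, x, y => if x ≥ y then 1 else 0

/-- Expressions over the registers (`reg`), rational constants, and memory cells (`mem`, with a
computed address). -/
inductive Expr
  | const (q : ℚ)
  | reg (x : ℕ)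
  | mem (address : Expr)
  | op (o : BinOp) (e₁ e₂ : Expr)
  | sqrt (e : Expr)

/-- Contents of the registers and of the memory. -/
structure Store where
  reg : ℕ → ℝ
  mem : ℕ → ℝ

def Store.setReg (σ : Store) (x : ℕ) (v : ℝ) : Store :=
  { σ with reg := Function.update σ.reg x v }

def Store.setMem (σ : Store) (a : ℕ) (v : ℝ) : Store :=
  { σ with mem := Function.update σ.mem a v }

/-- `v` is a natural number below `B`, so it is an address in a memory of `B` cells. -/
def IsAddress (B : ℕ) (v : ℝ) : Prop := ∃ a : ℕ, a < B ∧ v = a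

namespace Expr

/-- The value of an expression; meaningful if `Expr.Safe`. -/
noncomputable def eval (σ : Store) : Expr → ℝ
  | const q => q
  | reg x => σ.reg x
  | mem e => σ.mem ⌊eval σ e⌋₊
  | op o e₁ e₂ => o.apply (eval σ e₁) (eval σ e₂)
  | sqrt e => Real.sqrt (eval σ e)

/-- The evaluation does not get stuck in a memory of `B` cells: addresses are natural numbers below
`B`, denominators are nonzero, and arguments of the square root are nonnegative. -/
def Safe (B : ℕ) (σ : Store) : Expr → Prop
  | const _ => True
  | reg _ => True
  | mem e => e.Safe B σ ∧ IsAddress B (e.eval σ)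
  | op o e₁ e₂ => e₁.Safe B σ ∧ e₂.Safe B σ ∧ (o = BinOp.div → e₂.eval σ ≠ 0)
  | sqrt e => e.Safe B σ ∧ 0 ≤ e.eval σ

/-- The number of steps of the evaluation: one for each node of the expression. -/
def cost : Expr → ℕ
  | const _ => 1
  | reg _ => 1
  | mem e => e.cost + 1
  | op _ e₁ e₂ => e₁.cost + e₂.cost + 1
  | sqrt e => e.cost + 1

end Expr

/-- Programs. `rand x` stores a fresh uniform random number from `[0,1]` in register `x`. -/
inductive Prog
  | skip
  | assign (x : ℕ) (e : Expr)
  | store (address e : Expr)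
  | rand (x : ℕ)
  | seq (p q : Prog)
  | ite (cond : Expr) (p q : Prog)
  | while (cond : Expr) (p : Prog)

/-- A source of random numbers from `[0,1]`. -/
abbrev Tape : Type := ℕ → unitInterval

/-- The distribution of independent uniform random numbers from `[0,1]`. -/
noncomputable def tapeMeasure : Measure Tape :=
  Measure.infinitePi fun _ => (volume : Measure unitInterval)

/-- `Exec B p σ ω T σ' ω'`: in a memory of `B` cells, the program `p`, started on the store `σ` with
the random numbers `ω`, halts after `T` steps with the store `σ'`, and `ω'` are the random numbers
that have not been used. A condition holds if its value is nonzero. -/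
inductive Exec (B : ℕ) : Prog → Store → Tape → ℕ → Store → Tape → Prop
  | skip (σ : Store) (ω : Tape) : Exec B .skip σ ω 1 σ ω
  | assign (x : ℕ) (e : Expr) (σ : Store) (ω : Tape) (he : e.Safe B σ) :
      Exec B (.assign x e) σ ω (e.cost + 1) (σ.setReg x (e.eval σ)) ω
  | store (ad e : Expr) (σ : Store) (ω : Tape) (a : ℕ) (had : ad.Safe B σ) (he : e.Safe B σ)
      (ha : a < B) (hv : ad.eval σ = a) :
      Exec B (.store ad e) σ ω (ad.cost + e.cost + 1) (σ.setMem a (e.eval σ)) ω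
  | rand (x : ℕ) (σ : Store) (ω : Tape) :
      Exec B (.rand x) σ ω 1 (σ.setReg x (ω 0)) (fun k => ω (k + 1))
  | seq (p q : Prog) (σ₀ σ₁ σ₂ : Store) (ω₀ ω₁ ω₂ : Tape) (T₁ T₂ : ℕ)
      (hp : Exec B p σ₀ ω₀ T₁ σ₁ ω₁) (hq : Exec B q σ₁ ω₁ T₂ σ₂ ω₂) :
      Exec B (.seq p q) σ₀ ω₀ (T₁ + T₂) σ₂ ω₂
  | ite_true (c : Expr) (p q : Prog) (σ σ' : Store) (ω ω' : Tape) (T : ℕ) (hc : c.Safe B σ)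
      (h : c.eval σ ≠ 0) (hp : Exec B p σ ω T σ' ω') :
      Exec B (.ite c p q) σ ω (c.cost + 1 + T) σ' ω'
  | ite_false (c : Expr) (p q : Prog) (σ σ' : Store) (ω ω' : Tape) (T : ℕ) (hc : c.Safe B σ)
      (h : c.eval σ = 0) (hq : Exec B q σ ω T σ' ω') :
      Exec B (.ite c p q) σ ω (c.cost + 1 + T) σ' ω'
  | while_true (c : Expr) (p : Prog) (σ₀ σ₁ σ₂ : Store) (ω₀ ω₁ ω₂ : Tape) (T₁ T₂ : ℕ)
      (hc : c.Safe B σ₀) (h : c.eval σ₀ ≠ 0) (hp : Exec B p σ₀ ω₀ T₁ σ₁ ω₁)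
      (hw : Exec B (.while c p) σ₁ ω₁ T₂ σ₂ ω₂) :
      Exec B (.while c p) σ₀ ω₀ (c.cost + 1 + T₁ + T₂) σ₂ ω₂
  | while_false (c : Expr) (p : Prog) (σ : Store) (ω : Tape) (hc : c.Safe B σ)
      (h : c.eval σ = 0) : Exec B (.while c p) σ ω (c.cost + 1) σ ω

/-- In a memory of `B` cells, the program `p`, started on `σ` with the random numbers `ω`, halts
after at most `bound` steps in a store that satisfies `post`. -/
def HaltsWithin (B : ℕ) (p : Prog) (σ : Store) (ω : Tape) (bound : ℝ) (post : Store → Prop) : Prop :=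
  ∃ (T : ℕ) (σ' : Store) (ω' : Tape), Exec B p σ ω T σ' ω' ∧ (T : ℝ) ≤ bound ∧ post σ'

/-- The probability that `p`, started on `σ`, halts in a store that satisfies `post`. -/
noncomputable def outputProb (B : ℕ) (p : Prog) (σ : Store) (post : Store → Prop) : ENNReal :=
  tapeMeasure {ω | ∃ (T : ℕ) (σ' : Store) (ω' : Tape), Exec B p σ ω T σ' ω' ∧ post σ'}

end RealRAM

/-! ### Input and output conventions of the data structure -/

open RealRAM

/-- `σ` is the initial store of the construction. Registers `0, 1, 2` hold `n = N + 1`, `i` and `Δ`.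
The memory holds, one after the other, the `n * d` coordinates of the vertices of `S` (vertex by
vertex), the `n` vertex parameters of `S`, and the update points `t_1, …, t_i`. All other registers
and memory cells are `0`. -/
structure IsInput {d N : ℕ} (S : PolygonalCurve d N) {i : ℕ} (ts : Fin i → ℝ) (Δ : ℝ)
    (σ : Store) : Prop where
  size : σ.reg 0 = N + 1
  updates : σ.reg 1 = i
  delta : σ.reg 2 = Δ
  reg_zero : ∀ x, 3 ≤ x → σ.reg x = 0
  vertex : ∀ (k : Fin (N + 1)) (c : Fin d), σ.mem (k * d + c) = S.vertex k c
  param : ∀ k : Fin (N + 1), σ.mem ((N + 1) * d + k) = S.param k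
  update : ∀ k : Fin i, σ.mem ((N + 1) * d + (N + 1) + k) = ts k
  mem_zero : ∀ a, (N + 1) * d + (N + 1) + i ≤ a → σ.mem a = 0

/-- The candidate `(x, y, j)` is output explicitly: registers `0, 1, 2` hold the number `j` of its
edge (counted from `0`) and its parameters `x` and `y`. -/
def OutputsCandidate {N : ℕ} (z : Candidate N) (σ : Store) : Prop :=
  σ.reg 0 = (z.2.2 : ℕ) ∧ σ.reg 1 = z.1 ∧ σ.reg 2 = z.2.1

/-- The truth value of `P` is output in register `0`, as `1` or `0`. -/
def OutputsTruth (P : Prop) (σ : Store) : Prop :=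
  (P ∧ σ.reg 0 = 1) ∨ (¬ P ∧ σ.reg 0 = 0)

/-! Fix an edge `j` and a point `t` of the curve. A candidate on the edge is a pair of grid
positions `x`, `y`. It is feasible for `t` iff there are edges `k ≤ l ≤ k + 2` of the curve such
that `x` is close to the part of edge `k` before `t`, `y` is close to the part of edge `l` after
`t`, and the intervals of positions close to the vertices in between can be visited monotonically on
the way from `x` to `y` (`PolygonalCurve.mem_feasibleSet_iff`). The positions on a line that are
close to a segment form an interval, so these conditions compare `x` and `y` with interval ends.
Only six edges near `t` matter and each contributes six boundaries. Hence 36 breakpoints on the grid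
decide feasibility: the feasible set is constant on products of the cells that they cut out
(`HasSplits.covers_iff`). The order of `x` and `y` is not fixed when both lie in one cell, but then
one common position meets all the intervals and both directions are possible.

All update points together cut the grid of an edge at `O(i + 1)` breakpoints, and the candidates of
the edge into `O((i + 1)²)` blocks of constant weight. So `O(m)` records describe the distribution,
however fine the grid is.

The machine cannot round, so a breakpoint is found by binary search (`run_search`) in `O(L)` steps
and then inserted into a sorted list. The blocks of an edge are swept row by row. Passing a
breakpoint can change the factor of only the update point that owns it (`Cuts.flag_eq`), so one
division and one multiplication update the weight (`run_flagProg`). Each record also stores the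
total weight of its predecessors.

For sampling, one uniform number is scaled by the total weight. The candidates correspond to
disjoint half-open intervals whose lengths are their weights, and three binary searches, for block,
row and column, find the interval that is hit (`run_selectProg`, `volume_position`). For the
decision, `t` is treated as one more update point: doubling the weights on its feasible set raises
the total weight by exactly the weight of that set (`total_addPoint`). A second sweep restores the
table.

Running times are handled by `Run`, which bounds the steps by the size of the program times a
factor; only loops consume this factor. -/

namespace RealRAM

/-! ### Expressions -/

instance : Add Expr := ⟨Expr.op .add⟩
instance : Sub Expr := ⟨Expr.op .sub⟩
instance : Mul Expr := ⟨Expr.op .mul⟩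
instance : Div Expr := ⟨Expr.op .div⟩
instance (n : ℕ) : OfNat Expr n := ⟨Expr.const n⟩

/-- The truth value of a proposition as a real number. -/
noncomputable def ind (P : Prop) : ℝ := open Classical in if P then 1 else 0

theorem ind_true {P : Prop} (h : P) : ind P = 1 := by simp [ind, h]
theorem ind_false {P : Prop} (h : ¬ P) : ind P = 0 := by simp [ind, h]
theorem ind_eq_zero {P : Prop} : ind P = 0 ↔ ¬ P := by
  by_cases h : P <;> simp [ind, h]
theorem ind_ne_zero {P : Prop} : ind P ≠ 0 ↔ P := by
  by_cases h : P <;> simp [ind, h]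
theorem ind_congr {P Q : Prop} (h : P ↔ Q) : ind P = ind Q := by rw [propext h]
theorem ind_nonneg (P : Prop) : 0 ≤ ind P := by by_cases h : P <;> simp [ind, h]
theorem ind_mul (P Q : Prop) : ind P * ind Q = ind (P ∧ Q) := by
  by_cases h : P <;> by_cases h' : Q <;> simp [ind, h, h']

namespace Expr

/-- A natural number as a constant. -/
def ofNat (n : ℕ) : Expr := const n
/-- Negation of a truth value. -/
def not (e : Expr) : Expr := 1 - e
/-- Disjunction of truth values. -/
def or (e f : Expr) : Expr := e + f - e * f
/-- `a` if the truth value `c` is `1` and `b` if it is `0`. -/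
def ife (c a b : Expr) : Expr := c * a + (1 - c) * b
def lt (a b : Expr) : Expr := op .lt a b
def le (a b : Expr) : Expr := op .le a b
def eq (a b : Expr) : Expr := op .eq a b
def max (a b : Expr) : Expr := ife (le a b) b a
def min (a b : Expr) : Expr := ife (le a b) a b
/-- The quotient, with `x / 0` read as `x`. -/
def sdiv (a b : Expr) : Expr := a / (b + eq b 0)
/-- The sum of `f 0, …, f (n - 1)`. -/
def sum (f : ℕ → Expr) : ℕ → Expr
  | 0 => 0
  | n + 1 => sum f n + f n

end Expr

/-- In a memory of `B` cells, `e` is safe and has the value `v`. -/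
structure Ev (B : ℕ) (σ : Store) (e : Expr) (v : ℝ) : Prop where
  safe : e.Safe B σ
  eval_eq : e.eval σ = v

namespace Ev

variable {B : ℕ} {σ : Store} {a b c : Expr} {x y : ℝ} {P Q : Prop}

theorem congr (h : Ev B σ a x) (hxy : x = y) : Ev B σ a y := hxy ▸ h

theorem reg (r : ℕ) : Ev B σ (.reg r) (σ.reg r) := ⟨trivial, rfl⟩

theorem reg_of {r : ℕ} (h : σ.reg r = x) : Ev B σ (.reg r) x := ⟨trivial, h⟩

theorem nat (n : ℕ) : Ev B σ (.ofNat n) n := ⟨trivial, by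
  simp [Expr.ofNat, Expr.eval]⟩

theorem ofNat (n : ℕ) : Ev B σ (OfNat.ofNat n : Expr) (n : ℝ) := ⟨trivial, by
  change ((n : ℚ) : ℝ) = n
  simp⟩

theorem zero : Ev B σ (0 : Expr) 0 := (ofNat 0).congr (by simp)
theorem one : Ev B σ (1 : Expr) 1 := (ofNat 1).congr (by simp)
theorem two : Ev B σ (2 : Expr) 2 := (ofNat 2).congr (by simp)

theorem add (h : Ev B σ a x) (h' : Ev B σ b y) : Ev B σ (a + b) (x + y) :=
  ⟨⟨h.1, h'.1, nofun⟩, congrArg₂ (· + ·) h.2 h'.2⟩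

theorem sub (h : Ev B σ a x) (h' : Ev B σ b y) : Ev B σ (a - b) (x - y) :=
  ⟨⟨h.1, h'.1, nofun⟩, congrArg₂ (· - ·) h.2 h'.2⟩

theorem mul (h : Ev B σ a x) (h' : Ev B σ b y) : Ev B σ (a * b) (x * y) :=
  ⟨⟨h.1, h'.1, nofun⟩, congrArg₂ (· * ·) h.2 h'.2⟩

theorem div (h : Ev B σ a x) (h' : Ev B σ b y) (hy : y ≠ 0) : Ev B σ (a / b) (x / y) :=
  ⟨⟨h.1, h'.1, fun _ => h'.2 ▸ hy⟩, congrArg₂ (· / ·) h.2 h'.2⟩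

theorem sqrt (h : Ev B σ a x) (hx : 0 ≤ x) : Ev B σ (.sqrt a) (Real.sqrt x) :=
  ⟨⟨h.1, h.2 ▸ hx⟩, congrArg Real.sqrt h.2⟩

theorem mem {n : ℕ} (h : Ev B σ a n) (hn : n < B) : Ev B σ (.mem a) (σ.mem n) :=
  ⟨⟨h.1, n, hn, h.2⟩, by simp [Expr.eval, h.2]⟩

theorem mem_of {n : ℕ} (h : Ev B σ a n) (hn : n < B) (hx : σ.mem n = x) : Ev B σ (.mem a) x :=
  (h.mem hn).congr hx

theorem lt (h : Ev B σ a x) (h' : Ev B σ b y) : Ev B σ (.lt a b) (ind (x < y)) :=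
  ⟨⟨h.1, h'.1, nofun⟩, by
    change BinOp.apply .lt (a.eval σ) (b.eval σ) = _
    rw [h.2, h'.2]; by_cases hh : x < y <;> simp [BinOp.apply, ind, hh]⟩

theorem le (h : Ev B σ a x) (h' : Ev B σ b y) : Ev B σ (.le a b) (ind (x ≤ y)) :=
  ⟨⟨h.1, h'.1, nofun⟩, by
    change BinOp.apply .le (a.eval σ) (b.eval σ) = _
    rw [h.2, h'.2]; by_cases hh : x ≤ y <;> simp [BinOp.apply, ind, hh]⟩

theorem eq (h : Ev B σ a x) (h' : Ev B σ b y) : Ev B σ (.eq a b) (ind (x = y)) :=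
  ⟨⟨h.1, h'.1, nofun⟩, by
    change BinOp.apply .eq (a.eval σ) (b.eval σ) = _
    rw [h.2, h'.2]; by_cases hh : x = y <;> simp [BinOp.apply, ind, hh]⟩

theorem and (h : Ev B σ a (ind P)) (h' : Ev B σ b (ind Q)) : Ev B σ (a * b) (ind (P ∧ Q)) :=
  (h.mul h').congr (ind_mul P Q)

theorem not (h : Ev B σ a (ind P)) : Ev B σ (.not a) (ind (¬ P)) :=
  (one.sub h).congr (by by_cases hP : P <;> simp [ind, hP])

theorem or (h : Ev B σ a (ind P)) (h' : Ev B σ b (ind Q)) : Ev B σ (.or a b) (ind (P ∨ Q)) :=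
  ((h.add h').sub (h.mul h')).congr
    (by by_cases hP : P <;> by_cases hQ : Q <;> simp [ind, hP, hQ])

open Classical in
theorem ife (h : Ev B σ c (ind P)) (ha : Ev B σ a x) (hb : Ev B σ b y) :
    Ev B σ (.ife c a b) (if P then x else y) :=
  ((h.mul ha).add ((one.sub h).mul hb)).congr (by by_cases hP : P <;> simp [ind, hP])

theorem max (h : Ev B σ a x) (h' : Ev B σ b y) : Ev B σ (.max a b) (max x y) :=
  ((h.le h').ife h' h).congr (by
    by_cases hh : x ≤ y
    · simp [hh]
    · simp [hh, (not_le.1 hh).le])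

theorem min (h : Ev B σ a x) (h' : Ev B σ b y) : Ev B σ (.min a b) (min x y) :=
  ((h.le h').ife h h').congr (by
    by_cases hh : x ≤ y
    · simp [hh]
    · simp [hh, (not_le.1 hh).le])

/-- The machine has no conditional expressions: `ife` evaluates both branches, so a quotient has to
be safe even where it is not used. The denominator here is `1` if `y = 0`, and the result is `x / y`
otherwise. -/
theorem sdiv (h : Ev B σ a x) (h' : Ev B σ b y) : Ev B σ (.sdiv a b) (x / (y + ind (y = 0))) :=
  h.div (h'.add (h'.eq zero)) (by
    by_cases hh : y = 0 <;> simp [ind, hh])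

theorem sum {f : ℕ → Expr} {g : ℕ → ℝ} {n : ℕ} (h : ∀ k < n, Ev B σ (f k) (g k)) :
    Ev B σ (.sum f n) (∑ k ∈ Finset.range n, g k) := by
  induction n with
  | zero => exact zero.congr (by simp)
  | succ n ih =>
    rw [Finset.sum_range_succ]
    exact (ih fun k hk => h k (by omega)).add (h n (by omega))

end Ev

/-! ### Stores -/

@[simp] theorem Store.setReg_reg (σ : Store) (x y : ℕ) (v : ℝ) :
    (σ.setReg x v).reg y = if y = x then v else σ.reg y := by
  simp [Store.setReg, Function.update_apply]

@[simp] theorem Store.setReg_mem (σ : Store) (x : ℕ) (v : ℝ) : (σ.setReg x v).mem = σ.mem := rfl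

@[simp] theorem Store.setMem_reg (σ : Store) (x : ℕ) (v : ℝ) : (σ.setMem x v).reg = σ.reg := rfl

@[simp] theorem Store.setMem_mem (σ : Store) (x y : ℕ) (v : ℝ) :
    (σ.setMem x v).mem y = if y = x then v else σ.mem y := by
  simp [Store.setMem, Function.update_apply]

/-! ### Running programs -/

/-- The number of nodes of a program: the cost of one pass through it. -/
def Prog.size : Prog → ℕ
  | .skip => 1
  | .assign _ e => e.cost + 1
  | .store a e => a.cost + e.cost + 1
  | .rand _ => 1
  | .seq p q => p.size + q.size
  | .ite c p q => c.cost + 1 + p.size + q.size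
  | .while c p => c.cost + 1 + p.size

/-- Without using random numbers, `p` halts after at most `p.size * X` steps, with `Q`. -/
def Run (B : ℕ) (p : Prog) (X : ℕ) (σ : Store) (Q : Store → Prop) : Prop :=
  ∀ ω : Tape, ∃ (T : ℕ) (σ' : Store), Exec B p σ ω T σ' ω ∧ T ≤ p.size * X ∧ Q σ'

namespace Run

variable {B : ℕ} {p q : Prog} {X Y : ℕ} {σ : Store} {Q R : Store → Prop} {c e ad : Expr}

theorem mono (h : Run B p X σ R) (hQ : ∀ σ', R σ' → Q σ') (hX : X ≤ Y) : Run B p Y σ Q := by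
  intro ω
  obtain ⟨T, σ', h1, h2, h3⟩ := h ω
  exact ⟨T, σ', h1, h2.trans (Nat.mul_le_mul_left _ hX), hQ _ h3⟩

theorem imp (h : Run B p X σ R) (hQ : ∀ σ', R σ' → Q σ') : Run B p X σ Q := h.mono hQ le_rfl

theorem skip (hX : 0 < X) (hQ : Q σ) : Run B .skip X σ Q := fun ω =>
  ⟨1, σ, .skip σ ω, by rw [Prog.size, one_mul]; exact hX, hQ⟩

theorem assign {r : ℕ} {v : ℝ} (hX : 0 < X) (he : Ev B σ e v) (hQ : Q (σ.setReg r v)) :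
    Run B (.assign r e) X σ Q := fun ω =>
  ⟨_, _, .assign r e σ ω he.1, Nat.le_mul_of_pos_right _ hX, he.2 ▸ hQ⟩

theorem store {n : ℕ} {v : ℝ} (hX : 0 < X) (ha : Ev B σ ad n) (hn : n < B) (he : Ev B σ e v)
    (hQ : Q (σ.setMem n v)) : Run B (.store ad e) X σ Q := fun ω =>
  ⟨_, _, .store ad e σ ω n ha.1 he.1 hn ha.2, Nat.le_mul_of_pos_right _ hX, he.2 ▸ hQ⟩

/-- Sizes add up and the factor `X` is common to both parts, so sequences need no addition of time
bounds. -/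
theorem seq (hp : Run B p X σ fun σ' => Run B q X σ' Q) : Run B (.seq p q) X σ Q := by
  intro ω
  obtain ⟨T, σ', h1, h2, h3⟩ := hp ω
  obtain ⟨T', σ'', h1', h2', h3'⟩ := h3 ω
  refine ⟨T + T', σ'', .seq _ _ _ _ _ _ _ _ _ _ h1 h1', ?_, h3'⟩
  rw [Prog.size, Nat.add_mul]
  exact Nat.add_le_add h2 h2'

theorem ite {P : Prop} (hX : 0 < X) (hc : Ev B σ c (ind P)) (hp : P → Run B p X σ Q)
    (hq : ¬ P → Run B q X σ Q) : Run B (.ite c p q) X σ Q := by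
  intro ω
  by_cases hP : P
  · obtain ⟨T, σ', h1, h2, h3⟩ := hp hP ω
    refine ⟨_, σ', .ite_true _ _ _ _ _ _ _ _ hc.1 (by rw [hc.2]; exact ind_ne_zero.2 hP) h1, ?_, h3⟩
    rw [Prog.size]
    nlinarith [Nat.zero_le (c.cost * X), Nat.zero_le (q.size * X)]
  · obtain ⟨T, σ', h1, h2, h3⟩ := hq hP ω
    refine ⟨_, σ', .ite_false _ _ _ _ _ _ _ _ hc.1 (by rw [hc.2]; exact ind_eq_zero.2 hP) h1, ?_, h3⟩
    rw [Prog.size]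
    nlinarith [Nat.zero_le (c.cost * X), Nat.zero_le (p.size * X)]

/-- A loop with at most `n` iterations. -/
theorem loop (I : ℕ → Store → Prop) (n : ℕ) (hX : (n + 1) * Y ≤ X) (hY : 0 < Y) (h0 : I n σ)
    (h : ∀ m σ, I m σ → ∃ P : Prop, Ev B σ c (ind P) ∧
      (P → ∃ m', m = m' + 1 ∧ Run B p Y σ (I m')) ∧ (¬ P → Q σ)) :
    Run B (.while c p) X σ Q := by
  refine Run.mono (X := (n + 1) * Y) (R := Q) ?_ (fun _ h => h) hX
  clear hX
  -- `I m` is the invariant with at most `m` rounds left. At `m = 0` the condition must fail, since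
  -- no `m'` satisfies `0 = m' + 1`.
  induction n generalizing σ with
  | zero =>
    intro ω
    obtain ⟨P, hc, h1, h2⟩ := h _ _ h0
    by_cases hP : P
    · obtain ⟨m', hm, -⟩ := h1 hP; omega
    refine ⟨_, σ, .while_false _ _ _ _ hc.1 (by rw [hc.2]; exact ind_eq_zero.2 hP), ?_, h2 hP⟩
    rw [Prog.size]
    nlinarith [Nat.zero_le (c.cost * Y), Nat.zero_le (p.size * Y)]
  | succ n ih =>
    intro ω
    obtain ⟨P, hc, h1, h2⟩ := h _ _ h0
    by_cases hP : P
    · obtain ⟨m', hm, hr⟩ := h1 hP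
      obtain rfl : n = m' := by omega
      obtain ⟨T, σ', hT1, hT2, hT3⟩ := hr ω
      obtain ⟨T', σ'', hT1', hT2', hT3'⟩ := ih hT3 ω
      refine ⟨_, σ'', .while_true _ _ _ _ _ _ _ _ _ _ hc.1
        (by rw [hc.2]; exact ind_ne_zero.2 hP) hT1 hT1', ?_, hT3'⟩
      simp only [Prog.size] at hT2' ⊢
      nlinarith [Nat.zero_le (c.cost * Y)]
    · refine ⟨_, σ, .while_false _ _ _ _ hc.1 (by rw [hc.2]; exact ind_eq_zero.2 hP), ?_, h2 hP⟩
      rw [Prog.size]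
      nlinarith [Nat.zero_le (c.cost * Y), Nat.zero_le (p.size * Y),
        Nat.zero_le (n * ((c.cost + 1 + p.size) * Y))]

/-- A counting loop with `n` iterations. -/
theorem for_loop (I : ℕ → Store → Prop) (n : ℕ) (hX : (n + 1) * Y ≤ X) (hY : 0 < Y) (h0 : I 0 σ)
    (hc : ∀ m σ, m ≤ n → I m σ → Ev B σ c (ind (m < n)))
    (h : ∀ m σ, m < n → I m σ → Run B p Y σ (I (m + 1)))
    (hQ : ∀ σ, I n σ → Q σ) :
    Run B (.while c p) X σ Q := by
  refine loop (fun m σ => m ≤ n ∧ I (n - m) σ) n hX hY ⟨le_rfl, by simpa using h0⟩ ?_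
  rintro m σ ⟨hm, hI⟩
  refine ⟨n - m < n, hc _ _ (Nat.sub_le _ _) hI, fun hlt => ?_, fun hlt => ?_⟩
  · refine ⟨m - 1, by omega, (h _ _ hlt hI).imp fun σ' h' => ⟨by omega, ?_⟩⟩
    rwa [show n - (m - 1) = n - m + 1 by omega]
  · rw [show n - m = n by omega] at hI
    exact hQ _ hI

end Run

/-- Output probabilities ask for the existence of an execution with a given result. By determinism,
the one execution that has been constructed decides this. Two addresses of the same store
instruction agree because they are natural numbers with equal casts. -/
theorem Exec.deterministic {B : ℕ} {p : Prog} {σ σ₁ σ₂ : Store} {ω ω₁ ω₂ : Tape} {T₁ T₂ : ℕ}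
    (h₁ : Exec B p σ ω T₁ σ₁ ω₁) (h₂ : Exec B p σ ω T₂ σ₂ ω₂) : σ₁ = σ₂ ∧ ω₁ = ω₂ := by
  induction h₁ generalizing σ₂ ω₂ T₂ with
  | skip => cases h₂; exact ⟨rfl, rfl⟩
  | assign => cases h₂; exact ⟨rfl, rfl⟩
  | store ad e σ ω a _ _ _ hv =>
    cases h₂ with
    | store _ _ _ _ a' _ _ _ hv' =>
      have : a = a' := by exact_mod_cast hv.symm.trans hv'
      subst this; exact ⟨rfl, rfl⟩
  | rand => cases h₂; exact ⟨rfl, rfl⟩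
  | seq _ _ _ _ _ _ _ _ _ _ _ _ ih1 ih2 =>
    cases h₂ with
    | seq _ _ _ _ _ _ _ _ _ _ hp hq =>
      obtain ⟨rfl, rfl⟩ := ih1 hp
      exact ih2 hq
  | ite_true _ _ _ _ _ _ _ _ _ h _ ih =>
    cases h₂ with
    | ite_true _ _ _ _ _ _ _ _ _ _ hp => exact ih hp
    | ite_false _ _ _ _ _ _ _ _ _ h' => exact absurd h' h
  | ite_false _ _ _ _ _ _ _ _ _ h _ ih =>
    cases h₂ with
    | ite_false _ _ _ _ _ _ _ _ _ _ hp => exact ih hp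
    | ite_true _ _ _ _ _ _ _ _ _ h' => exact absurd h h'
  | while_true _ _ _ _ _ _ _ _ _ _ _ h _ _ ih1 ih2 =>
    cases h₂ with
    | while_true _ _ _ _ _ _ _ _ _ _ _ _ hp hw =>
      obtain ⟨rfl, rfl⟩ := ih1 hp
      exact ih2 hw
    | while_false _ _ _ _ _ h' => exact absurd h' h
  | while_false _ _ _ _ _ h =>
    cases h₂ with
    | while_true _ _ _ _ _ _ _ _ _ _ _ h' => exact absurd h h'
    | while_false => exact ⟨rfl, rfl⟩

end RealRAM

/-! ### Points of a line that are close to a segment -/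

section LineSegment

variable {V : Type*} [NormedAddCommGroup V] [InnerProductSpace ℝ V]

/-- The parameter in `[u₀, u₁]` of the point of the segment `u ↦ A + u • U` closest to `X`. -/
noncomputable def projParam (A U X : V) (u₀ u₁ : ℝ) : ℝ :=
  max u₀ (min u₁ (inner ℝ (X - A) U / (inner ℝ U U + ind (inner ℝ U U = (0 : ℝ)))))

/-- The vector from the closest point of the segment to `X`. -/
noncomputable def gapVec (A U X : V) (u₀ u₁ : ℝ) : V := X - (A + projParam A U X u₀ u₁ • U)

/-- The parameters `z` of the points `C + z • E` that are `Δ`-close to the segment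
`A + [u₀, u₁] • U`. -/
def closeSet (A U C E : V) (u₀ u₁ Δ : ℝ) : Set ℝ :=
  {z | ∃ u ∈ Icc u₀ u₁, dist (A + u • U) (C + z • E) ≤ Δ}

/-- `C + z • E` is not `Δ`-close to the segment, and moving in the direction of `E` helps. -/
def IsBelow (A U C E : V) (u₀ u₁ Δ z : ℝ) : Prop :=
  ¬ inner ℝ (gapVec A U (C + z • E) u₀ u₁) (gapVec A U (C + z • E) u₀ u₁) ≤ Δ * Δ ∧
    inner ℝ (gapVec A U (C + z • E) u₀ u₁) E < 0

/-- `C + z • E` is not `Δ`-close to the segment, and moving against the direction of `E` helps. -/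
def IsAbove (A U C E : V) (u₀ u₁ Δ z : ℝ) : Prop :=
  ¬ inner ℝ (gapVec A U (C + z • E) u₀ u₁) (gapVec A U (C + z • E) u₀ u₁) ≤ Δ * Δ ∧
    0 < inner ℝ (gapVec A U (C + z • E) u₀ u₁) E

theorem projParam_mem (A U X : V) {u₀ u₁ : ℝ} (h : u₀ ≤ u₁) :
    projParam A U X u₀ u₁ ∈ Icc u₀ u₁ :=
  ⟨le_max_left _ _, max_le h (min_le_left _ _)⟩

/-- The variational inequality of the projection to a segment. With the unclamped parameter `r`, the
inner product is `(r - p)‖U‖²`; it vanishes unless clamping moved `r` to an end, and then `u - p`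
has the opposite sign. -/
theorem gapVec_inner_le (A U X : V) {u₀ u₁ u : ℝ} (hu : u ∈ Icc u₀ u₁) :
    (u - projParam A U X u₀ u₁) * inner ℝ (gapVec A U X u₀ u₁) U ≤ 0 := by
  by_cases hU : U = 0
  · simp [hU]
  have hpos : (0 : ℝ) < inner ℝ U U := real_inner_self_pos.2 hU
  set r : ℝ := inner ℝ (X - A) U / (inner ℝ U U + ind (inner ℝ U U = (0 : ℝ))) with hr
  have hr' : inner ℝ (X - A) U = r * inner ℝ U U := by
    rw [hr, ind_false hpos.ne', add_zero, div_mul_cancel₀ _ hpos.ne']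
  have hg : inner ℝ (gapVec A U X u₀ u₁) U = (r - projParam A U X u₀ u₁) * inner ℝ U U := by
    rw [gapVec, ← sub_sub, inner_sub_left, hr', inner_smul_left]
    simp; ring
  rw [hg, ← mul_assoc]
  refine mul_nonpos_of_nonpos_of_nonneg ?_ hpos.le
  have hp : projParam A U X u₀ u₁ = max u₀ (min u₁ r) := rfl
  rw [hp]
  rcases le_total u₁ r with h1 | h1
  · rw [min_eq_left h1, max_eq_right (hu.1.trans hu.2)]
    nlinarith [hu.2]
  · rw [min_eq_right h1]
    rcases le_total u₀ r with h2 | h2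
    · rw [max_eq_right h2]; simp
    · rw [max_eq_left h2]; nlinarith [hu.1]

/-- In the expansion of `‖g - (u - p) • U‖²` the cross term is nonnegative by `gapVec_inner_le`. -/
theorem gapVec_norm_le (A U X : V) {u₀ u₁ u : ℝ} (hu : u ∈ Icc u₀ u₁) :
    ‖gapVec A U X u₀ u₁‖ ≤ dist (A + u • U) X := by
  have h := gapVec_inner_le A U X hu
  set p := projParam A U X u₀ u₁
  set g := gapVec A U X u₀ u₁ with hg
  have hx : X - (A + u • U) = g - (u - p) • U := by
    rw [hg, gapVec]; module
  rw [dist_comm, dist_eq_norm, hx]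
  refine le_of_sq_le_sq ?_ (norm_nonneg _)
  rw [norm_sub_sq_real, inner_smul_right]
  nlinarith [sq_nonneg ‖(u - p) • U‖]

theorem mem_closeSet_iff (A U C E : V) {u₀ u₁ Δ : ℝ} (h : u₀ ≤ u₁) (hΔ : 0 < Δ) (z : ℝ) :
    z ∈ closeSet A U C E u₀ u₁ Δ ↔
      inner ℝ (gapVec A U (C + z • E) u₀ u₁) (gapVec A U (C + z • E) u₀ u₁) ≤ Δ * Δ := by
  rw [real_inner_self_eq_norm_mul_norm, ← abs_le_iff_mul_self_le,
    abs_of_nonneg (norm_nonneg _), abs_of_pos hΔ]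
  constructor
  · rintro ⟨u, hu, hd⟩
    exact (gapVec_norm_le A U _ hu).trans hd
  · intro hn
    exact ⟨_, projParam_mem A U _ h, by rwa [dist_comm, dist_eq_norm]⟩

/-- At a far position `z` with gap `g`, a position `z'` close to the point with parameter `u`
satisfies `‖g‖² + (z' - z)⟪g, E⟫ - (u - p)⟪g, U⟫ ≤ Δ‖g‖ < ‖g‖²`, and the third term cannot help by
`gapVec_inner_le`. So the sign of `⟪g, E⟫` tells on which side of `z` all close positions lie. -/
theorem closeSet_side (A U C E : V) {u₀ u₁ Δ z z' : ℝ} (hΔ : 0 < Δ)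
    (hz : ¬ inner ℝ (gapVec A U (C + z • E) u₀ u₁) (gapVec A U (C + z • E) u₀ u₁) ≤ Δ * Δ)
    (hz' : z' ∈ closeSet A U C E u₀ u₁ Δ) :
    (z' - z) * inner ℝ (gapVec A U (C + z • E) u₀ u₁) E < 0 := by
  obtain ⟨u, hu, hd⟩ := hz'
  have h := gapVec_inner_le A U (C + z • E) hu
  set p := projParam A U (C + z • E) u₀ u₁
  set g := gapVec A U (C + z • E) u₀ u₁ with hg
  rw [not_le, real_inner_self_eq_norm_mul_norm] at hz
  have hgn : Δ < ‖g‖ := by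
    by_contra hcon
    nlinarith [norm_nonneg g]
  have hx : (C + z' • E) - (A + u • U) = g + (z' - z) • E - (u - p) • U := by
    rw [hg, gapVec]; module
  have h1 : inner ℝ ((C + z' • E) - (A + u • U)) g ≤ Δ * ‖g‖ := by
    refine (real_inner_le_norm _ _).trans ?_
    rw [dist_comm, dist_eq_norm] at hd
    exact mul_le_mul_of_nonneg_right hd (norm_nonneg _)
  rw [hx, inner_sub_left, inner_add_left, inner_smul_left, inner_smul_left,
    real_inner_self_eq_norm_mul_norm, real_inner_comm g E, real_inner_comm g U] at h1
  simp only [conj_trivial] at h1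
  nlinarith

/-! ### Which side of the close positions a far position is on -/

section

variable {A U C E : V} {u₀ u₁ Δ z z' : ℝ}

/-- All close positions lie to the right of `z`, hence `z'` is far as well, and a close position to
the right of `z'` determines the sign there. Without any close position the test need not be
monotone. -/
theorem IsBelow.anti (hΔ : 0 < Δ) (h01 : u₀ ≤ u₁) (hne : (closeSet A U C E u₀ u₁ Δ).Nonempty)
    (h : IsBelow A U C E u₀ u₁ Δ z) (hz : z' ≤ z) : IsBelow A U C E u₀ u₁ Δ z' := by
  obtain ⟨y, hy⟩ := hne
  have h1 := closeSet_side A U C E hΔ h.1 hy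
  have hyz : z < y := by
    by_contra hcon
    nlinarith [h.2]
  have hout : ¬ inner ℝ (gapVec A U (C + z' • E) u₀ u₁) (gapVec A U (C + z' • E) u₀ u₁) ≤ Δ * Δ := by
    intro hin
    have := closeSet_side A U C E hΔ h.1 ((mem_closeSet_iff A U C E h01 hΔ z').2 hin)
    nlinarith [h.2]
  refine ⟨hout, ?_⟩
  have := closeSet_side A U C E hΔ hout hy
  by_contra hcon
  nlinarith

theorem IsAbove.mono (hΔ : 0 < Δ) (h01 : u₀ ≤ u₁) (hne : (closeSet A U C E u₀ u₁ Δ).Nonempty)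
    (h : IsAbove A U C E u₀ u₁ Δ z) (hz : z ≤ z') : IsAbove A U C E u₀ u₁ Δ z' := by
  obtain ⟨y, hy⟩ := hne
  have h1 := closeSet_side A U C E hΔ h.1 hy
  have hyz : y < z := by
    by_contra hcon
    nlinarith [h.2]
  have hout : ¬ inner ℝ (gapVec A U (C + z' • E) u₀ u₁) (gapVec A U (C + z' • E) u₀ u₁) ≤ Δ * Δ := by
    intro hin
    have := closeSet_side A U C E hΔ h.1 ((mem_closeSet_iff A U C E h01 hΔ z').2 hin)
    nlinarith [h.2]
  refine ⟨hout, ?_⟩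
  have := closeSet_side A U C E hΔ hout hy
  by_contra hcon
  nlinarith

/-- A far position with `⟪g, E⟫ = 0` would contradict `closeSet_side`, so every far position is on
one of the two sides. -/
theorem mem_closeSet_iff_not (hΔ : 0 < Δ) (h01 : u₀ ≤ u₁)
    (hne : (closeSet A U C E u₀ u₁ Δ).Nonempty) :
    z ∈ closeSet A U C E u₀ u₁ Δ ↔
      ¬ IsBelow A U C E u₀ u₁ Δ z ∧ ¬ IsAbove A U C E u₀ u₁ Δ z := by
  rw [mem_closeSet_iff A U C E h01 hΔ]
  constructor
  · exact fun h => ⟨fun h' => h'.1 h, fun h' => h'.1 h⟩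
  · rintro ⟨h1, h2⟩
    by_contra hout
    obtain ⟨y, hy⟩ := hne
    have := closeSet_side A U C E hΔ hout hy
    have h3 : ¬ inner ℝ (gapVec A U (C + z • E) u₀ u₁) E < 0 := fun h => h1 ⟨hout, h⟩
    have h4 : ¬ 0 < inner ℝ (gapVec A U (C + z • E) u₀ u₁) E := fun h => h2 ⟨hout, h⟩
    have h5 : inner ℝ (gapVec A U (C + z • E) u₀ u₁) E = 0 := le_antisymm (not_lt.1 h4) (not_lt.1 h3)
    rw [h5] at this
    simp at this

end

/-- Quarter of the discriminant of the equation `‖P - (C + z • E)‖² = Δ²` in `z`. -/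
noncomputable def hitDisc (P C E : V) (Δ : ℝ) : ℝ :=
  inner ℝ (P - C) E * inner ℝ (P - C) E - inner ℝ E E * (inner ℝ (P - C) (P - C) - Δ * Δ)

open Classical in
/-- The smallest parameter in `[0, 1]` where `C + z • E` is `Δ`-close to `P` is the maximum of this
number and `0`; it is `2` if there is none. -/
noncomputable def hitLo (P C E : V) (Δ : ℝ) : ℝ :=
  if 0 < (inner ℝ E E : ℝ) then
    if 0 ≤ hitDisc P C E Δ then
      (inner ℝ (P - C) E - Real.sqrt (max 0 (hitDisc P C E Δ))) /
        (inner ℝ E E + ind (inner ℝ E E = (0 : ℝ)))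
    else 2
  else if inner ℝ (P - C) (P - C) ≤ Δ * Δ then 0 else 2

open Classical in
/-- The largest parameter in `[0, 1]` where `C + z • E` is `Δ`-close to `P` is the minimum of this
number and `1`; it is `-1` if there is none. -/
noncomputable def hitHi (P C E : V) (Δ : ℝ) : ℝ :=
  if 0 < (inner ℝ E E : ℝ) then
    if 0 ≤ hitDisc P C E Δ then
      (inner ℝ (P - C) E + Real.sqrt (max 0 (hitDisc P C E Δ))) /
        (inner ℝ E E + ind (inner ℝ E E = (0 : ℝ)))
    else 0 - 1
  else if inner ℝ (P - C) (P - C) ≤ Δ * Δ then 1 else 0 - 1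

/-- The close positions are the solutions of a quadratic inequality in `z`. The values `2` and `-1`
stand for an empty solution set: no `z` in `[0, 1]` satisfies the resulting bounds. -/
theorem dist_le_iff_hit (P C E : V) {Δ z : ℝ} (hΔ : 0 < Δ) (hz : z ∈ Icc (0 : ℝ) 1) :
    dist P (C + z • E) ≤ Δ ↔ hitLo P C E Δ ≤ z ∧ z ≤ hitHi P C E Δ := by
  have h0 : dist P (C + z • E) ≤ Δ ↔
      inner ℝ (P - C) (P - C) - 2 * z * inner ℝ (P - C) E + z * z * inner ℝ E E ≤ Δ * Δ := by
    rw [dist_eq_norm, ← sub_sub]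
    have : ‖P - C - z • E‖ * ‖P - C - z • E‖ =
        inner ℝ (P - C) (P - C) - 2 * z * inner ℝ (P - C) E + z * z * inner ℝ E E := by
      generalize P - C = W
      rw [← real_inner_self_eq_norm_mul_norm, inner_sub_left, inner_sub_right, inner_sub_right,
        inner_smul_left, inner_smul_right, inner_smul_left, inner_smul_right,
        real_inner_comm W E]
      simp; ring
    rw [← this]
    constructor
    · intro h; exact mul_self_le_mul_self (norm_nonneg _) h
    · intro h; exact abs_le_of_sq_le_sq' (by nlinarith) hΔ.le |>.2
  rw [h0]
  unfold hitLo hitHi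
  by_cases hE : 0 < (inner ℝ E E : ℝ)
  · simp only [hE, if_true]
    have hD : hitDisc P C E Δ =
      inner ℝ (P - C) E * inner ℝ (P - C) E - inner ℝ E E * (inner ℝ (P - C) (P - C) - Δ * Δ) := rfl
    set D := hitDisc P C E Δ
    set b : ℝ := inner ℝ (P - C) E
    set q : ℝ := inner ℝ (P - C) (P - C)
    set l : ℝ := inner ℝ E E
    -- Completing the square after multiplication by `l > 0`.
    have key : q - 2 * z * b + z * z * l ≤ Δ * Δ ↔ (l * z - b) ^ 2 ≤ D := by
      rw [hD]
      constructor
      · intro h; nlinarith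
      · intro h; nlinarith
    rw [key]
    by_cases hD0 : 0 ≤ D
    · simp only [hD0, if_true, max_eq_right, ind_false hE.ne', add_zero]
      rw [div_le_iff₀ hE, le_div_iff₀ hE, Real.sq_le hD0]
      constructor
      · rintro ⟨h1, h2⟩; exact ⟨by linarith, by linarith⟩
      · rintro ⟨h1, h2⟩; exact ⟨by linarith, by linarith⟩
    · simp only [hD0, if_false]
      constructor
      · intro h; nlinarith [sq_nonneg (l * z - b)]
      · rintro ⟨h1, h2⟩; linarith [hz.2]
  · simp only [hE, if_false]
    have hE0 : E = 0 := by
      by_contra h; exact hE (real_inner_self_pos.2 h)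
    subst hE0
    simp only [inner_zero_right, mul_zero, sub_zero, add_zero]
    split_ifs with h
    · exact ⟨fun _ => hz, fun _ => h⟩
    · constructor
      · exact fun h' => absurd h' h
      · rintro ⟨h1, h2⟩; linarith [hz.2]

end LineSegment

/-! ### Piecewise linear functions -/

/-- The function on `[0, 1]` that interpolates linearly between the values `s 0, …, s n` at the
points `0, 1 / n, …, 1`. -/
noncomputable def pwl (n : ℕ) (s : ℕ → ℝ) (u : ℝ) : ℝ :=
  s 0 + ∑ i ∈ Finset.range n, max 0 (min 1 (n * u - i)) * (s (i + 1) - s i)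

theorem pwl_eq {n : ℕ} (s : ℕ → ℝ) {u : ℝ} {i : ℕ} (hi : i < n) (h₀ : (i : ℝ) ≤ n * u)
    (h₁ : n * u ≤ i + 1) :
    pwl n s u = (1 - (n * u - i)) * s i + (n * u - i) * s (i + 1) := by
  -- The truncated factors are `1` for indices below `i` and `0` above it, so the partial sums
  -- telescope up to `i` and are constant after the `i`-th summand.
  have key : ∀ m, s 0 + ∑ i ∈ Finset.range m, max 0 (min 1 (n * u - i)) * (s (i + 1) - s i) =
      if m ≤ i then s m else (1 - (n * u - i)) * s i + (n * u - i) * s (i + 1) := by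
    intro m
    induction m with
    | zero => simp
    | succ m ih =>
      rw [Finset.sum_range_succ, ← add_assoc, ih]
      rcases lt_trichotomy m i with h | rfl | h
      · have : (m : ℝ) + 1 ≤ i := by exact_mod_cast h
        rw [if_pos h.le, if_pos (by omega), min_eq_left (by linarith), max_eq_right zero_le_one]
        ring
      · rw [if_pos le_rfl, if_neg (by omega), min_eq_right (by linarith),
          max_eq_right (by linarith)]
        ring
      · have : (i : ℝ) + 1 ≤ m := by exact_mod_cast h
        rw [if_neg (by omega), if_neg (by omega), max_eq_left]
        · ring
        · exact (min_le_right _ _).trans (by linarith)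
  rw [pwl, key n, if_neg (by omega)]

theorem exists_pwl_piece {n : ℕ} (hn : 0 < n) {u : ℝ} (hu : u ∈ Icc (0 : ℝ) 1) :
    ∃ i < n, (i : ℝ) ≤ n * u ∧ n * u ≤ i + 1 := by
  have h0 : 0 ≤ n * u := mul_nonneg (Nat.cast_nonneg _) hu.1
  by_cases h : ⌊n * u⌋₊ < n
  · exact ⟨_, h, Nat.floor_le h0, (Nat.lt_floor_add_one _).le⟩
  -- This happens only for `u = 1`, which belongs to the last piece.
  · have h1 : n * u ≤ n := mul_le_of_le_one_right (Nat.cast_nonneg _) hu.2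
    have h2 : (n : ℝ) ≤ n * u := (Nat.cast_le.2 (not_lt.1 h)).trans (Nat.floor_le h0)
    have h3 : ((n - 1 : ℕ) : ℝ) = n - 1 := by rw [Nat.cast_sub hn]; simp
    exact ⟨n - 1, by omega, by linarith, by linarith⟩

theorem le_of_forall_le_succ {n : ℕ} {s : ℕ → ℝ} (h : ∀ i < n, s i ≤ s (i + 1)) {i j : ℕ}
    (hij : i ≤ j) (hj : j ≤ n) : s i ≤ s j := by
  induction j, hij using Nat.le_induction with
  | base => exact le_rfl
  | succ j _ ih => exact (ih (by omega)).trans (h j (by omega))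

theorem pwl_zero {n : ℕ} (s : ℕ → ℝ) (hn : 0 < n) : pwl n s 0 = s 0 := by
  rw [pwl_eq s hn (by simp) (by simp)]; simp

theorem pwl_one {n : ℕ} (s : ℕ → ℝ) (hn : 0 < n) : pwl n s 1 = s n := by
  have h3 : ((n - 1 : ℕ) : ℝ) = n - 1 := by rw [Nat.cast_sub hn]; simp
  rw [pwl_eq s (show n - 1 < n by omega) (by rw [h3]; linarith) (by rw [h3]; linarith), h3,
    Nat.sub_add_cancel hn]
  ring

theorem continuous_pwl (n : ℕ) (s : ℕ → ℝ) : Continuous (pwl n s) := by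
  unfold pwl; fun_prop

theorem monotone_pwl {n : ℕ} {s : ℕ → ℝ} (h : ∀ i < n, s i ≤ s (i + 1)) : Monotone (pwl n s) := by
  intro u v huv
  refine add_le_add_right (Finset.sum_le_sum fun i hi => ?_) _
  refine mul_le_mul_of_nonneg_right ?_ (sub_nonneg.2 (h i (Finset.mem_range.1 hi)))
  gcongr

theorem image_pwl {n : ℕ} {s : ℕ → ℝ} (hn : 0 < n) (h : ∀ i < n, s i ≤ s (i + 1)) :
    pwl n s '' Icc 0 1 = Icc (s 0) (s n) := by
  refine Subset.antisymm ?_ ?_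
  · rintro _ ⟨u, hu, rfl⟩
    rw [← pwl_zero s hn, ← pwl_one s hn]
    exact ⟨monotone_pwl h hu.1, monotone_pwl h hu.2⟩
  · have := intermediate_value_Icc (zero_le_one (α := ℝ)) (continuous_pwl n s).continuousOn
    rwa [pwl_zero s hn, pwl_one s hn] at this

namespace PolygonalCurve

variable {d N : ℕ}

/-! ### Feasible sets in terms of free space intervals -/

/-- The vertices, indexed by natural numbers. -/
noncomputable def vert (S : PolygonalCurve d N) (a : ℕ) : EuclideanSpace ℝ (Fin d) :=
  if h : a < N + 1 then S.vertex ⟨a, h⟩ else 0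

/-- The vertex parameters, indexed by natural numbers. -/
noncomputable def par (S : PolygonalCurve d N) (a : ℕ) : ℝ :=
  if h : a < N + 1 then S.param ⟨a, h⟩ else 0

/-- The vector along the edge that starts at the `a`-th vertex. -/
noncomputable def dir (S : PolygonalCurve d N) (a : ℕ) : EuclideanSpace ℝ (Fin d) :=
  S.vert (a + 1) - S.vert a

/-- The position of `t` relative to the `w`-th edge, clamped to `[0, 1]`. -/
noncomputable def pos (S : PolygonalCurve d N) (w : ℕ) (t : ℝ) : ℝ :=
  max 0 (min 1 ((t - S.par w) / (S.par (w + 1) - S.par w)))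

/-- The positions on the `j`-th edge that are `Δ`-close to the part `[u₀, u₁]` of the `w`-th. -/
def near (S : PolygonalCurve d N) (Δ : ℝ) (j w : ℕ) (u₀ u₁ : ℝ) : Set ℝ :=
  closeSet (S.vert w) (S.dir w) (S.vert j) (S.dir j) u₀ u₁ Δ

/-- The start of the part of the `j`-th edge that is `Δ`-close to the `v`-th vertex. -/
noncomputable def lo (S : PolygonalCurve d N) (Δ : ℝ) (j v : ℕ) : ℝ :=
  hitLo (S.vert v) (S.vert j) (S.dir j) Δ

/-- The end of the part of the `j`-th edge that is `Δ`-close to the `v`-th vertex. -/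
noncomputable def hi (S : PolygonalCurve d N) (Δ : ℝ) (j v : ℕ) : ℝ :=
  hitHi (S.vert v) (S.vert j) (S.dir j) Δ

/-- There is an ascending sequence from `x` to `y` through the intervals `[lo v, hi v]`,
`k < v ≤ l`. -/
def Ascends (lo hi : ℕ → ℝ) (k l : ℕ) (x y : ℝ) : Prop :=
  x ≤ y ∧ ∀ v, k < v → v ≤ l → x ≤ hi v ∧ lo v ≤ y ∧ ∀ v', v ≤ v' → v' ≤ l → lo v ≤ hi v'

/-- There is a descending sequence from `x` to `y` through the intervals `[lo v, hi v]`,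
`k < v ≤ l`. -/
def Descends (lo hi : ℕ → ℝ) (k l : ℕ) (x y : ℝ) : Prop :=
  y ≤ x ∧ ∀ v, k < v → v ≤ l → y ≤ hi v ∧ lo v ≤ x ∧ ∀ v', v ≤ v' → v' ≤ l → lo v' ≤ hi v

/-- The subedge of the `j`-th edge from `x` to `y` can be traversed with a part of the curve that
contains `t`, starts on the `k`-th edge and ends on the `l`-th edge. -/
def CoversVia (S : PolygonalCurve d N) (Δ t : ℝ) (j k l : ℕ) (x y : ℝ) : Prop :=
  l < N ∧ S.par k ≤ t ∧ t ≤ S.par (l + 1) ∧ x ∈ S.near Δ j k 0 (S.pos k t) ∧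
    y ∈ S.near Δ j l (S.pos l t) 1 ∧
    (Ascends (S.lo Δ j) (S.hi Δ j) k l x y ∨ Descends (S.lo Δ j) (S.hi Δ j) k l x y)

/-- The subedge of the `j`-th edge from `x` to `y` can be traversed with a part of the curve that
contains `t` and has at most three edges. -/
def Covers (S : PolygonalCurve d N) (Δ t : ℝ) (j : ℕ) (x y : ℝ) : Prop :=
  ∃ k l, k ≤ l ∧ l ≤ k + 2 ∧ S.CoversVia Δ t j k l x y

theorem vert_eq (S : PolygonalCurve d N) (k : Fin (N + 1)) : S.vert k = S.vertex k := by
  rw [vert, dif_pos k.2]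

theorem par_eq (S : PolygonalCurve d N) (k : Fin (N + 1)) : S.par k = S.param k := by
  rw [par, dif_pos k.2]

theorem par_lt (S : PolygonalCurve d N) {a b : ℕ} (h : a < b) (hb : b ≤ N) :
    S.par a < S.par b := by
  rw [par, par, dif_pos (by omega), dif_pos (by omega)]
  exact S.param_strictMono (by simpa using h)

theorem par_le (S : PolygonalCurve d N) {a b : ℕ} (h : a ≤ b) (hb : b ≤ N) :
    S.par a ≤ S.par b := by
  rcases h.eq_or_lt with rfl | h
  · exact le_rfl
  · exact (S.par_lt h hb).le

theorem edge_eq (S : PolygonalCurve d N) (k : Fin N) (s : ℝ) :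
    S.edge k s = S.vert k + s • S.dir k := by
  have h1 : S.vertex k.castSucc = S.vert k := (S.vert_eq k.castSucc).symm
  have h2 : S.vertex k.succ = S.vert (k + 1) := (S.vert_eq k.succ).symm
  rw [edge, dir, h1, h2]
  module

theorem subedge_eq (S : PolygonalCurve d N) (x y : ℝ) (k : Fin N) (s : ℝ) :
    S.subedge (x, y, k) s = S.vert k + ((1 - s) * x + s * y) • S.dir k := by
  rw [subedge, edge_eq, edge_eq]
  module

theorem eval_eq (S : PolygonalCurve d N) {w : ℕ} (hw : w < N) {t : ℝ}
    (ht : t ∈ Icc (S.par w) (S.par (w + 1))) :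
    S.eval t = S.vert w + ((t - S.par w) / (S.par (w + 1) - S.par w)) • S.dir w := by
  have h1 : S.param (Fin.castSucc ⟨w, hw⟩) = S.par w := (S.par_eq (Fin.castSucc ⟨w, hw⟩)).symm
  have h2 : S.param (Fin.succ ⟨w, hw⟩) = S.par (w + 1) := (S.par_eq (Fin.succ ⟨w, hw⟩)).symm
  have := S.eval_eq_edge ⟨w, hw⟩ t (by rwa [h1, h2])
  rw [this, edge_eq, h1, h2]

theorem eval_add (S : PolygonalCurve d N) {w : ℕ} (hw : w < N) {u : ℝ} (hu : u ∈ Icc (0 : ℝ) 1) :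
    S.eval (S.par w + u * (S.par (w + 1) - S.par w)) = S.vert w + u • S.dir w := by
  have hpos := sub_pos.2 (S.par_lt (Nat.lt_succ_self w) (by omega : w + 1 ≤ N))
  rw [S.eval_eq hw ⟨by nlinarith [hu.1], by nlinarith [hu.2]⟩, add_sub_cancel_left,
    mul_div_cancel_right₀ _ hpos.ne']

theorem eval_par (S : PolygonalCurve d N) {v : ℕ} (hv : v < N) : S.eval (S.par v) = S.vert v := by
  simpa using S.eval_add hv (u := 0) (by simp)

/-- Straight segments within one edge stay close. -/
theorem dist_eval_le (S : PolygonalCurve d N) {w : ℕ} (hw : w < N) (j : ℕ) {s s' z z' θ Δ : ℝ}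
    (hs : s ∈ Icc (S.par w) (S.par (w + 1))) (hs' : s' ∈ Icc (S.par w) (S.par (w + 1)))
    (hθ : θ ∈ Icc (0 : ℝ) 1) (h : dist (S.eval s) (S.vert j + z • S.dir j) ≤ Δ)
    (h' : dist (S.eval s') (S.vert j + z' • S.dir j) ≤ Δ) :
    dist (S.eval ((1 - θ) * s + θ * s'))
      (S.vert j + ((1 - θ) * z + θ * z') • S.dir j) ≤ Δ := by
  have hm : (1 - θ) * s + θ * s' ∈ Icc (S.par w) (S.par (w + 1)) :=
    (convex_Icc _ _) hs hs' (by linarith [hθ.2]) hθ.1 (by ring)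
  rw [dist_eq_norm] at *
  rw [S.eval_eq hw hs] at h
  rw [S.eval_eq hw hs'] at h'
  rw [S.eval_eq hw hm]
  set q := S.par (w + 1) - S.par w
  have : S.vert w + (((1 - θ) * s + θ * s' - S.par w) / q) • S.dir w -
      (S.vert j + ((1 - θ) * z + θ * z') • S.dir j) =
      (1 - θ) • (S.vert w + ((s - S.par w) / q) • S.dir w - (S.vert j + z • S.dir j)) +
      θ • (S.vert w + ((s' - S.par w) / q) • S.dir w - (S.vert j + z' • S.dir j)) := by
    rw [show ((1 - θ) * s + θ * s' - S.par w) / q =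
      (1 - θ) * ((s - S.par w) / q) + θ * ((s' - S.par w) / q) by ring]
    module
  rw [this]
  refine (norm_add_le _ _).trans ?_
  rw [norm_smul, norm_smul, Real.norm_of_nonneg hθ.1, Real.norm_of_nonneg (by linarith [hθ.2])]
  nlinarith [hθ.1, hθ.2]

/-- Both curves are straight between consecutive nodes, so closeness at the nodes suffices by
`dist_eval_le`. The positions `z i` still have to be rewritten as parameters `γ i` of the subedge,
increasing from `0` to `1` for either orientation. -/
theorem exists_traversal (S : PolygonalCurve d N) {n k : ℕ} (hn : 0 < n) (hk : k + n ≤ N)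
    (j : Fin N) {s z : ℕ → ℝ} {Δ : ℝ} (hs : ∀ i < n, s i ≤ s (i + 1))
    (hs₁ : ∀ i < n, s i ∈ Icc (S.par (k + i)) (S.par (k + i + 1)))
    (hs₂ : ∀ i < n, s (i + 1) ∈ Icc (S.par (k + i)) (S.par (k + i + 1)))
    (hz : (∀ i < n, z i ≤ z (i + 1)) ∨ (∀ i < n, z (i + 1) ≤ z i))
    (hd : ∀ i ≤ n, dist (S.eval (s i)) (S.vert j + z i • S.dir j) ≤ Δ) :
    ∃ f g : ℝ → ℝ, S.IsPartialTraversal ⟨k, by omega⟩ ⟨k + n - 1, by omega⟩ (s 0) (s n) 0 1 f g ∧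
      ∀ u ∈ Icc (0 : ℝ) 1, dist (S.eval (f u)) (S.subedge (z 0, z n, j) (g u)) ≤ Δ := by
  have hγ : ∃ γ : ℕ → ℝ, γ 0 = 0 ∧ γ n = 1 ∧ (∀ i < n, γ i ≤ γ (i + 1)) ∧
      ∀ i ≤ n, z i = (1 - γ i) * z 0 + γ i * z n := by
    by_cases hxy : z 0 = z n
    -- The subedge is a single point, so any increasing `γ` with the right ends will do.
    · refine ⟨fun i => if i = 0 then 0 else 1, by simp, by simp [hn.ne'], fun i _ => ?_,
        fun i hi => ?_⟩
      · by_cases h : i = 0 <;> simp [h]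
      · have : z i = z 0 := by
          rcases hz with hz | hz
          · exact le_antisymm (hxy ▸ le_of_forall_le_succ hz hi le_rfl)
              (le_of_forall_le_succ hz (Nat.zero_le _) hi)
          · have hz' : ∀ i < n, -z i ≤ -z (i + 1) := fun i hi => neg_le_neg (hz i hi)
            have h1 := le_of_forall_le_succ (s := fun i => -z i) hz' hi le_rfl
            have h2 := le_of_forall_le_succ (s := fun i => -z i) hz' (Nat.zero_le _) hi
            linarith
        rw [this, ← hxy]; ring
    · have hne : z n - z 0 ≠ 0 := sub_ne_zero.2 (Ne.symm hxy)
      refine ⟨fun i => (z i - z 0) / (z n - z 0), by simp, div_self hne, fun i hi => ?_,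
        fun i _ => ?_⟩
      · rcases hz with hz | hz
        · have h1 := le_of_forall_le_succ hz (Nat.zero_le n) le_rfl
          exact div_le_div_of_nonneg_right (by linarith [hz i hi]) (by linarith)
        · have h1 := le_of_forall_le_succ (s := fun i => -z i)
            (fun i hi => neg_le_neg (hz i hi)) (Nat.zero_le n) le_rfl
          exact div_le_div_of_nonpos_of_le (by linarith) (by linarith [hz i hi])
      · field_simp; ring
  obtain ⟨γ, hγ0, hγ1, hγm, hγz⟩ := hγ
  have hle : s 0 ≤ s n := le_of_forall_le_succ hs (Nat.zero_le _) le_rfl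
  refine ⟨pwl n s, pwl n γ, ⟨?_, ?_, ?_, hle, le_rfl, zero_le_one, le_rfl,
    (continuous_pwl n s).continuousOn, (monotone_pwl hs).monotoneOn _, image_pwl hn hs,
    (continuous_pwl n γ).continuousOn, (monotone_pwl hγm).monotoneOn _, ?_⟩, ?_⟩
  · simp only [Fin.le_def]; omega
  · have := hs₁ 0 hn
    rw [← S.par_eq, ← S.par_eq]
    simpa using this
  · have := hs₂ (n - 1) (by omega)
    rw [← S.par_eq, ← S.par_eq]
    rw [show n - 1 + 1 = n by omega, show k + (n - 1) = k + n - 1 by omega] at this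
    exact this
  · rw [image_pwl hn hγm, hγ0, hγ1]
  · intro u hu
    obtain ⟨i, hi, h0, h1⟩ := exists_pwl_piece hn hu
    rw [subedge_eq, pwl_eq s hi h0 h1, pwl_eq γ hi h0 h1]
    set θ := n * u - i
    have : (1 - ((1 - θ) * γ i + θ * γ (i + 1))) * z 0 + ((1 - θ) * γ i + θ * γ (i + 1)) * z n =
        (1 - θ) * z i + θ * z (i + 1) := by
      rw [hγz i hi.le, hγz (i + 1) hi]; ring
    rw [this]
    exact S.dist_eval_le (w := k + i) (by omega) j (hs₁ i hi) (hs₂ i hi)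
      ⟨by simp only [θ]; linarith, by simp only [θ]; linarith⟩ (hd i hi.le) (hd (i + 1) hi)

/-- The greedy choice works: pass each vertex at the lowest height that is still possible, the
maximum of `x` and the lower ends so far. The pairwise inequalities `lo v ≤ hi v'` say that this
never overshoots a later interval. -/
theorem Ascends.exists_nodes {lo hi : ℕ → ℝ} {k l : ℕ} {x y : ℝ} (h : Ascends lo hi k l x y)
    (hkl : k ≤ l) :
    ∃ z : ℕ → ℝ, z 0 = x ∧ z (l + 1 - k) = y ∧ (∀ i < l + 1 - k, z i ≤ z (i + 1)) ∧
      (∀ i, x ≤ z i ∧ z i ≤ y) ∧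
      ∀ i, 0 < i → i < l + 1 - k → lo (k + i) ≤ z i ∧ z i ≤ hi (k + i) := by
  obtain ⟨hxy, h⟩ := h
  let zz : ℕ → ℝ := fun n => n.rec x fun m r => max r (lo (k + m + 1))
  have zz0 : zz 0 = x := rfl
  have zzs : ∀ m, zz (m + 1) = max (zz m) (lo (k + m + 1)) := fun m => rfl
  have hx : ∀ m, x ≤ zz m := by
    intro m
    induction m with
    | zero => exact le_rfl
    | succ m ih => rw [zzs]; exact ih.trans (le_max_left _ _)
  have hy : ∀ m, k + m ≤ l → zz m ≤ y := by
    intro m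
    induction m with
    | zero => exact fun _ => hxy
    | succ m ih =>
      intro hm
      rw [zzs]; exact max_le (ih (by omega)) (h _ (by omega) (by omega)).2.1
  have hh : ∀ m v, k + m ≤ v → k < v → v ≤ l → zz m ≤ hi v := by
    intro m
    induction m with
    | zero => exact fun v _ h1 h2 => (h v h1 h2).1
    | succ m ih =>
      intro v hm h1 h2
      rw [zzs]
      exact max_le (ih v (by omega) h1 h2) ((h (k + m + 1) (by omega) (by omega)).2.2 v hm h2)
  refine ⟨fun i => if k + i ≤ l then zz i else y, by simp [hkl, zz0], ?_, ?_, ?_, ?_⟩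
  · simp only; rw [if_neg (by omega)]
  · intro i hi
    simp only
    rw [if_pos (by omega)]
    split_ifs with h'
    · rw [zzs]; exact le_max_left _ _
    · exact hy i (by omega)
  · intro i
    simp only
    split_ifs with h'
    · exact ⟨hx i, hy i h'⟩
    · exact ⟨hxy, le_rfl⟩
  · intro i h0 hil
    simp only
    rw [if_pos (by omega)]
    obtain ⟨m, rfl⟩ : ∃ m, i = m + 1 := ⟨i - 1, by omega⟩
    exact ⟨by rw [zzs]; exact le_max_right _ _,
      hh (m + 1) (k + (m + 1)) le_rfl (by omega) (by omega)⟩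

/-- Negating all heights swaps the ends of the intervals and turns a descent into an ascent. -/
theorem Descends.exists_nodes {lo hi : ℕ → ℝ} {k l : ℕ} {x y : ℝ} (h : Descends lo hi k l x y)
    (hkl : k ≤ l) :
    ∃ z : ℕ → ℝ, z 0 = x ∧ z (l + 1 - k) = y ∧ (∀ i < l + 1 - k, z (i + 1) ≤ z i) ∧
      (∀ i, y ≤ z i ∧ z i ≤ x) ∧
      ∀ i, 0 < i → i < l + 1 - k → lo (k + i) ≤ z i ∧ z i ≤ hi (k + i) := by
  have h' : Ascends (fun v => -hi v) (fun v => -lo v) k l (-x) (-y) := by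
    refine ⟨neg_le_neg h.1, fun v h1 h2 => ?_⟩
    obtain ⟨h3, h4, h5⟩ := h.2 v h1 h2
    exact ⟨neg_le_neg h4, neg_le_neg h3, fun v' h6 h7 => neg_le_neg (h5 v' h6 h7)⟩
  obtain ⟨z, h1, h2, h3, h4, h5⟩ := h'.exists_nodes hkl
  refine ⟨fun i => -z i, by simp [h1], by simp [h2], fun i hi => neg_le_neg (h3 i hi),
    fun i => ⟨by linarith [(h4 i).2], by linarith [(h4 i).1]⟩, fun i h6 h7 => ?_⟩
  exact ⟨by linarith [(h5 i h6 h7).2], by linarith [(h5 i h6 h7).1]⟩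

/-- The nodes on the curve are a point `a ≤ t` of edge `k` close to `x`, the vertices `k + 1, …, l`,
and a point `b ≥ t` of edge `l` close to `y`. Their heights come from the ascending or descending
sequence. -/
theorem exists_traversal_of_coversVia (S : PolygonalCurve d N) {Δ t : ℝ} (hΔ : 0 < Δ) {k l : ℕ}
    (j : Fin N) {x y : ℝ} (hx : x ∈ Icc (0 : ℝ) 1) (hy : y ∈ Icc (0 : ℝ) 1) (hkl : k ≤ l)
    (h : S.CoversVia Δ t j k l x y) :
    ∃ (k' l' : Fin N) (a b : ℝ) (f g : ℝ → ℝ), (k' : ℕ) = k ∧ (l' : ℕ) = l ∧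
      S.IsPartialTraversal k' l' a b 0 1 f g ∧ t ∈ Icc a b ∧
      ∀ u ∈ Icc (0 : ℝ) 1, dist (S.eval (f u)) (S.subedge (x, y, j) (g u)) ≤ Δ := by
  obtain ⟨hl, hkt, htl, ⟨u, hu, hux⟩, ⟨v, hv, hvy⟩, hc⟩ := h
  have hposk := sub_pos.2 (S.par_lt (Nat.lt_succ_self k) (by omega : k + 1 ≤ N))
  have hposl := sub_pos.2 (S.par_lt (Nat.lt_succ_self l) (by omega : l + 1 ≤ N))
  have hu1 : u ≤ 1 := hu.2.trans (max_le zero_le_one (min_le_left _ _))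
  have hv0 : 0 ≤ v := (le_max_left _ _).trans hv.1
  -- Clamping in `pos` is harmless here: `t` is not before edge `k`, so the upper bound on `u` is at
  -- most the true relative position, and `t` is not after edge `l`, so the lower bound on `v` is at
  -- least the true one.
  have hut : u * (S.par (k + 1) - S.par k) ≤ t - S.par k := by
    rw [← le_div_iff₀ hposk]
    exact hu.2.trans (max_le (div_nonneg (by linarith) hposk.le) (min_le_right _ _))
  have hvt : t - S.par l ≤ v * (S.par (l + 1) - S.par l) := by
    rw [← div_le_iff₀ hposl]
    refine le_trans ?_ hv.1
    refine le_max_of_le_right (le_min ((div_le_one hposl).2 (by linarith)) le_rfl)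
  set a := S.par k + u * (S.par (k + 1) - S.par k) with ha
  set b := S.par l + v * (S.par (l + 1) - S.par l) with hb
  have hab : a ≤ b := by linarith
  have ha' : a ∈ Icc (S.par k) (S.par (k + 1)) := ⟨by nlinarith [hu.1], by nlinarith⟩
  have hb' : b ∈ Icc (S.par l) (S.par (l + 1)) := ⟨by nlinarith [hv.1], by nlinarith [hv.2]⟩
  have hz : ∃ z : ℕ → ℝ, z 0 = x ∧ z (l + 1 - k) = y ∧
      ((∀ i < l + 1 - k, z i ≤ z (i + 1)) ∨ (∀ i < l + 1 - k, z (i + 1) ≤ z i)) ∧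
      (∀ i, z i ∈ Icc (0 : ℝ) 1) ∧
      ∀ i, 0 < i → i < l + 1 - k → S.lo Δ j (k + i) ≤ z i ∧ z i ≤ S.hi Δ j (k + i) := by
    rcases hc with hc | hc
    · obtain ⟨z, h1, h2, h3, h4, h5⟩ := hc.exists_nodes hkl
      exact ⟨z, h1, h2, .inl h3, fun i => ⟨hx.1.trans (h4 i).1, (h4 i).2.trans hy.2⟩, h5⟩
    · obtain ⟨z, h1, h2, h3, h4, h5⟩ := hc.exists_nodes hkl
      exact ⟨z, h1, h2, .inr h3, fun i => ⟨hy.1.trans (h4 i).1, (h4 i).2.trans hx.2⟩, h5⟩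
  obtain ⟨z, hz0, hzn, hzm, hz01, hzv⟩ := hz
  set n := l + 1 - k with hn
  let s : ℕ → ℝ := fun i => if i = 0 then a else if i = n then b else S.par (k + i)
  have hs1 : ∀ i < n, s i ∈ Icc (S.par (k + i)) (S.par (k + i + 1)) := by
    intro i hi
    simp only [s]
    split_ifs with h1 h2
    · subst h1; exact ha'
    · omega
    · exact ⟨le_rfl, S.par_le (by omega) (by omega)⟩
  have hs2 : ∀ i < n, s (i + 1) ∈ Icc (S.par (k + i)) (S.par (k + i + 1)) := by
    intro i hi
    simp only [s]
    rw [if_neg (by omega)]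
    split_ifs with h2
    · rwa [show k + i = l by omega]
    · exact ⟨S.par_le (by omega) (by omega), le_rfl⟩
  have hsm : ∀ i < n, s i ≤ s (i + 1) := by
    intro i hi
    by_cases h0 : i = 0
    · subst h0
      by_cases h1 : 0 + 1 = n
      · simpa [s, ← h1] using hab
      · simpa [s, h1] using ha'.2
    · have h1 : s i = S.par (k + i) := by simp only [s]; rw [if_neg h0, if_neg (by omega)]
      rw [h1]; exact (hs2 i hi).1
  have hd : ∀ i ≤ n, dist (S.eval (s i)) (S.vert j + z i • S.dir j) ≤ Δ := by
    intro i hi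
    by_cases h0 : i = 0
    · subst h0
      simp only [s, if_true, hz0]
      rw [ha, S.eval_add (by omega) ⟨hu.1, hu1⟩]
      exact hux
    by_cases h1 : i = n
    · subst h1
      simp only [s, if_true, hzn, h0, if_false]
      rw [hb, S.eval_add (by omega) ⟨hv0, hv.2⟩]
      exact hvy
    simp only [s, h0, h1, if_false]
    rw [S.eval_par (by omega)]
    exact (dist_le_iff_hit _ _ _ hΔ (hz01 i)).2 (hzv i (by omega) (by omega))
  obtain ⟨f, g, hfg, hfd⟩ := S.exists_traversal (k := k) (by omega) (by omega) j hsm hs1 hs2 hzm hd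
  refine ⟨_, _, _, _, f, g, rfl, by simp only; omega, hfg, ?_, ?_⟩
  · have e1 : s 0 = a := by simp [s]
    have e2 : s n = b := by simp only [s, if_true]; rw [if_neg (by omega)]
    rw [e1, e2]
    exact ⟨by linarith, by linarith⟩
  · rwa [hz0, hzn] at hfd

/-- Monotone surjections onto intervals map ends to ends, which gives the conditions on `x` and `y`.
By surjectivity the traversal stops at each vertex `v` with `k < v ≤ l`, at a height in `[lo v, hi
v]`, and monotonicity orders these heights along the subedge. -/
theorem coversVia_of_traversal (S : PolygonalCurve d N) {Δ t : ℝ} (hΔ : 0 < Δ) {k l : Fin N}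
    (j : Fin N) {x y a b : ℝ} (hx : x ∈ Icc (0 : ℝ) 1) (hy : y ∈ Icc (0 : ℝ) 1) {f g : ℝ → ℝ}
    (h : S.IsPartialTraversal k l a b 0 1 f g) (ht : t ∈ Icc a b)
    (hd : ∀ u ∈ Icc (0 : ℝ) 1, dist (S.eval (f u)) (S.subedge (x, y, j) (g u)) ≤ Δ) :
    S.CoversVia Δ t j k l x y := by
  have ends : ∀ {φ : ℝ → ℝ} {p q : ℝ}, p ≤ q → MonotoneOn φ (Icc 0 1) → φ '' Icc 0 1 = Icc p q →
      φ 0 = p ∧ φ 1 = q := by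
    intro φ p q hpq hm hi
    have m0 : (0 : ℝ) ∈ Icc (0 : ℝ) 1 := by simp
    have m1 : (1 : ℝ) ∈ Icc (0 : ℝ) 1 := by simp
    have i0 : φ 0 ∈ Icc p q := hi ▸ mem_image_of_mem φ m0
    have i1 : φ 1 ∈ Icc p q := hi ▸ mem_image_of_mem φ m1
    obtain ⟨u, hu, hup⟩ : p ∈ φ '' Icc 0 1 := hi ▸ ⟨le_rfl, hpq⟩
    obtain ⟨v, hv, hvq⟩ : q ∈ φ '' Icc 0 1 := hi ▸ ⟨hpq, le_rfl⟩
    exact ⟨le_antisymm (hup ▸ hm m0 hu hu.1) i0.1, le_antisymm i1.2 (hvq ▸ hm hv m1 hv.2)⟩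
  obtain ⟨hf0, hf1⟩ := ends h.le₁ h.monotoneOn₁ h.image₁
  obtain ⟨hg0, hg1⟩ := ends zero_le_one h.monotoneOn₂ h.image₂
  have hposk := sub_pos.2 (S.par_lt (Nat.lt_succ_self k) (by omega : (k : ℕ) + 1 ≤ N))
  have hposl := sub_pos.2 (S.par_lt (Nat.lt_succ_self l) (by omega : (l : ℕ) + 1 ≤ N))
  have ha : a ∈ Icc (S.par k) (S.par (k + 1)) := by
    have := h.start_mem
    rwa [← S.par_eq, ← S.par_eq] at this
  have hb : b ∈ Icc (S.par l) (S.par (l + 1)) := by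
    have := h.end_mem
    rwa [← S.par_eq, ← S.par_eq] at this
  have hkl : (k : ℕ) ≤ l := h.edge_le
  simp only [subedge_eq] at hd
  have hd0 := hd 0 (by simp)
  have hd1 := hd 1 (by simp)
  rw [hf0, hg0, S.eval_eq (by omega) ha] at hd0
  rw [hf1, hg1, S.eval_eq (by omega) hb] at hd1
  refine ⟨l.2, ha.1.trans ht.1, ht.2.trans hb.2, ⟨_, ⟨?_, ?_⟩, by simpa using hd0⟩,
    ⟨_, ⟨?_, ?_⟩, by simpa using hd1⟩, ?_⟩
  · exact div_nonneg (by linarith [ha.1]) hposk.le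
  · refine le_max_of_le_right (le_min ((div_le_one hposk).2 (by linarith [ha.2])) ?_)
    exact div_le_div_of_nonneg_right (by linarith [ht.1]) hposk.le
  · refine max_le (div_nonneg (by linarith [hb.1]) hposl.le) ((min_le_right _ _).trans ?_)
    exact div_le_div_of_nonneg_right (by linarith [ht.2]) hposl.le
  · exact (div_le_one hposl).2 (by linarith [hb.2])
  -- the heights at which the vertices are passed
  have hnode : ∀ v, (k : ℕ) < v → v ≤ l → ∃ u ∈ Icc (0 : ℝ) 1, f u = S.par v := by
    intro v h1 h2
    have : S.par v ∈ f '' Icc 0 1 := by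
      rw [h.image₁]
      exact ⟨ha.2.trans (S.par_le h1 (by omega)), (S.par_le h2 (by omega)).trans hb.1⟩
    exact this
  have hg01 : ∀ u ∈ Icc (0 : ℝ) 1, g u ∈ Icc (0 : ℝ) 1 := fun u hu =>
    h.image₂ ▸ mem_image_of_mem g hu
  have hhit : ∀ v, (k : ℕ) < v → v ≤ l → ∀ u ∈ Icc (0 : ℝ) 1, f u = S.par v →
      S.lo Δ j v ≤ (1 - g u) * x + g u * y ∧ (1 - g u) * x + g u * y ≤ S.hi Δ j v := by
    intro v h1 h2 u hu huv
    refine (dist_le_iff_hit _ _ _ hΔ ?_).1 ?_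
    · have := hg01 u hu
      exact (convex_Icc _ _) hx hy (by linarith [this.2]) this.1 (by ring)
    · have := hd u hu
      rwa [huv, S.eval_par (by omega)] at this
  have hord : ∀ v v', (k : ℕ) < v → v ≤ v' → v' ≤ l → ∃ u ∈ Icc (0 : ℝ) 1, ∃ u' ∈ Icc (0 : ℝ) 1,
      f u = S.par v ∧ f u' = S.par v' ∧ g u ≤ g u' := by
    intro v v' h1 h2 h3
    obtain ⟨u, hu, huv⟩ := hnode v h1 (by omega)
    -- For `v = v'` the same moment is used twice; for `v < v'` the strict order of the vertex
    -- parameters forces the order of the moments.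
    rcases h2.eq_or_lt with rfl | h2
    · exact ⟨u, hu, u, hu, huv, huv, le_rfl⟩
    obtain ⟨u', hu', huv'⟩ := hnode v' (by omega) h3
    refine ⟨u, hu, u', hu', huv, huv', h.monotoneOn₂ hu hu' ?_⟩
    by_contra hcon
    have h4 := h.monotoneOn₁ hu' hu (not_le.1 hcon).le
    have h5 := S.par_lt h2 (by omega)
    linarith
  rcases le_total x y with hxy | hxy
  · refine .inl ⟨hxy, fun v h1 h2 => ?_⟩
    obtain ⟨u, hu, huv⟩ := hnode v h1 h2
    obtain ⟨h3, h4⟩ := hhit v h1 h2 u hu huv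
    obtain ⟨g0, g1⟩ := hg01 u hu
    refine ⟨by nlinarith, by nlinarith, fun v' h5 h6 => ?_⟩
    obtain ⟨u, hu, u', hu', e1, e2, e3⟩ := hord v v' h1 h5 h6
    have h7 := (hhit v h1 h2 u hu e1).1
    have h8 := (hhit v' (by omega) h6 u' hu' e2).2
    nlinarith
  · refine .inr ⟨hxy, fun v h1 h2 => ?_⟩
    obtain ⟨u, hu, huv⟩ := hnode v h1 h2
    obtain ⟨h3, h4⟩ := hhit v h1 h2 u hu huv
    obtain ⟨g0, g1⟩ := hg01 u hu
    refine ⟨by nlinarith, by nlinarith, fun v' h5 h6 => ?_⟩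
    obtain ⟨u, hu, u', hu', e1, e2, e3⟩ := hord v v' h1 h5 h6
    have h7 := (hhit v h1 h2 u hu e1).2
    have h8 := (hhit v' (by omega) h6 u' hu' e2).1
    nlinarith

theorem mem_feasibleSet_iff (S : PolygonalCurve d N) {Δ t : ℝ} (hΔ : 0 < Δ) (j : Fin N) {x y : ℝ}
    (hx : x ∈ Icc (0 : ℝ) 1) (hy : y ∈ Icc (0 : ℝ) 1) (hz : (x, y, j) ∈ S.approxCandidates Δ) :
    (x, y, j) ∈ S.feasibleSet Δ t ↔ S.Covers Δ t j x y := by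
  constructor
  · rintro ⟨-, k, l, a, b, f, g, h1, h2, h3, h4⟩
    exact ⟨k, l, h1.edge_le, h2, S.coversVia_of_traversal hΔ j hx hy h1 h3 h4⟩
  · rintro ⟨k, l, h1, h2, h3⟩
    obtain ⟨k', l', a, b, f, g, rfl, rfl, h4, h5, h6⟩ :=
      S.exists_traversal_of_coversVia hΔ j hx hy h1 h3
    exact ⟨hz, k', l', a, b, f, g, h4, h2, h5, h6⟩

end PolygonalCurve

namespace PolygonalCurve

variable {d N : ℕ}

/-! ### The grid, indexed by natural numbers -/

/-- The length of the `j`-th edge. -/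
noncomputable def len (S : PolygonalCurve d N) (j : ℕ) : ℝ :=
  Real.sqrt (inner ℝ (S.dir j) (S.dir j))

open Classical in
/-- The distance between consecutive grid points of the `j`-th edge. -/
noncomputable def step (S : PolygonalCurve d N) (Δ : ℝ) (j : ℕ) : ℝ :=
  if 0 < S.len j then Δ / (S.len j + ind (S.len j = 0)) else 1

/-- The grid points of the `j`-th edge. -/
noncomputable def gridVal (S : PolygonalCurve d N) (Δ : ℝ) (j a : ℕ) : ℝ := min 1 (a * S.step Δ j)

/-- The number of grid points of the `j`-th edge. -/
noncomputable def gridCount (S : PolygonalCurve d N) (Δ : ℝ) (j : ℕ) : ℕ := ⌈1 / S.step Δ j⌉₊ + 1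

variable (S : PolygonalCurve d N) {Δ : ℝ} (j : ℕ)

theorem len_nonneg : 0 ≤ S.len j := Real.sqrt_nonneg _

theorem len_eq (k : Fin N) : S.len k = S.edgeLength k := by
  have h1 : S.vertex k.castSucc = S.vert k := (S.vert_eq k.castSucc).symm
  have h2 : S.vertex k.succ = S.vert (k + 1) := (S.vert_eq k.succ).symm
  rw [len, real_inner_self_eq_norm_sq, Real.sqrt_sq (norm_nonneg _), edgeLength, h1, h2,
    dist_comm, dist_eq_norm, dir]

theorem len_le {j : ℕ} (hj : j < N) : S.len j ≤ S.maxEdgeLength := by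
  have := S.len_eq ⟨j, hj⟩
  simp only at this
  rw [this]
  exact le_ciSup (f := fun k => S.edgeLength k) (Finite.bddAbove_range _) _

theorem step_of_pos (h : 0 < S.len j) : S.step Δ j = Δ / S.len j := by
  rw [step, if_pos h, ind_false h.ne', add_zero]

theorem step_of_zero (h : ¬ 0 < S.len j) : S.step Δ j = 1 := by rw [step, if_neg h]

theorem step_pos (hΔ : 0 < Δ) : 0 < S.step Δ j := by
  by_cases h : 0 < S.len j
  · rw [S.step_of_pos j h]; exact div_pos hΔ h
  · rw [S.step_of_zero j h]; exact one_pos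

theorem gridVal_mem (hΔ : 0 < Δ) (a : ℕ) : S.gridVal Δ j a ∈ Icc (0 : ℝ) 1 :=
  ⟨le_min zero_le_one (mul_nonneg (Nat.cast_nonneg _) (S.step_pos j hΔ).le), min_le_left _ _⟩

theorem gridVal_mono (hΔ : 0 < Δ) : Monotone (S.gridVal Δ j) := fun _ _ hab =>
  min_le_min_left _ (mul_le_mul_of_nonneg_right (Nat.cast_le.2 hab) (S.step_pos j hΔ).le)

/-- Only the last grid point can be affected by the truncation at `1`; this makes the grid values
distinct. -/
theorem mul_step_lt (hΔ : 0 < Δ) {a : ℕ} (ha : a + 1 < S.gridCount Δ j) : a * S.step Δ j < 1 := by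
  rw [← lt_div_iff₀ (S.step_pos j hΔ)]
  exact Nat.lt_ceil.1 (by rw [gridCount] at ha; omega)

theorem gridVal_lt (hΔ : 0 < Δ) {a b : ℕ} (hab : a < b) (hb : b < S.gridCount Δ j) :
    S.gridVal Δ j a < S.gridVal Δ j b := by
  have h := S.mul_step_lt j hΔ (a := a) (by omega)
  have hs := S.step_pos j hΔ
  rw [gridVal, min_eq_right h.le]
  refine lt_min h (mul_lt_mul_of_pos_right (by exact_mod_cast hab) hs)

theorem gridVal_le_iff (hΔ : 0 < Δ) {a b : ℕ} (ha : a < S.gridCount Δ j) :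
    S.gridVal Δ j a ≤ S.gridVal Δ j b ↔ a ≤ b := by
  refine ⟨fun h => ?_, fun h => S.gridVal_mono j hΔ h⟩
  by_contra hcon
  exact absurd h (not_le.2 (S.gridVal_lt j hΔ (not_le.1 hcon) ha))

theorem gridVal_inj (hΔ : 0 < Δ) {a b : ℕ} (ha : a < S.gridCount Δ j)
    (hb : b < S.gridCount Δ j) (h : S.gridVal Δ j a = S.gridVal Δ j b) : a = b :=
  le_antisymm ((S.gridVal_le_iff j hΔ ha).1 h.le) ((S.gridVal_le_iff j hΔ hb).1 h.ge)

theorem grid_eq (hΔ : 0 < Δ) (k : Fin N) :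
    S.grid Δ k = {x | ∃ a < S.gridCount Δ k, x = S.gridVal Δ k a} := by
  have hs := S.step_pos k hΔ
  have htop : S.gridVal Δ k (S.gridCount Δ k - 1) = 1 := by
    rw [gridVal, gridCount, Nat.add_sub_cancel, min_eq_left]
    rw [← div_le_iff₀ hs]
    exact Nat.le_ceil _
  ext x
  simp only [grid, mem_union, mem_inter_iff, mem_ofPred_eq, mem_singleton_iff]
  constructor
  · rintro (⟨hx, a, rfl⟩ | rfl)
    · by_cases h : 0 < S.len k
      · have hst : Δ / S.edgeLength k = S.step Δ k := by rw [← S.len_eq, S.step_of_pos _ h]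
        rw [hst] at hx ⊢
        have ha : 0 ≤ a := by
          have := nonneg_of_mul_nonneg_left hx.1 hs
          exact_mod_cast this
        obtain ⟨b, rfl⟩ := Int.eq_ofNat_of_zero_le ha
        refine ⟨b, ?_, ?_⟩
        · have : (b : ℝ) ≤ 1 / S.step Δ k := (le_div_iff₀ hs).2 (by simpa using hx.2)
          rw [gridCount, Nat.lt_succ_iff]
          exact_mod_cast this.trans (Nat.le_ceil _)
        · rw [gridVal, min_eq_right (by simpa using hx.2)]; simp
      -- Here `Δ / 0 = 0`, so the only multiple is `0`. The value `1` of `step` yields the two grid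
      -- points `0` and `1`, as required.
      · have : S.edgeLength k = 0 := by
          rw [← S.len_eq]; exact le_antisymm (not_lt.1 h) (S.len_nonneg _)
        refine ⟨0, by rw [gridCount]; omega, by simp [this, gridVal]⟩
    · exact ⟨S.gridCount Δ k - 1, by rw [gridCount]; omega, htop.symm⟩
  · rintro ⟨a, ha, rfl⟩
    by_cases ha1 : a + 1 < S.gridCount Δ k
    · left
      have h1 := S.mul_step_lt k hΔ ha1
      refine ⟨S.gridVal_mem k hΔ a, ?_⟩
      rw [gridVal, min_eq_right h1.le]
      by_cases h : 0 < S.len k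
      · exact ⟨a, by rw [S.step_of_pos _ h, S.len_eq]; simp⟩
      · rw [S.step_of_zero _ h] at h1 ⊢
        have : a = 0 := by
          have : a < 1 := by exact_mod_cast (by simpa using h1 : (a : ℝ) < 1)
          omega
        subst this
        exact ⟨0, by simp⟩
    · right
      rw [← htop]
      congr 1
      omega

/-- The search for the last grid point finds it. -/
theorem gridCount_eq (hΔ : 0 < Δ) {p : ℕ} (h₁ : p = 0 ∨ ((p : ℝ) - 1) * Δ < S.len j ∨ (p : ℝ) ≤ 1)
    (h₂ : ¬ ((((p + 1 : ℕ) : ℝ) - 1) * Δ < S.len j ∨ ((p + 1 : ℕ) : ℝ) ≤ 1)) :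
    S.gridCount Δ j = p + 1 := by
  rw [gridCount]
  congr 1
  push_cast at h₂
  push Not at h₂
  have hp : 0 < p := by
    rcases Nat.eq_zero_or_pos p with rfl | h
    · simp at h₂
    · exact h
  -- It remains to show `p - 1 < 1 / step ≤ p`. For an edge of positive length, `1 / step` is the
  -- length divided by `Δ`; for length `0` it is `1`, and the alternative `p ≤ 1` in the search test
  -- leads to `p = 1`.
  rw [Nat.ceil_eq_iff hp.ne']
  rw [show ((p - 1 : ℕ) : ℝ) = p - 1 by rw [Nat.cast_sub hp]; simp]
  by_cases h : 0 < S.len j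
  · rw [S.step_of_pos j h, one_div_div, lt_div_iff₀ hΔ, div_le_iff₀ hΔ]
    refine ⟨?_, by linarith [h₂.1]⟩
    rcases h₁ with rfl | h₁ | h₁
    · exact absurd hp (lt_irrefl _)
    · exact h₁
    · have : (p : ℝ) = 1 := le_antisymm h₁ (by exact_mod_cast hp)
      rw [this]; simpa using h
  · rw [S.step_of_zero j h]
    have : (p : ℝ) ≤ 1 := by
      rcases h₁ with rfl | h₁ | h₁
      · simp
      · by_contra hcon
        have h3 : S.len j ≤ 0 := not_lt.1 h
        nlinarith
      · exact h₁
    have h3 : (1 : ℝ) ≤ p := by exact_mod_cast hp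
    simp
    constructor <;> linarith

theorem gridCount_le (hΔ : 0 < Δ) {j : ℕ} (hj : j < N) :
    (S.gridCount Δ j : ℝ) ≤ S.maxEdgeLength / Δ + 3 := by
  have hm := S.len_le hj
  have h0 := S.len_nonneg j
  have hs : 1 / S.step Δ j ≤ S.maxEdgeLength / Δ + 1 := by
    by_cases h : 0 < S.len j
    · rw [S.step_of_pos j h, one_div_div]
      have := div_le_div_of_nonneg_right hm hΔ.le
      linarith
    · rw [S.step_of_zero j h]
      have : 0 ≤ S.maxEdgeLength / Δ := div_nonneg (by linarith) hΔ.le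
      linarith
  have := (Nat.ceil_lt_add_one (one_div_nonneg.2 (S.step_pos j hΔ).le)).le
  rw [gridCount]
  push_cast
  linarith

/-! ### Breakpoints -/

/-- `p` separates the numbers below `c` that satisfy `T` from those that do not. -/
def IsSplit (T : ℕ → Prop) (c p : ℕ) : Prop := p ≤ c ∧ (p = 0 ∨ T (p - 1)) ∧ (p = c ∨ ¬ T p)

/-- `IsSplit` only looks at the neighbours `p - 1` and `p`, which is what a binary search guarantees
for any `T`. Monotonicity extends this to all indices. -/
theorem IsSplit.iff_lt {T : ℕ → Prop} {c p : ℕ} (h : IsSplit T c p)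
    (hT : ∀ a b, a ≤ b → T b → T a) {x : ℕ} (hx : x < c) : T x ↔ ¬ p ≤ x := by
  obtain ⟨h1, h2, h3⟩ := h
  constructor
  · intro hTx hpx
    rcases h3 with rfl | h3
    · omega
    · exact h3 (hT _ _ hpx hTx)
  · intro hpx
    rcases h2 with rfl | h2
    · omega
    · exact hT _ _ (by omega) h2

/-- The conditions on a grid point that determine the boundary of a feasible set. -/
def boundaryTest (S : PolygonalCurve d N) (Δ t : ℝ) (j w : ℕ) (i : Fin 6) (z : ℝ) : Prop :=
  match i with
  | 0 => IsBelow (S.vert w) (S.dir w) (S.vert j) (S.dir j) 0 (S.pos w t) Δ z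
  | 1 => ¬ IsAbove (S.vert w) (S.dir w) (S.vert j) (S.dir j) 0 (S.pos w t) Δ z
  | 2 => IsBelow (S.vert w) (S.dir w) (S.vert j) (S.dir j) (S.pos w t) 1 Δ z
  | 3 => ¬ IsAbove (S.vert w) (S.dir w) (S.vert j) (S.dir j) (S.pos w t) 1 Δ z
  | 4 => z < S.lo Δ j w
  | 5 => z ≤ S.hi Δ j w

/-- `τ` is an edge whose parameter interval contains `t`, the last one if there are two. -/
def IsLoc (S : PolygonalCurve d N) (t : ℝ) (τ : ℕ) : Prop :=
  τ < N ∧ S.par τ ≤ t ∧ (τ + 1 = N ∨ t < S.par (τ + 1))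

/-- `s` contains all breakpoints of the feasible set of `t` on the `j`-th edge. -/
def HasSplits (S : PolygonalCurve d N) (Δ t : ℝ) (j τ : ℕ) (s : Set ℕ) : Prop :=
  ∀ w < N, τ ≤ w + 3 → w ≤ τ + 2 → ∀ i, ∃ p ∈ s,
    IsSplit (fun a => S.boundaryTest Δ t j w i (S.gridVal Δ j a)) (S.gridCount Δ j) p

/-- No element of `s` separates `x` from `x'`. -/
def SameCell (s : Set ℕ) (x x' : ℕ) : Prop := ∀ p ∈ s, p ≤ x ↔ p ≤ x'

theorem SameCell.symm {s : Set ℕ} {x x' : ℕ} (h : SameCell s x x') : SameCell s x' x :=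
  fun p hp => (h p hp).symm

theorem SameCell.trans {s : Set ℕ} {x x' x'' : ℕ} (h : SameCell s x x') (h' : SameCell s x' x'') :
    SameCell s x x'' :=
  fun p hp => (h p hp).trans (h' p hp)

theorem pos_mem (w : ℕ) (t : ℝ) : S.pos w t ∈ Icc (0 : ℝ) 1 :=
  ⟨le_max_left _ _, max_le zero_le_one (min_le_left _ _)⟩

/-! ### Constancy of feasible sets on products of cells -/

section

variable {S j} {t : ℝ} {τ : ℕ} {s : Set ℕ} {x x' y y' : ℕ}

/-- Being close means being neither below nor above, and each of these two monotone tests is decided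
by one breakpoint. -/
theorem HasSplits.mem_near_iff (h : S.HasSplits Δ t j τ s) (hΔ : 0 < Δ) {w : ℕ} (hw : w < N)
    (h1 : τ ≤ w + 3) (h2 : w ≤ τ + 2) (hxx : SameCell s x x') (hx : x < S.gridCount Δ j)
    (hx' : x' < S.gridCount Δ j) :
    (S.gridVal Δ j x ∈ S.near Δ j w 0 (S.pos w t) ↔
      S.gridVal Δ j x' ∈ S.near Δ j w 0 (S.pos w t)) ∧
    (S.gridVal Δ j x ∈ S.near Δ j w (S.pos w t) 1 ↔
      S.gridVal Δ j x' ∈ S.near Δ j w (S.pos w t) 1) := by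
  have aux : ∀ (u₀ u₁ : ℝ) (i i' : Fin 6), u₀ ≤ u₁ →
      (∀ z, S.boundaryTest Δ t j w i z ↔
        IsBelow (S.vert w) (S.dir w) (S.vert j) (S.dir j) u₀ u₁ Δ z) →
      (∀ z, S.boundaryTest Δ t j w i' z ↔
        ¬ IsAbove (S.vert w) (S.dir w) (S.vert j) (S.dir j) u₀ u₁ Δ z) →
      (S.gridVal Δ j x ∈ S.near Δ j w u₀ u₁ ↔ S.gridVal Δ j x' ∈ S.near Δ j w u₀ u₁) := by
    intro u₀ u₁ i i' hu hi hi'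
    by_cases hne : (S.near Δ j w u₀ u₁).Nonempty
    · obtain ⟨p, hp, hs⟩ := h w hw h1 h2 i
      obtain ⟨p', hp', hs'⟩ := h w hw h1 h2 i'
      simp only [hi] at hs
      simp only [hi'] at hs'
      have ha : ∀ a b, a ≤ b →
          IsBelow (S.vert w) (S.dir w) (S.vert j) (S.dir j) u₀ u₁ Δ (S.gridVal Δ j b) →
          IsBelow (S.vert w) (S.dir w) (S.vert j) (S.dir j) u₀ u₁ Δ (S.gridVal Δ j a) :=
        fun a b hab hb => hb.anti hΔ hu hne (S.gridVal_mono j hΔ hab)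
      have ha' : ∀ a b, a ≤ b →
          ¬ IsAbove (S.vert w) (S.dir w) (S.vert j) (S.dir j) u₀ u₁ Δ (S.gridVal Δ j b) →
          ¬ IsAbove (S.vert w) (S.dir w) (S.vert j) (S.dir j) u₀ u₁ Δ (S.gridVal Δ j a) :=
        fun a b hab hb hcon => hb (hcon.mono hΔ hu hne (S.gridVal_mono j hΔ hab))
      rw [near, mem_closeSet_iff_not hΔ hu hne, mem_closeSet_iff_not hΔ hu hne,
        hs.iff_lt ha hx, hs.iff_lt ha hx', hs'.iff_lt ha' hx, hs'.iff_lt ha' hx', hxx p hp,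
        hxx p' hp']
    -- With no close position the tests may fail to be monotone and the computed breakpoints are
    -- meaningless, but both sides are false.
    · exact ⟨fun h' => absurd ⟨_, h'⟩ hne, fun h' => absurd ⟨_, h'⟩ hne⟩
  exact ⟨aux 0 _ 0 1 (S.pos_mem w t).1 (fun _ => Iff.rfl) (fun _ => Iff.rfl),
    aux _ 1 2 3 (S.pos_mem w t).2 (fun _ => Iff.rfl) (fun _ => Iff.rfl)⟩

theorem HasSplits.le_hi_iff (h : S.HasSplits Δ t j τ s) (hΔ : 0 < Δ) {w : ℕ} (hw : w < N)
    (h1 : τ ≤ w + 3) (h2 : w ≤ τ + 2) (hxx : SameCell s x x') (hx : x < S.gridCount Δ j)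
    (hx' : x' < S.gridCount Δ j) :
    (S.gridVal Δ j x ≤ S.hi Δ j w ↔ S.gridVal Δ j x' ≤ S.hi Δ j w) ∧
    (S.lo Δ j w ≤ S.gridVal Δ j x ↔ S.lo Δ j w ≤ S.gridVal Δ j x') := by
  obtain ⟨p, hp, hs⟩ := h w hw h1 h2 4
  obtain ⟨p', hp', hs'⟩ := h w hw h1 h2 5
  simp only [boundaryTest] at hs hs'
  have ha : ∀ a b, a ≤ b → S.gridVal Δ j b < S.lo Δ j w → S.gridVal Δ j a < S.lo Δ j w :=
    fun a b hab hb => (S.gridVal_mono j hΔ hab).trans_lt hb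
  have ha' : ∀ a b, a ≤ b → S.gridVal Δ j b ≤ S.hi Δ j w → S.gridVal Δ j a ≤ S.hi Δ j w :=
    fun a b hab hb => (S.gridVal_mono j hΔ hab).trans hb
  rw [← not_lt (a := S.gridVal Δ j x) (b := S.lo Δ j w),
    ← not_lt (a := S.gridVal Δ j x') (b := S.lo Δ j w), hs.iff_lt ha hx, hs.iff_lt ha hx', hs'.iff_lt ha' hx,
    hs'.iff_lt ha' hx', hxx p hp, hxx p' hp']
  exact ⟨Iff.rfl, Iff.rfl⟩

/-- The bound is `τ ≤ l + 1` and not `τ ≤ l`, because `t` may be the end of edge `l`, which is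
assigned to the next edge. Together with `l ≤ k + 2`, all edges from `k` to `l` are among the six
edges from `τ - 3` to `τ + 2`. -/
theorem IsLoc.window (hτ : S.IsLoc t τ) {k l : ℕ} (hkl : k ≤ l) (hlk : l ≤ k + 2)
    (hl : l < N) (hk : S.par k ≤ t) (ht : t ≤ S.par (l + 1)) : k ≤ τ ∧ τ ≤ l + 1 := by
  obtain ⟨h1, h2, h3⟩ := hτ
  constructor
  · by_contra hcon
    rcases h3 with h3 | h3
    · omega
    · exact absurd (h3.trans_le (S.par_le (show τ + 1 ≤ k by omega) (by omega))) (not_lt.2 hk)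
  · by_contra hcon
    exact absurd (S.par_lt (show l + 1 < τ by omega) (by omega)) (not_lt.2 (h2.trans ht))

/-- All comparisons with `near`, `lo` and `hi` carry over within a cell, and the inequalities
between different intervals do not involve `x` and `y`. Only the order of `x'` and `y'` can differ
from that of `x` and `y`. -/
theorem HasSplits.coversVia (h : S.HasSplits Δ t j τ s) (hΔ : 0 < Δ) (hτ : S.IsLoc t τ) {k l : ℕ}
    (hkl : k ≤ l) (hlk : l ≤ k + 2) (hxx : SameCell s x x') (hyy : SameCell s y y')
    (hx : x < S.gridCount Δ j) (hx' : x' < S.gridCount Δ j) (hy : y < S.gridCount Δ j)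
    (hy' : y' < S.gridCount Δ j) (hc : S.CoversVia Δ t j k l (S.gridVal Δ j x) (S.gridVal Δ j y)) :
    S.CoversVia Δ t j k l (S.gridVal Δ j x') (S.gridVal Δ j y') := by
  obtain ⟨hl, hkt, htl, hxn, hyn, hc⟩ := hc
  obtain ⟨hw1, hw2⟩ := hτ.window hkl hlk hl hkt htl
  refine ⟨hl, hkt, htl,
    (h.mem_near_iff hΔ (by omega) (by omega) (by omega) hxx hx hx').1.1 hxn,
    (h.mem_near_iff hΔ hl (by omega) (by omega) hyy hy hy').2.1 hyn, ?_⟩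
  have hhi : ∀ {a b v : ℕ}, k < v → v ≤ l → SameCell s a b → a < S.gridCount Δ j →
      b < S.gridCount Δ j → S.gridVal Δ j a ≤ S.hi Δ j v → S.gridVal Δ j b ≤ S.hi Δ j v :=
    fun {a b v} h1 h2 hab ha hb h' =>
      (h.le_hi_iff hΔ (by omega) (by omega) (by omega) hab ha hb).1.1 h'
  have hlo : ∀ {a b v : ℕ}, k < v → v ≤ l → SameCell s a b → a < S.gridCount Δ j →
      b < S.gridCount Δ j → S.lo Δ j v ≤ S.gridVal Δ j a → S.lo Δ j v ≤ S.gridVal Δ j b :=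
    fun {a b v} h1 h2 hab ha hb h' =>
      (h.le_hi_iff hΔ (by omega) (by omega) (by omega) hab ha hb).2.1 h'
  rcases hc with ⟨hxy, hc⟩ | ⟨hxy, hc⟩
  · by_cases hxy' : S.gridVal Δ j x' ≤ S.gridVal Δ j y'
    · exact .inl ⟨hxy', fun v h1 h2 => ⟨hhi h1 h2 hxx hx hx' (hc v h1 h2).1,
        hlo h1 h2 hyy hy hy' (hc v h1 h2).2.1, (hc v h1 h2).2.2⟩⟩
    · have h3 : x ≤ y := (S.gridVal_le_iff j hΔ hx).1 hxy
      have h4 : y' ≤ x' := by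
        by_contra hcon
        exact hxy' (S.gridVal_mono j hΔ (not_le.1 hcon).le)
      -- Reversing the order within the same cells is possible only if all four indices are in one
      -- cell. Then `x` and `y` satisfy each other's bounds, and the inequalities for the reverse
      -- direction follow by comparing both ends with one position.
      have h5 : SameCell s x y := fun p hp =>
        ⟨fun h => h.trans h3, fun h => (hxx p hp).2 (((hyy p hp).1 h).trans h4)⟩
      refine .inr ⟨S.gridVal_mono j hΔ h4, fun v h1 h2 =>
        ⟨hhi h1 h2 (h5.trans hyy) hx hy' (hc v h1 h2).1,
          hlo h1 h2 (h5.symm.trans hxx) hy hx' (hc v h1 h2).2.1, fun v' h6 h7 => ?_⟩⟩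
      exact (hlo (by omega) h7 h5.symm hy hx (hc v' (by omega) h7).2.1).trans (hc v h1 h2).1
  · by_cases hxy' : S.gridVal Δ j y' ≤ S.gridVal Δ j x'
    · exact .inr ⟨hxy', fun v h1 h2 => ⟨hhi h1 h2 hyy hy hy' (hc v h1 h2).1,
        hlo h1 h2 hxx hx hx' (hc v h1 h2).2.1, (hc v h1 h2).2.2⟩⟩
    · have h3 : y ≤ x := (S.gridVal_le_iff j hΔ hy).1 hxy
      have h4 : x' ≤ y' := by
        by_contra hcon
        exact hxy' (S.gridVal_mono j hΔ (not_le.1 hcon).le)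
      have h5 : SameCell s x y := fun p hp =>
        ⟨fun h => (hyy p hp).2 (((hxx p hp).1 h).trans h4), fun h => h.trans h3⟩
      refine .inl ⟨S.gridVal_mono j hΔ h4, fun v h1 h2 =>
        ⟨hhi h1 h2 (h5.symm.trans hxx) hy hx' (hc v h1 h2).1,
          hlo h1 h2 (h5.trans hyy) hx hy' (hc v h1 h2).2.1, fun v' h6 h7 => ?_⟩⟩
      exact (hlo h1 h2 h5 hx hy (hc v h1 h2).2.1).trans (hc v' (by omega) h7).1

/-- A feasible set is constant on the products of cells. -/
theorem HasSplits.covers_iff (h : S.HasSplits Δ t j τ s) (hΔ : 0 < Δ) (hτ : S.IsLoc t τ)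
    (hxx : SameCell s x x') (hyy : SameCell s y y')
    (hx : x < S.gridCount Δ j) (hx' : x' < S.gridCount Δ j) (hy : y < S.gridCount Δ j)
    (hy' : y' < S.gridCount Δ j) :
    S.Covers Δ t j (S.gridVal Δ j x) (S.gridVal Δ j y) ↔
      S.Covers Δ t j (S.gridVal Δ j x') (S.gridVal Δ j y') :=
  ⟨fun ⟨k, l, h1, h2, h3⟩ => ⟨k, l, h1, h2, h.coversVia hΔ hτ h1 h2 hxx hyy hx hx' hy hy' h3⟩,
    fun ⟨k, l, h1, h2, h3⟩ =>
      ⟨k, l, h1, h2, h.coversVia hΔ hτ h1 h2 hxx.symm hyy.symm hx' hx hy' hy h3⟩⟩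

end

end PolygonalCurve

namespace RealRAM

/-! ### Bounded quantifiers and vectors of expressions -/

namespace Expr

/-- The conjunction of `f 0, …, f (n - 1)`. -/
def all (f : ℕ → Expr) : ℕ → Expr
  | 0 => 1
  | n + 1 => all f n * f n

/-- The disjunction of `f 0, …, f (n - 1)`. -/
def any (f : ℕ → Expr) : ℕ → Expr
  | 0 => 0
  | n + 1 => or (any f n) (f n)

/-- The inner product of the first `d` entries. -/
def dot (d : ℕ) (f g : ℕ → Expr) : Expr := sum (fun c => f c * g c) d

end Expr

/-- The expressions `f 0, …, f (d - 1)` evaluate to the coordinates of `v`. -/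
def VEv {d : ℕ} (B : ℕ) (σ : Store) (f : ℕ → Expr) (v : EuclideanSpace ℝ (Fin d)) : Prop :=
  ∀ c : Fin d, Ev B σ (f c) (v c)

variable {d B : ℕ} {σ : Store}

theorem Ev.all {f : ℕ → Expr} {P : ℕ → Prop} {n : ℕ} (h : ∀ k < n, Ev B σ (f k) (ind (P k))) :
    Ev B σ (.all f n) (ind (∀ k < n, P k)) := by
  induction n with
  | zero => exact Ev.one.congr (by simp [ind])
  | succ n ih =>
    refine ((ih fun k hk => h k (by omega)).and (h n (by omega))).congr (ind_congr ?_)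
    rw [Nat.forall_lt_succ_right]

theorem Ev.any {f : ℕ → Expr} {P : ℕ → Prop} {n : ℕ} (h : ∀ k < n, Ev B σ (f k) (ind (P k))) :
    Ev B σ (.any f n) (ind (∃ k < n, P k)) := by
  induction n with
  | zero => exact Ev.zero.congr (by simp [ind])
  | succ n ih =>
    refine ((ih fun k hk => h k (by omega)).or (h n (by omega))).congr (ind_congr ?_)
    rw [Nat.exists_lt_succ_right]

theorem Ev.natAdd {e f : Expr} {m n : ℕ} (he : Ev B σ e m) (hf : Ev B σ f n) :
    Ev B σ (e + f) ((m + n : ℕ) : ℝ) := (he.add hf).congr (by push_cast; rfl)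

theorem Ev.natMul {e f : Expr} {m n : ℕ} (he : Ev B σ e m) (hf : Ev B σ f n) :
    Ev B σ (e * f) ((m * n : ℕ) : ℝ) := (he.mul hf).congr (by push_cast; rfl)

theorem Ev.natSub {e f : Expr} {m n : ℕ} (he : Ev B σ e m) (hf : Ev B σ f n) (h : n ≤ m) :
    Ev B σ (e - f) ((m - n : ℕ) : ℝ) := (he.sub hf).congr (by rw [Nat.cast_sub h])

theorem Ev.natTruncSub {e f : Expr} {m n : ℕ} (he : Ev B σ e m) (hf : Ev B σ f n) :
    Ev B σ (.max 0 (e - f)) ((m - n : ℕ) : ℝ) := (Ev.zero.max (he.sub hf)).congr (by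
  rcases le_total n m with h | h
  · rw [Nat.cast_sub h, max_eq_right]
    exact sub_nonneg.2 (by exact_mod_cast h)
  · rw [Nat.sub_eq_zero_of_le h, max_eq_left]
    · simp
    · exact sub_nonpos.2 (by exact_mod_cast h))

theorem Ev.natMin {e f : Expr} {m n : ℕ} (he : Ev B σ e m) (hf : Ev B σ f n) :
    Ev B σ (.min e f) ((Min.min m n : ℕ) : ℝ) := (he.min hf).congr (by push_cast; rfl)

theorem Ev.nat1 : Ev B σ (1 : Expr) ((1 : ℕ) : ℝ) := Ev.ofNat 1
theorem Ev.nat2 : Ev B σ (2 : Expr) ((2 : ℕ) : ℝ) := Ev.ofNat 2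

theorem VEv.add {f g : ℕ → Expr} {v w : EuclideanSpace ℝ (Fin d)} (hf : VEv B σ f v)
    (hg : VEv B σ g w) : VEv B σ (fun c => f c + g c) (v + w) := fun c => (hf c).add (hg c)

theorem VEv.sub {f g : ℕ → Expr} {v w : EuclideanSpace ℝ (Fin d)} (hf : VEv B σ f v)
    (hg : VEv B σ g w) : VEv B σ (fun c => f c - g c) (v - w) := fun c => (hf c).sub (hg c)

theorem VEv.smul {e : Expr} {g : ℕ → Expr} {x : ℝ} {w : EuclideanSpace ℝ (Fin d)}
    (he : Ev B σ e x) (hg : VEv B σ g w) : VEv B σ (fun c => e * g c) (x • w) :=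
  fun c => he.mul (hg c)

theorem VEv.dot {f g : ℕ → Expr} {v w : EuclideanSpace ℝ (Fin d)} (hf : VEv B σ f v)
    (hg : VEv B σ g w) : Ev B σ (.dot d f g) (inner ℝ v w) := by
  refine (Ev.sum (g := fun k => if h : k < d then v ⟨k, h⟩ * w ⟨k, h⟩ else 0)
    fun k hk => ?_).congr ?_
  · simp only [dif_pos hk]
    exact (hf ⟨k, hk⟩).mul (hg ⟨k, hk⟩)
  · rw [Finset.sum_range, PiLp.inner_apply]
    refine Finset.sum_congr rfl fun c _ => ?_
    simp [mul_comm]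

end RealRAM

/-! ### The memory layout -/

/-- A curve together with the parameter `Δ` and `q` update points. The arrays have room for
`i + 1` update points. -/
structure CurveTask (d N : ℕ) where
  S : PolygonalCurve d N
  Δ : ℝ
  Δ_pos : 0 < Δ
  i : ℕ
  q : ℕ
  q_le : q ≤ i + 1
  pts : ℕ → ℝ
  pts_mem : ∀ k < q, pts k ∈ Icc (0 : ℝ) 1

namespace CurveTask

variable {d N : ℕ} (P : CurveTask d N)

/-- The address of the `k`-th vertex parameter. -/
def parA (_ : CurveTask d N) (k : ℕ) : ℕ := (N + 1) * d + k
/-- The address of the `k`-th update point. -/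
def ptsA (_ : CurveTask d N) (k : ℕ) : ℕ := (N + 1) * d + (N + 1) + k
/-- The address of the edge that contains the `k`-th update point. -/
def locA (k : ℕ) : ℕ := (N + 1) * d + (N + 1) + (P.i + 1) + k
/-- The address of the factor that the `k`-th update point contributes to the current weight. -/
def flagA (k : ℕ) : ℕ := (N + 1) * d + (N + 1) + 2 * (P.i + 1) + k
/-- The address of the `k`-th breakpoint; its update point is stored in the next cell. -/
def evA (k : ℕ) : ℕ := (N + 1) * d + (N + 1) + 3 * (P.i + 1) + 2 * k
/-- A bound on the number of breakpoints on an edge. -/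
def maxEv : ℕ := 37 * (P.i + 1)
/-- The address of the `k`-th record. -/
def recA (k : ℕ) : ℕ :=
  (N + 1) * d + (N + 1) + 3 * (P.i + 1) + 2 * (37 * (P.i + 1) + 1) + 8 * k
/-- A bound on the number of records. -/
def maxRec : ℕ := N * (P.maxEv + 1) ^ 2
/-- The number of memory cells. -/
def memSize : ℕ := P.recA P.maxRec

/-- The input of the construction is in place. -/
structure Env (σ : Store) : Prop where
  reg3 : σ.reg 3 = N
  reg4 : σ.reg 4 = P.i
  reg5 : σ.reg 5 = P.Δ
  reg6 : σ.reg 6 = P.q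
  vert : ∀ v ≤ N, ∀ c : Fin d, σ.mem (v * d + c) = P.S.vert v c
  par : ∀ v ≤ N, σ.mem (P.parA v) = P.S.par v
  pts : ∀ k < P.q, σ.mem (P.ptsA k) = P.pts k

/-- The edge that contains the `k`-th update point. -/
noncomputable def loc (k : ℕ) : ℕ :=
  open Classical in Nat.findGreatest (fun τ => P.S.par τ ≤ P.pts k) (N - 1)

/-- The environment while the `j`-th edge is processed. -/
structure EdgeEnv (j : ℕ) (σ : Store) : Prop extends P.Env σ where
  loc : ∀ k < P.q, σ.mem (P.locA k) = P.loc k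
  reg7 : σ.reg 7 = j
  reg8 : σ.reg 8 = P.S.gridCount P.Δ j
  reg9 : σ.reg 9 = P.S.step P.Δ j

end CurveTask

theorem PolygonalCurve.edges_pos {d N : ℕ} (S : PolygonalCurve d N) : 0 < N := by
  rcases Nat.eq_zero_or_pos N with rfl | h
  · have h0 := S.param_zero
    have h1 := S.param_last
    rw [show Fin.last 0 = 0 from rfl, h0] at h1
    exact absurd h1 zero_ne_one
  · exact h

theorem PolygonalCurve.par_zero {d N : ℕ} (S : PolygonalCurve d N) : S.par 0 = 0 :=
  (S.par_eq 0).trans S.param_zero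

/-! ### Location of the update points, and preservation of the input -/

namespace CurveTask

variable {d N : ℕ} (P : CurveTask d N)

theorem isLoc_loc {k : ℕ} (hk : k < P.q) : P.S.IsLoc (P.pts k) (P.loc k) := by
  classical
  have hN := P.S.edges_pos
  have h0 : P.S.par 0 ≤ P.pts k := by rw [P.S.par_zero]; exact (P.pts_mem k hk).1
  have hle : P.loc k ≤ N - 1 := Nat.findGreatest_le _
  refine ⟨by omega, ?_, ?_⟩
  · exact Nat.findGreatest_spec (P := fun τ => P.S.par τ ≤ P.pts k) (Nat.zero_le _) h0
  · by_cases h : P.loc k + 1 = N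
    · exact .inl h
    · right
      by_contra hcon
      exact Nat.findGreatest_is_greatest (P := fun τ => P.S.par τ ≤ P.pts k)
        (Nat.lt_succ_self (P.loc k)) (by omega) (not_lt.1 hcon)

theorem _root_.PolygonalCurve.IsLoc.unique {S : PolygonalCurve d N} {t : ℝ} {τ τ' : ℕ}
    (h : S.IsLoc t τ) (h' : S.IsLoc t τ') : τ = τ' := by
  obtain ⟨h1, h2, h3⟩ := h
  obtain ⟨h1', h2', h3'⟩ := h'
  by_contra hne
  rcases Nat.lt_or_gt_of_ne hne with hlt | hlt
  · rcases h3 with h3 | h3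
    · omega
    · linarith [S.par_le (show τ + 1 ≤ τ' by omega) (by omega)]
  · rcases h3' with h3' | h3'
    · omega
    · linarith [S.par_le (show τ' + 1 ≤ τ by omega) (by omega)]

theorem vert_lt {v : ℕ} (hv : v ≤ N) (c : Fin d) : v * d + c < (N + 1) * d := by
  have : (v + 1) * d ≤ (N + 1) * d := Nat.mul_le_mul_right _ (by omega)
  have := c.2
  nlinarith

section

variable {P} {σ σ' : Store} {j : ℕ}

/-- The input is confined to registers `3` to `6` and to the cells below `locA 0`, so programs that
leave these alone preserve it. -/
theorem Env.congr (h : P.Env σ) (hr : ∀ x, 3 ≤ x → x < 7 → σ'.reg x = σ.reg x)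
    (hm : ∀ a < P.locA 0, σ'.mem a = σ.mem a) : P.Env σ' where
  reg3 := (hr 3 (by omega) (by omega)).trans h.reg3
  reg4 := (hr 4 (by omega) (by omega)).trans h.reg4
  reg5 := (hr 5 (by omega) (by omega)).trans h.reg5
  reg6 := (hr 6 (by omega) (by omega)).trans h.reg6
  vert v hv c := (hm _ (by have := vert_lt hv c; simp only [locA]; omega)).trans (h.vert v hv c)
  par v hv := (hm _ (by simp only [locA, parA]; omega)).trans (h.par v hv)
  pts v hv := (hm _ (by have := P.q_le; simp only [locA, ptsA]; omega)).trans (h.pts v hv)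

theorem EdgeEnv.congr (h : P.EdgeEnv j σ) (hr : ∀ x, 3 ≤ x → x < 10 → σ'.reg x = σ.reg x)
    (hm : ∀ a < P.flagA 0, σ'.mem a = σ.mem a) : P.EdgeEnv j σ' where
  toEnv := h.toEnv.congr (fun x h1 h2 => hr x h1 (by omega)) fun a ha => hm a (by
    simp only [locA, flagA] at *; omega)
  loc k hk := (hm _ (by have := P.q_le; simp only [locA, flagA]; omega)).trans (h.loc k hk)
  reg7 := (hr 7 (by omega) (by omega)).trans h.reg7
  reg8 := (hr 8 (by omega) (by omega)).trans h.reg8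
  reg9 := (hr 9 (by omega) (by omega)).trans h.reg9

end

/-! ### Expressions for the geometric primitives -/

open Expr

section

variable (d)

def inputE : Expr := (reg 3 + 1) * ofNat d
def parE (e : Expr) : Expr := mem (inputE d + e)
def ptsE (e : Expr) : Expr := mem (inputE d + (reg 3 + 1) + e)
def locAE (e : Expr) : Expr := inputE d + (reg 3 + 1) + (reg 4 + 1) + e
def flagAE (e : Expr) : Expr := inputE d + (reg 3 + 1) + 2 * (reg 4 + 1) + e
def evAE (e : Expr) : Expr := inputE d + (reg 3 + 1) + 3 * (reg 4 + 1) + 2 * e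
def recAE (e : Expr) : Expr :=
  inputE d + (reg 3 + 1) + 3 * (reg 4 + 1) + 2 * (37 * (reg 4 + 1) + 1) + 8 * e
def vertE (e : Expr) (c : ℕ) : Expr := mem (e * ofNat d + ofNat c)
def dirE (e : Expr) (c : ℕ) : Expr := vertE d (e + 1) c - vertE d e c
def posE (w t : Expr) : Expr :=
  max 0 (min 1 (sdiv (t - parE d w) (parE d (w + 1) - parE d w)))
def pointE (j z : Expr) (c : ℕ) : Expr := vertE d j c + z * dirE d j c
def projE (w u₀ u₁ j z : Expr) : Expr :=
  max u₀ (min u₁ (sdiv (dot d (fun c => pointE d j z c - vertE d w c) (dirE d w))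
    (dot d (dirE d w) (dirE d w))))
def gapE (w u₀ u₁ j z : Expr) (c : ℕ) : Expr :=
  pointE d j z c - (vertE d w c + projE d w u₀ u₁ j z * dirE d w c)
def nearE (w u₀ u₁ j z : Expr) : Expr :=
  le (dot d (gapE d w u₀ u₁ j z) (gapE d w u₀ u₁ j z)) (reg 5 * reg 5)
def belowE (w u₀ u₁ j z : Expr) : Expr :=
  not (nearE d w u₀ u₁ j z) * lt (dot d (gapE d w u₀ u₁ j z) (dirE d j)) 0
def aboveE (w u₀ u₁ j z : Expr) : Expr :=
  not (nearE d w u₀ u₁ j z) * lt 0 (dot d (gapE d w u₀ u₁ j z) (dirE d j))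
def diffE (v j : Expr) (c : ℕ) : Expr := vertE d v c - vertE d j c
def discE (v j : Expr) : Expr :=
  dot d (diffE d v j) (dirE d j) * dot d (diffE d v j) (dirE d j) -
    dot d (dirE d j) (dirE d j) * (dot d (diffE d v j) (diffE d v j) - reg 5 * reg 5)
def loE (v j : Expr) : Expr :=
  ife (lt 0 (dot d (dirE d j) (dirE d j)))
    (ife (le 0 (discE d v j))
      (sdiv (dot d (diffE d v j) (dirE d j) - sqrt (max 0 (discE d v j)))
        (dot d (dirE d j) (dirE d j))) 2)
    (ife (le (dot d (diffE d v j) (diffE d v j)) (reg 5 * reg 5)) 0 2)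
def hiE (v j : Expr) : Expr :=
  ife (lt 0 (dot d (dirE d j) (dirE d j)))
    (ife (le 0 (discE d v j))
      (sdiv (dot d (diffE d v j) (dirE d j) + sqrt (max 0 (discE d v j)))
        (dot d (dirE d j) (dirE d j))) (0 - 1))
    (ife (le (dot d (diffE d v j) (diffE d v j)) (reg 5 * reg 5)) 1 (0 - 1))
def lenE (j : Expr) : Expr := sqrt (dot d (dirE d j) (dirE d j))
def stepE (j : Expr) : Expr := ife (lt 0 (lenE d j)) (sdiv (reg 5) (lenE d j)) 1

/-- The expression for `PolygonalCurve.boundaryTest`. -/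
def boundaryE (t w z : Expr) : Fin 6 → Expr
  | 0 => belowE d w 0 (posE d w t) (reg 7) z
  | 1 => not (aboveE d w 0 (posE d w t) (reg 7) z)
  | 2 => belowE d w (posE d w t) 1 (reg 7) z
  | 3 => not (aboveE d w (posE d w t) 1 (reg 7) z)
  | 4 => lt z (loE d w (reg 7))
  | 5 => le z (hiE d w (reg 7))

/-- The number `e`, or the number of the last edge if `e` is larger. -/
def clampE (e : Expr) : Expr := min (reg 3 - 1) e

def ascendsE (b : ℕ) (k x y : Expr) : Expr :=
  le x y * all (fun m => le x (hiE d (clampE (k + ofNat (m + 1))) (reg 7)) *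
    (le (loE d (clampE (k + ofNat (m + 1))) (reg 7)) y *
      all (fun e => le (loE d (clampE (k + ofNat (m + 1))) (reg 7))
        (hiE d (clampE (k + ofNat (m + e + 1))) (reg 7))) (b - m))) b

def descendsE (b : ℕ) (k x y : Expr) : Expr :=
  le y x * all (fun m => le y (hiE d (clampE (k + ofNat (m + 1))) (reg 7)) *
    (le (loE d (clampE (k + ofNat (m + 1))) (reg 7)) x *
      all (fun e => le (loE d (clampE (k + ofNat (m + e + 1))) (reg 7))
        (hiE d (clampE (k + ofNat (m + 1))) (reg 7))) (b - m))) b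

def viaE (b : ℕ) (t k x y : Expr) : Expr :=
  lt (k + ofNat b) (reg 3) * (le (parE d k) t * (le t (parE d (clampE (k + ofNat b) + 1)) *
    (nearE d k 0 (posE d k t) (reg 7) x *
      (nearE d (clampE (k + ofNat b)) (posE d (clampE (k + ofNat b)) t) 1 (reg 7) y *
        or (ascendsE d b k x y) (descendsE d b k x y)))))

/-- The expression for `PolygonalCurve.Covers`. -/
def coversE (t τ x y : Expr) : Expr :=
  any (fun a => any (fun b => viaE d b t (max 0 (τ - ofNat a)) x y) 3) 4

def gridE (a : Expr) : Expr := min 1 (a * reg 9)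

end

theorem maxRec_le_memSize (k : ℕ) (hk : k < P.maxRec) : P.recA k + 7 < P.memSize := by
  simp only [memSize, recA]; omega

section

variable {P} {σ : Store} {e e' f t w z u₀ u₁ x y k τ : Expr} {j m n : ℕ}

theorem Env.ev_N (h : P.Env σ) : Ev P.memSize σ (reg 3) (N : ℕ) := .reg_of h.reg3

theorem Env.ev_input (h : P.Env σ) : Ev P.memSize σ (inputE d) (((N + 1) * d : ℕ) : ℝ) :=
  (h.ev_N.natAdd Ev.nat1).natMul (.nat d)

theorem Env.ev_par (h : P.Env σ) (he : Ev P.memSize σ e n) (hn : n ≤ N) :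
    Ev P.memSize σ (parE d e) (P.S.par n) :=
  .mem_of (n := P.parA n) (h.ev_input.natAdd he) (by simp only [parA, memSize, recA]; omega)
    (h.par n hn)

theorem Env.ev_ptsA (h : P.Env σ) (he : Ev P.memSize σ e n) :
    Ev P.memSize σ (inputE d + (reg 3 + 1) + e) (P.ptsA n) :=
  (h.ev_input.natAdd (h.ev_N.natAdd Ev.nat1)).natAdd he

theorem Env.ev_pts (h : P.Env σ) (he : Ev P.memSize σ e n) (hn : n < P.q) :
    Ev P.memSize σ (ptsE d e) (P.pts n) :=
  .mem_of (n := P.ptsA n) (h.ev_ptsA he)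
    (by have := P.q_le; simp only [ptsA, memSize, recA]; omega) (h.pts n hn)

theorem Env.ev_i (h : P.Env σ) : Ev P.memSize σ (reg 4 + 1) ((P.i + 1 : ℕ) : ℝ) :=
  Ev.natAdd (.reg_of h.reg4) Ev.nat1

theorem Env.ev_locA (h : P.Env σ) (he : Ev P.memSize σ e n) :
    Ev P.memSize σ (locAE d e) (P.locA n) :=
  ((h.ev_input.natAdd (h.ev_N.natAdd Ev.nat1)).natAdd h.ev_i).natAdd he

theorem Env.ev_flagA (h : P.Env σ) (he : Ev P.memSize σ e n) :
    Ev P.memSize σ (flagAE d e) (P.flagA n) :=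
  ((h.ev_input.natAdd (h.ev_N.natAdd Ev.nat1)).natAdd (Ev.natMul (.ofNat 2) h.ev_i)).natAdd he

theorem Env.ev_evA (h : P.Env σ) (he : Ev P.memSize σ e n) :
    Ev P.memSize σ (evAE d e) (P.evA n) :=
  ((h.ev_input.natAdd (h.ev_N.natAdd Ev.nat1)).natAdd (Ev.natMul (.ofNat 3) h.ev_i)).natAdd
    (Ev.natMul (.ofNat 2) he)

theorem Env.ev_recA (h : P.Env σ) (he : Ev P.memSize σ e n) :
    Ev P.memSize σ (recAE d e) (P.recA n) :=
  (((h.ev_input.natAdd (h.ev_N.natAdd Ev.nat1)).natAdd (Ev.natMul (.ofNat 3) h.ev_i)).natAdd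
    (Ev.natMul (.ofNat 2) ((Ev.natMul (.ofNat 37) h.ev_i).natAdd Ev.nat1))).natAdd
    (Ev.natMul (.ofNat 8) he)

theorem EdgeEnv.ev_loc (h : P.EdgeEnv j σ) (he : Ev P.memSize σ e n) (hn : n < P.q) :
    Ev P.memSize σ (mem (locAE d e)) (P.loc n) :=
  .mem_of (h.ev_locA he) (by have := P.q_le; simp only [locA, memSize, recA]; omega) (h.loc n hn)

theorem Env.ev_vert (h : P.Env σ) (he : Ev P.memSize σ e n) (hn : n ≤ N) :
    VEv P.memSize σ (vertE d e) (P.S.vert n) := fun c =>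
  .mem_of ((he.natMul (.nat d)).natAdd (.nat c))
    (by have := vert_lt hn c; simp only [memSize, recA]; omega) (h.vert n hn c)

theorem Env.ev_dir (h : P.Env σ) (he : Ev P.memSize σ e n) (hn : n < N) :
    VEv P.memSize σ (dirE d e) (P.S.dir n) :=
  (h.ev_vert (he.natAdd Ev.nat1) hn).sub (h.ev_vert he hn.le)

theorem Env.ev_pos (h : P.Env σ) (he : Ev P.memSize σ e n) (hn : n < N) {t' : ℝ}
    (ht : Ev P.memSize σ t t') : Ev P.memSize σ (posE d e t) (P.S.pos n t') := by
  have hp := h.ev_par he hn.le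
  refine (Ev.zero.max (Ev.one.min ((ht.sub hp).sdiv
    ((h.ev_par (he.natAdd Ev.nat1) hn).sub hp)))).congr ?_
  have := sub_pos.2 (P.S.par_lt (Nat.lt_succ_self n) hn)
  rw [ind_false this.ne', add_zero]
  rfl

theorem Env.ev_gap (h : P.Env σ) (he : Ev P.memSize σ e n) (hn : n < N)
    (hf : Ev P.memSize σ f m) (hm : m < N) {a b c : ℝ} (ha : Ev P.memSize σ u₀ a)
    (hb : Ev P.memSize σ u₁ b) (hz : Ev P.memSize σ z c) :
    VEv P.memSize σ (gapE d e u₀ u₁ f z)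
      (gapVec (P.S.vert n) (P.S.dir n) (P.S.vert m + c • P.S.dir m) a b) := by
  have hp : VEv P.memSize σ (pointE d f z) (P.S.vert m + c • P.S.dir m) :=
    (h.ev_vert hf hm.le).add (.smul hz (h.ev_dir hf hm))
  have hv := h.ev_vert he hn.le
  have hd := h.ev_dir he hn
  exact hp.sub (hv.add (.smul (ha.max (hb.min (((hp.sub hv).dot hd).sdiv (hd.dot hd)))) hd))

theorem Env.ev_sq (h : P.Env σ) : Ev P.memSize σ (reg 5 * reg 5) (P.Δ * P.Δ) :=
  Ev.mul (.reg_of h.reg5) (.reg_of h.reg5)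

theorem Env.ev_near (h : P.Env σ) (he : Ev P.memSize σ e n) (hn : n < N)
    (hf : Ev P.memSize σ f m) (hm : m < N) {a b c : ℝ} (ha : Ev P.memSize σ u₀ a)
    (hb : Ev P.memSize σ u₁ b) (hz : Ev P.memSize σ z c) (hab : a ≤ b) :
    Ev P.memSize σ (nearE d e u₀ u₁ f z) (ind (c ∈ P.S.near P.Δ m n a b)) := by
  have hg := h.ev_gap he hn hf hm ha hb hz
  exact ((hg.dot hg).le h.ev_sq).congr
    (ind_congr (mem_closeSet_iff _ _ _ _ hab P.Δ_pos _).symm)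

theorem Env.ev_below (h : P.Env σ) (he : Ev P.memSize σ e n) (hn : n < N)
    (hf : Ev P.memSize σ f m) (hm : m < N) {a b c : ℝ} (ha : Ev P.memSize σ u₀ a)
    (hb : Ev P.memSize σ u₁ b) (hz : Ev P.memSize σ z c) :
    Ev P.memSize σ (belowE d e u₀ u₁ f z)
      (ind (IsBelow (P.S.vert n) (P.S.dir n) (P.S.vert m) (P.S.dir m) a b P.Δ c)) := by
  have hg := h.ev_gap he hn hf hm ha hb hz
  exact ((hg.dot hg).le h.ev_sq).not.and ((hg.dot (h.ev_dir hf hm)).lt .zero)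

theorem Env.ev_above (h : P.Env σ) (he : Ev P.memSize σ e n) (hn : n < N)
    (hf : Ev P.memSize σ f m) (hm : m < N) {a b c : ℝ} (ha : Ev P.memSize σ u₀ a)
    (hb : Ev P.memSize σ u₁ b) (hz : Ev P.memSize σ z c) :
    Ev P.memSize σ (aboveE d e u₀ u₁ f z)
      (ind (IsAbove (P.S.vert n) (P.S.dir n) (P.S.vert m) (P.S.dir m) a b P.Δ c)) := by
  have hg := h.ev_gap he hn hf hm ha hb hz
  exact ((hg.dot hg).le h.ev_sq).not.and (Ev.zero.lt (hg.dot (h.ev_dir hf hm)))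

theorem Env.ev_disc (h : P.Env σ) (he : Ev P.memSize σ e n) (hn : n ≤ N)
    (hf : Ev P.memSize σ f m) (hm : m < N) :
    Ev P.memSize σ (discE d e f) (hitDisc (P.S.vert n) (P.S.vert m) (P.S.dir m) P.Δ) := by
  have h1 := (h.ev_vert he hn).sub (h.ev_vert hf hm.le)
  have h2 := h.ev_dir hf hm
  exact ((h1.dot h2).mul (h1.dot h2)).sub ((h2.dot h2).mul ((h1.dot h1).sub h.ev_sq))

/-- The maximum with `0` under the root and the indicator in the denominator make all branches safe
to evaluate, including those not taken. -/
theorem Env.ev_lo (h : P.Env σ) (he : Ev P.memSize σ e n) (hn : n ≤ N)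
    (hf : Ev P.memSize σ f m) (hm : m < N) :
    Ev P.memSize σ (loE d e f) (P.S.lo P.Δ m n) := by
  have h1 := (h.ev_vert he hn).sub (h.ev_vert hf hm.le)
  have h2 := h.ev_dir hf hm
  have h3 := h.ev_disc he hn hf hm
  exact (Ev.zero.lt (h2.dot h2)).ife ((Ev.zero.le h3).ife
    (((h1.dot h2).sub ((Ev.zero.max h3).sqrt (le_max_left _ _))).sdiv (h2.dot h2)) .two)
    (((h1.dot h1).le h.ev_sq).ife .zero .two)

theorem Env.ev_hi (h : P.Env σ) (he : Ev P.memSize σ e n) (hn : n ≤ N)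
    (hf : Ev P.memSize σ f m) (hm : m < N) :
    Ev P.memSize σ (hiE d e f) (P.S.hi P.Δ m n) := by
  have h1 := (h.ev_vert he hn).sub (h.ev_vert hf hm.le)
  have h2 := h.ev_dir hf hm
  have h3 := h.ev_disc he hn hf hm
  exact (Ev.zero.lt (h2.dot h2)).ife ((Ev.zero.le h3).ife
    (((h1.dot h2).add ((Ev.zero.max h3).sqrt (le_max_left _ _))).sdiv (h2.dot h2))
      (Ev.zero.sub .one))
    (((h1.dot h1).le h.ev_sq).ife .one (Ev.zero.sub .one))

theorem Env.ev_len (h : P.Env σ) (he : Ev P.memSize σ e n) (hn : n < N) :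
    Ev P.memSize σ (lenE d e) (P.S.len n) :=
  ((h.ev_dir he hn).dot (h.ev_dir he hn)).sqrt real_inner_self_nonneg

theorem Env.ev_step (h : P.Env σ) (he : Ev P.memSize σ e n) (hn : n < N) :
    Ev P.memSize σ (stepE d e) (P.S.step P.Δ n) :=
  (Ev.zero.lt (h.ev_len he hn)).ife ((Ev.reg_of h.reg5).sdiv (h.ev_len he hn)) .one

theorem Env.ev_clamp (h : P.Env σ) (he : Ev P.memSize σ e n) :
    Ev P.memSize σ (clampE e) ((Min.min (N - 1) n : ℕ) : ℝ) :=
  (h.ev_N.natSub Ev.nat1 P.S.edges_pos).natMin he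

theorem EdgeEnv.ev_boundary (h : P.EdgeEnv j σ) (hj : j < N) (he : Ev P.memSize σ e n) (hn : n < N)
    {t' c : ℝ} (ht : Ev P.memSize σ t t') (hz : Ev P.memSize σ z c) (i : Fin 6) :
    Ev P.memSize σ (boundaryE d t e z i) (ind (P.S.boundaryTest P.Δ t' j n i c)) := by
  have h7 : Ev P.memSize σ (reg 7) j := .reg_of h.reg7
  have hp := h.ev_pos he hn ht
  fin_cases i
  · exact h.ev_below he hn h7 hj .zero hp hz
  · exact (h.ev_above he hn h7 hj .zero hp hz).not
  · exact h.ev_below he hn h7 hj hp .one hz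
  · exact (h.ev_above he hn h7 hj hp .one hz).not
  · exact hz.lt (h.ev_lo he hn.le h7 hj)
  · exact hz.le (h.ev_hi he hn.le h7 hj)

theorem EdgeEnv.ev_via (h : P.EdgeEnv j σ) (hj : j < N) (hk : Ev P.memSize σ k n) (hn : n < N)
    {t' a b : ℝ} (ht : Ev P.memSize σ t t') (hx : Ev P.memSize σ x a) (hy : Ev P.memSize σ y b)
    (l : ℕ) :
    Ev P.memSize σ (viaE d l t k x y) (ind (P.S.CoversVia P.Δ t' j n (n + l) a b)) := by
  have h7 : Ev P.memSize σ (reg 7) j := .reg_of h.reg7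
  have hc : ∀ m : ℕ, Ev P.memSize σ (clampE (k + ofNat m)) ((Min.min (N - 1) (n + m) : ℕ) : ℝ) :=
    fun m => h.ev_clamp (hk.natAdd (.nat m))
  have hlt : ∀ m, Min.min (N - 1) m < N := fun m =>
    (min_le_left _ _).trans_lt (Nat.sub_lt P.S.edges_pos one_pos)
  have hlo := fun m => h.ev_lo (hc m) (hlt _).le h7 hj
  have hhi := fun m => h.ev_hi (hc m) (hlt _).le h7 hj
  have hasc := (hx.le hy).and (Ev.all (n := l) fun m _ =>
    (hx.le (hhi (m + 1))).and (((hlo (m + 1)).le hy).and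
      (Ev.all (n := l - m) fun e _ => (hlo (m + 1)).le (hhi (m + e + 1)))))
  have hdesc := (hy.le hx).and (Ev.all (n := l) fun m _ =>
    (hy.le (hhi (m + 1))).and (((hlo (m + 1)).le hx).and
      (Ev.all (n := l - m) fun e _ => (hlo (m + e + 1)).le (hhi (m + 1)))))
  refine (((hk.natAdd (.nat l)).lt h.ev_N).and (((h.ev_par hk hn.le).le ht).and
    ((ht.le (h.ev_par ((hc l).natAdd Ev.nat1) (hlt _))).and
    ((h.ev_near hk hn h7 hj .zero (h.ev_pos hk hn ht) hx (P.S.pos_mem _ _).1).and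
    ((h.ev_near (hc l) (hlt _) h7 hj (h.ev_pos (hc l) (hlt _) ht) .one hy
      (P.S.pos_mem _ _).2).and (hasc.or hdesc)))))).congr (ind_congr ?_)
  rw [Nat.cast_lt]
  -- Clamping keeps the addresses valid while edges beyond the last one are tried. Once `n + l < N`
  -- is known, it has no effect.
  refine and_congr_right fun hl => ?_
  have hmin : ∀ m ≤ l, Min.min (N - 1) (n + m) = n + m := fun m hm => min_eq_right (by omega)
  rw [hmin l le_rfl]
  refine and_congr Iff.rfl (and_congr Iff.rfl (and_congr Iff.rfl (and_congr Iff.rfl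
    (or_congr (and_congr Iff.rfl ?_) (and_congr Iff.rfl ?_)))))
  · constructor
    · intro H v h1 h2
      obtain ⟨m, rfl⟩ : ∃ m, v = n + (m + 1) := ⟨v - n - 1, by omega⟩
      have H' := H m (by omega)
      rw [hmin _ (by omega)] at H'
      refine ⟨H'.1, H'.2.1, fun v' h3 h4 => ?_⟩
      obtain ⟨e, rfl⟩ : ∃ e, v' = n + (m + e + 1) := ⟨v' - (n + (m + 1)), by omega⟩
      have := H'.2.2 e (by omega)
      rwa [hmin _ (by omega)] at this
    · intro H m hm
      rw [hmin _ (by omega)]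
      obtain ⟨h1, h2, h3⟩ := H (n + (m + 1)) (by omega) (by omega)
      refine ⟨h1, h2, fun e he => ?_⟩
      rw [hmin _ (by omega)]
      exact h3 _ (by omega) (by omega)
  · constructor
    · intro H v h1 h2
      obtain ⟨m, rfl⟩ : ∃ m, v = n + (m + 1) := ⟨v - n - 1, by omega⟩
      have H' := H m (by omega)
      rw [hmin _ (by omega)] at H'
      refine ⟨H'.1, H'.2.1, fun v' h3 h4 => ?_⟩
      obtain ⟨e, rfl⟩ : ∃ e, v' = n + (m + e + 1) := ⟨v' - (n + (m + 1)), by omega⟩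
      have := H'.2.2 e (by omega)
      rwa [hmin _ (by omega)] at this
    · intro H m hm
      rw [hmin _ (by omega)]
      obtain ⟨h1, h2, h3⟩ := H (n + (m + 1)) (by omega) (by omega)
      refine ⟨h1, h2, fun e he => ?_⟩
      rw [hmin _ (by omega)]
      exact h3 _ (by omega) (by omega)

/-- By `IsLoc.window`, `k` is one of `τ, …, τ - 3` and `l` one of `k, k + 1, k + 2`, so four times
three trials suffice. Truncated subtraction near the start of the curve merely repeats `k = 0`. -/
theorem EdgeEnv.ev_covers (h : P.EdgeEnv j σ) (hj : j < N) {t' a b : ℝ} (hτ' : P.S.IsLoc t' n)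
    (hτ : Ev P.memSize σ τ n) (ht : Ev P.memSize σ t t') (hx : Ev P.memSize σ x a)
    (hy : Ev P.memSize σ y b) :
    Ev P.memSize σ (coversE d t τ x y) (ind (P.S.Covers P.Δ t' j a b)) := by
  have hn := hτ'.1
  refine (Ev.any (n := 4) fun m _ => Ev.any (n := 3) fun l _ =>
    h.ev_via hj (hτ.natTruncSub (.nat m)) (by omega) ht hx hy l).congr (ind_congr ?_)
  constructor
  · rintro ⟨m, -, l, h1, h2⟩
    exact ⟨_, _, by omega, by omega, h2⟩
  · rintro ⟨k, l, h1, h2, h3⟩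
    obtain ⟨h4, h5⟩ := hτ'.window h1 h2 h3.1 h3.2.1 h3.2.2.1
    refine ⟨n - k, by omega, l - k, by omega, ?_⟩
    rwa [show n - (n - k) = k by omega, show k + (l - k) = l by omega]

theorem EdgeEnv.ev_grid (h : P.EdgeEnv j σ) (hx : Ev P.memSize σ x n) :
    Ev P.memSize σ (gridE x) (P.S.gridVal P.Δ j n) :=
  Ev.one.min (hx.mul (.reg_of h.reg9))

end

end CurveTask

namespace RealRAM

/-! ### Binary search -/

open RealRAM.Expr in
/-- Stores a number in register `30` up to which `T` holds and after which it fails, by binary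
search below `H`. -/
def search (H : Expr) (T : Expr → Expr) : Prog :=
  .seq (.assign 31 1) (.seq (.while (lt (reg 31) H) (.assign 31 (reg 31 * 2)))
    (.seq (.assign 30 0) (.while (le 1 (reg 31))
      (.seq (.ite (lt (reg 30 + reg 31) H)
        (.ite (T (reg 30 + reg 31)) (.assign 30 (reg 30 + reg 31)) .skip) .skip)
        (.assign 31 (reg 31 / 2))))))

/-- `σ` with the registers `30` and `31` replaced. -/
def Store.setSearch (σ : Store) (a b : ℝ) : Store := (σ.setReg 30 a).setReg 31 b

theorem Store.setSearch_set30 (σ : Store) (a b c : ℝ) :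
    (σ.setSearch a b).setReg 30 c = σ.setSearch c b := by
  simp only [setSearch, setReg]
  congr 1
  funext x
  simp only [Function.update_apply]
  split_ifs <;> simp_all

theorem Store.setSearch_set31 (σ : Store) (a b c : ℝ) :
    (σ.setSearch a b).setReg 31 c = σ.setSearch a c := by
  simp only [setSearch, setReg]
  congr 1
  funext x
  simp only [Function.update_apply]
  split_ifs <;> simp_all

theorem Store.setReg31_eq (σ : Store) (c : ℝ) : σ.setReg 31 c = σ.setSearch (σ.reg 30) c := by
  simp only [setSearch, setReg]
  congr 1
  funext x
  simp only [Function.update_apply]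
  split_ifs <;> simp_all

theorem Store.setSearch_reg (σ : Store) (a b : ℝ) {x : ℕ} (h : x ≠ 30) (h' : x ≠ 31) :
    (σ.setSearch a b).reg x = σ.reg x := by
  simp [setSearch, h, h']

@[simp] theorem Store.setSearch_reg30 (σ : Store) (a b : ℝ) : (σ.setSearch a b).reg 30 = a := by
  simp [setSearch]

@[simp] theorem Store.setSearch_reg31 (σ : Store) (a b : ℝ) : (σ.setSearch a b).reg 31 = b := by
  simp [setSearch]

/-- No monotonicity of the test is assumed, so the result is only a local change from true to false.
The bound `v` is real and need not be an integer. The test is evaluated only at integers `n` with `0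
< n < v`, which keeps its memory accesses valid. -/
theorem run_search {B X l : ℕ} {σ : Store} {H : Expr} {v : ℝ} {T : Expr → Expr} {T' : ℕ → Prop}
    {Q : Store → Prop} (hX : l + 2 ≤ X) (hv : v ≤ 2 ^ l)
    (hH : ∀ a b, Ev B (σ.setSearch a b) H v)
    (hT : ∀ a b e (n : ℕ), 0 < n → (n : ℝ) < v → Ev B (σ.setSearch a b) e n →
      Ev B (σ.setSearch a b) (T e) (ind (T' n)))
    (hQ : ∀ (r : ℕ) b, (r = 0 ∨ (r : ℝ) < v ∧ T' r) → (v ≤ r + 1 ∨ ¬ T' (r + 1)) →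
      Q (σ.setSearch r b)) :
    Run B (search H T) X σ Q := by
  have hX0 : 0 < X := by omega
  refine .seq (.assign hX0 Ev.one (.seq ?_))
  rw [Store.setReg31_eq]
  -- Doubling: register `31` is `2 ^ e`, and it reaches `v` before `e` exceeds `l`.
  refine Run.loop (Y := 1)
    (fun m σ' => ∃ e a, e + m = l ∧ σ' = σ.setSearch a (2 ^ e)) l (by omega) one_pos
    ⟨0, _, by simp, by simp; rfl⟩ ?_
  rintro m σ' ⟨e, a, hm, rfl⟩
  refine ⟨_, (Ev.reg_of (by simp; rfl)).lt (hH _ _), fun hlt => ?_, fun hlt => ?_⟩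
  · have : m ≠ 0 := by
      rintro rfl
      rw [show e = l by omega] at hlt
      exact absurd hlt (not_lt.2 hv)
    refine ⟨m - 1, by omega, .assign one_pos ((Ev.reg _).mul .two) ⟨e + 1, a, by omega, ?_⟩⟩
    rw [Store.setSearch_set31, Store.setSearch_reg31, pow_succ]
  · refine .seq (.assign hX0 Ev.zero ?_)
    rw [Store.setSearch_set30]
    -- With `m` rounds left, the next power to try is `2 ^ m / 2`; for `m = 0` this is `1 / 2`,
    -- which ends the loop. The test holds at `r` unless `r = 0`, and `r + 2 ^ m` is either out of
    -- range or fails it.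
    refine Run.loop (Y := 1)
      (fun m σ' => ∃ r : ℕ, σ' = σ.setSearch r (2 ^ m / 2) ∧ (r = 0 ∨ (r : ℝ) < v ∧ T' r) ∧
        (v ≤ r + 2 ^ m ∨ ¬ T' (r + 2 ^ m))) (e + 1) (by omega) one_pos
      ⟨0, by rw [pow_succ]; simp, .inl rfl, .inl ?_⟩ ?_
    · rw [not_lt] at hlt
      rw [pow_succ]
      have : (0 : ℝ) < 2 ^ e := by positivity
      push_cast; linarith
    rintro m σ' ⟨r, rfl, h1, h2⟩
    refine ⟨_, Ev.one.le (Ev.reg_of (by simp; rfl)), fun hle => ?_, fun hle => ?_⟩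
    · have : m ≠ 0 := by
        rintro rfl
        norm_num at hle
      obtain ⟨m, rfl⟩ := Nat.exists_eq_succ_of_ne_zero this
      refine ⟨m, rfl, ?_⟩
      have hp : (2 : ℝ) ^ (m + 1) / 2 = ((2 ^ m : ℕ) : ℝ) := by rw [pow_succ]; simp
      rw [Nat.succ_eq_add_one, hp]
      have hcand : ∀ σ' : Store, σ' = σ.setSearch r ((2 ^ m : ℕ) : ℝ) →
          Ev B σ' (.reg 30 + .reg 31) ((r + 2 ^ m : ℕ) : ℝ) := by
        rintro _ rfl
        exact Ev.natAdd (.reg_of (by simp)) (.reg_of (by simp))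
      have hfin : ∀ r' : ℕ, (r' = 0 ∨ (r' : ℝ) < v ∧ T' r') →
          (v ≤ r' + 2 ^ m ∨ ¬ T' (r' + 2 ^ m)) →
          Run B (.assign 31 (.reg 31 / 2)) 1 (σ.setSearch r' ((2 ^ m : ℕ) : ℝ))
            (fun σ' => ∃ r : ℕ, σ' = σ.setSearch r (2 ^ m / 2) ∧ (r = 0 ∨ (r : ℝ) < v ∧ T' r) ∧
              (v ≤ r + 2 ^ m ∨ ¬ T' (r + 2 ^ m))) := by
        intro r' h3 h4
        refine .assign one_pos ((Ev.reg _).div .two two_ne_zero) ⟨r', ?_, h3, h4⟩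
        rw [Store.setSearch_set31, Store.setSearch_reg31]
        simp
      refine .seq (.ite one_pos ((hcand _ rfl).lt (hH _ _)) (fun h3 => ?_) fun h3 => ?_)
      · refine .ite one_pos (hT _ _ _ _ (by positivity) h3 (hcand _ rfl)) (fun h4 => ?_) fun h4 => ?_
        · refine .assign one_pos (hcand _ rfl) ?_
          rw [Store.setSearch_set30]
          refine hfin _ (.inr ⟨h3, h4⟩) ?_
          rcases h2 with h2 | h2
          · left; push_cast; rw [Nat.succ_eq_add_one, pow_succ] at h2; linarith
          · right; rwa [Nat.succ_eq_add_one, pow_succ, Nat.mul_two, ← add_assoc] at h2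
        · exact .skip one_pos (hfin _ h1 (.inr h4))
      · refine .skip one_pos (hfin _ h1 (.inl ?_))
        have := not_lt.1 h3
        push_cast at this
        exact this
    · refine hQ r _ h1 ?_
      have : m = 0 := by
        by_contra hm
        obtain ⟨m, rfl⟩ := Nat.exists_eq_succ_of_ne_zero hm
        refine hle ?_
        rw [Nat.succ_eq_add_one, pow_succ, mul_div_cancel_right₀ _ two_ne_zero]
        exact one_le_pow₀ one_le_two
      subst this
      simpa using h2

/-! ### Repetition with a fixed number of rounds -/

/-- The programs `f 0, …, f (n - 1)`, one after the other. -/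
def Prog.rep (f : ℕ → Prog) : ℕ → Prog
  | 0 => .skip
  | n + 1 => .seq (rep f n) (f n)

theorem Run.rep {B X n : ℕ} {f : ℕ → Prog} {σ : Store} (hX : 0 < X) (I : ℕ → Store → Prop)
    (h0 : I 0 σ) (h : ∀ m < n, ∀ σ, I m σ → Run B (f m) X σ (I (m + 1))) :
    Run B (Prog.rep f n) X σ (I n) := by
  induction n with
  | zero => exact .skip hX h0
  | succ n ih =>
    exact .seq ((ih fun m hm => h m (by omega)).imp fun σ' h' => h n (by omega) σ' h')

end RealRAM

namespace CurveTask

open Expr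

variable {d N : ℕ} (P : CurveTask d N)

/-! ### The sorted list of breakpoints -/

/-- The first `n` entries of the list of breakpoints are `ev 0, …, ev (n - 1)`, in ascending
order. -/
structure EvList (n : ℕ) (ev : ℕ → ℕ × ℕ) (σ : Store) : Prop where
  reg12 : σ.reg 12 = n
  val : ∀ p < n, σ.mem (P.evA p) = (ev p).1
  own : ∀ p < n, σ.mem (P.evA p + 1) = (ev p).2
  sorted : ∀ p p', p ≤ p' → p' < n → (ev p).1 ≤ (ev p').1

/-- Inserts the breakpoint in register `22` with the update point in register `13`. -/
def insertProg (d : ℕ) : Prog :=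
  .seq (.assign 23 (reg 12)) (.seq
    (.while (lt 0 (reg 23) * lt (reg 22) (mem (evAE d (max 0 (reg 23 - 1)))))
      (.seq (.store (evAE d (reg 23)) (mem (evAE d (max 0 (reg 23 - 1)))))
        (.seq (.store (evAE d (reg 23) + 1) (mem (evAE d (max 0 (reg 23 - 1)) + 1)))
          (.assign 23 (reg 23 - 1)))))
    (.seq (.store (evAE d (reg 23)) (reg 22))
      (.seq (.store (evAE d (reg 23) + 1) (reg 13)) (.assign 12 (reg 12 + 1)))))

variable {P}

theorem EvList.congr {n : ℕ} {ev : ℕ → ℕ × ℕ} {σ σ' : Store} (h : P.EvList n ev σ)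
    (hr : σ'.reg 12 = σ.reg 12) (hn : n ≤ P.maxEv)
    (hm : ∀ a, P.evA 0 ≤ a → a < P.recA 0 → σ'.mem a = σ.mem a) : P.EvList n ev σ' where
  reg12 := hr.trans h.reg12
  val p hp := (hm _ (by simp only [evA]; omega)
    (by simp only [evA, recA, maxEv] at *; omega)).trans (h.val p hp)
  own p hp := (hm _ (by simp only [evA]; omega)
    (by simp only [evA, recA, maxEv] at *; omega)).trans (h.own p hp)
  sorted := h.sorted

/-- Insertion into a sorted array by shifting the larger entries, hence at most `n` rounds. -/
theorem run_insert {X j n v k : ℕ} {ev : ℕ → ℕ × ℕ} {σ : Store} {Q : Store → Prop}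
    (h : P.EdgeEnv j σ) (hev : P.EvList n ev σ) (hn : n < P.maxEv) (hX : P.maxEv ≤ X)
    (h22 : σ.reg 22 = v) (h13 : σ.reg 13 = k)
    (hQ : ∀ σ' ev', (∀ x, x ≠ 12 → x ≠ 23 → σ'.reg x = σ.reg x) →
      (∀ a, a < P.evA 0 ∨ P.recA 0 ≤ a → σ'.mem a = σ.mem a) → P.EvList (n + 1) ev' σ' →
      ev' '' Iio (n + 1) = insert (v, k) (ev '' Iio n) → Q σ') :
    Run P.memSize (insertProg d) X σ Q := by
  have hX0 : 0 < X := by omega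
  refine .seq (.assign hX0 (Ev.reg_of hev.reg12) (.seq ?_))
  have hB : P.recA 0 ≤ P.memSize := by simp only [memSize, recA]; omega
  -- Slot `p` is free: the entries below it are untouched, those above it have moved up by one and
  -- are at least `v`.
  refine Run.loop (Y := 1) (fun p σ' => p ≤ n ∧ σ'.reg 23 = p ∧
    (∀ x, x ≠ 23 → σ'.reg x = σ.reg x) ∧
    (∀ a, a < P.evA 0 ∨ P.recA 0 ≤ a → σ'.mem a = σ.mem a) ∧
    (∀ p' < p, σ'.mem (P.evA p') = (ev p').1 ∧ σ'.mem (P.evA p' + 1) = (ev p').2) ∧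
    (∀ p', p < p' → p' ≤ n → σ'.mem (P.evA p') = (ev (p' - 1)).1 ∧
      σ'.mem (P.evA p' + 1) = (ev (p' - 1)).2 ∧ v ≤ (ev (p' - 1)).1)) n (by omega) one_pos ?_ ?_
  · refine ⟨le_rfl, by simp, fun x hx => by simp [hx], fun a _ => rfl,
      fun p' hp' => ⟨hev.val p' hp', hev.own p' hp'⟩, fun p' h1 h2 => by omega⟩
  rintro p σ' ⟨hpn, h23, hr, hm, hlow, hhigh⟩
  have henv : P.EdgeEnv j σ' := h.congr (fun x _ h2 => hr x (by omega)) fun a ha =>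
    hm a (.inl (by simp only [flagA, evA] at *; omega))
  have e23 : Ev P.memSize σ' (reg 23) (p : ℕ) := .reg_of h23
  have e22 : Ev P.memSize σ' (reg 22) (v : ℕ) := .reg_of ((hr 22 (by omega)).trans h22)
  have epred := henv.ev_evA (e23.natTruncSub Ev.nat1)
  have hlt : ∀ p ≤ n, P.evA p + 1 < P.recA 0 := fun p hp => by
    simp only [evA, recA, maxEv] at *; omega
  have hpred := hlt (p - 1) (by omega)
  refine ⟨_, (Ev.zero.lt e23).and (e22.lt (epred.mem (by omega))), fun hc => ?_, fun hc => ?_⟩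
  · have hp : p ≠ 0 := by rintro rfl; simp at hc
    obtain ⟨p, rfl⟩ := Nat.exists_eq_succ_of_ne_zero hp
    simp only [Nat.succ_eq_add_one, Nat.add_sub_cancel] at *
    obtain ⟨hl1, hl2⟩ := hlow p (by omega)
    have hvp : v < (ev p).1 := by
      have := hc.2
      rw [hl1] at this
      exact_mod_cast this
    refine ⟨p, rfl, .seq (.store one_pos (henv.ev_evA e23) (by have := hlt (p + 1) hpn; omega)
      (epred.mem_of (by omega) hl1) ?_)⟩
    set σ1 := σ'.setMem (P.evA (p + 1)) (ev p).1 with hσ1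
    have henv1 : P.EdgeEnv j σ1 := henv.congr (fun x _ _ => rfl) fun a ha => by
      rw [hσ1, Store.setMem_mem, if_neg]; simp only [flagA, evA] at *; omega
    have e231 : Ev P.memSize σ1 (reg 23) ((p + 1 : ℕ) : ℝ) := .reg_of h23
    refine .seq (.store one_pos ((henv1.ev_evA e231).natAdd Ev.nat1)
      (by have := hlt (p + 1) hpn; omega)
      (((henv1.ev_evA (e231.natTruncSub Ev.nat1)).natAdd Ev.nat1).mem_of
        (by simp only [Nat.add_sub_cancel]; omega) (x := (ev p).2) ?_) ?_)
    · rw [hσ1, Store.setMem_mem, if_neg (by simp only [Nat.add_sub_cancel, evA]; omega)]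
      exact hl2
    refine .assign one_pos (((Ev.reg_of (x := ((p + 1 : ℕ) : ℝ)) (by exact h23)).natSub Ev.nat1
      (by omega)).congr (y := (p : ℝ)) (by simp)) ⟨by omega, by simp, fun x hx => ?_, fun a ha => ?_,
      fun p' hp' => ?_, fun p' hp1 hp2 => ?_⟩
    · simp [hx, hσ1]; exact hr x hx
    · have := hlt (p + 1) hpn
      simp only [Store.setReg_mem, hσ1, Store.setMem_mem]
      rw [if_neg, if_neg]
      · exact hm a ha
      · simp only [evA] at *; omega
      · simp only [evA] at *; omega
    · simp only [Store.setReg_mem, hσ1, Store.setMem_mem, evA]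
      rw [if_neg (by omega), if_neg (by omega), if_neg (by omega), if_neg (by omega)]
      exact hlow p' (by omega)
    · simp only [Store.setReg_mem, hσ1, Store.setMem_mem, evA]
      by_cases hpp : p' = p + 1
      · subst hpp
        rw [if_neg (by omega), if_pos rfl, if_pos rfl]
        simp only [Nat.add_sub_cancel, true_and]
        exact hvp.le
      · rw [if_neg (by omega), if_neg (by omega), if_neg (by omega), if_neg (by omega)]
        exact hhigh p' (by omega) hp2
  -- The loop has compared `v` only with the predecessor of the free slot; sortedness covers the
  -- earlier entries.
  · have hle : ∀ p' < p, (ev p').1 ≤ v := by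
      intro p' hp'
      have h1 : (ev p').1 ≤ (ev (p - 1)).1 := hev.sorted _ _ (by omega) (by omega)
      refine h1.trans ?_
      by_contra hcon
      refine hc ⟨by exact_mod_cast (by omega : 0 < p), ?_⟩
      rw [(hlow (p - 1) (by omega)).1]
      exact_mod_cast not_le.1 hcon
    have hpl := hlt p hpn
    refine .seq (.store hX0 (henv.ev_evA e23) (by omega) e22 ?_)
    set σ1 := σ'.setMem (P.evA p) v with hσ1
    have henv1 : P.EdgeEnv j σ1 := henv.congr (fun x _ _ => rfl) fun a ha => by
      rw [hσ1, Store.setMem_mem, if_neg]; simp only [flagA, evA] at *; omega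
    refine .seq (.store hX0 ((henv1.ev_evA (.reg_of h23)).natAdd Ev.nat1) (by omega)
      (Ev.reg_of (x := (k : ℝ)) ((hr 13 (by omega)).trans h13)) ?_)
    have e12 : Ev P.memSize (σ1.setMem (P.evA p + 1) k) (reg 12) (n : ℕ) :=
      .reg_of ((hr 12 (by omega)).trans hev.reg12)
    refine .assign hX0 (e12.natAdd Ev.nat1) (hQ _ (fun p' => if p' < p then ev p' else if p' = p then (v, k) else ev (p' - 1))
        (fun x h1 h2 => ?_) (fun a ha => ?_) ⟨by simp, fun p' hp' => ?_, fun p' hp' => ?_,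
          fun p₁ p₂ h12 h2 => ?_⟩ ?_)
    · simp [h1, hσ1]; exact hr x h2
    · simp only [Store.setReg_mem, hσ1, Store.setMem_mem]
      rw [if_neg, if_neg]
      · exact hm a ha
      · simp only [evA] at *; omega
      · simp only [evA] at *; omega
    · simp only [Store.setReg_mem, hσ1, Store.setMem_mem, evA]
      rw [if_neg (by omega)]
      rcases lt_trichotomy p' p with h1 | rfl | h1
      · rw [if_neg (by omega), if_pos h1]; exact (hlow p' h1).1
      · simp
      · rw [if_neg (by omega), if_neg (by omega), if_neg (by omega)]
        exact (hhigh p' h1 (by omega)).1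
    · simp only [Store.setReg_mem, hσ1, Store.setMem_mem, evA]
      rcases lt_trichotomy p' p with h1 | rfl | h1
      · rw [if_neg (by omega), if_neg (by omega), if_pos h1]; exact (hlow p' h1).2
      · simp
      · rw [if_neg (by omega), if_neg (by omega), if_neg (by omega), if_neg (by omega)]
        exact (hhigh p' h1 (by omega)).2.1
    · have hs := hev.sorted
      have hh : ∀ p', p < p' → p' ≤ n → v ≤ (ev (p' - 1)).1 := fun p' h1 h2 => (hhigh p' h1 h2).2.2
      rcases lt_trichotomy p₁ p with h1 | h1 | h1 <;> rcases lt_trichotomy p₂ p with h3 | h3 | h3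
      · rw [if_pos h1, if_pos h3]; exact hs _ _ h12 (by omega)
      · rw [if_pos h1, if_neg (by omega), if_pos h3]; exact hle _ h1
      · rw [if_pos h1, if_neg (by omega), if_neg (by omega)]; exact hs _ _ (by omega) (by omega)
      · omega
      · rw [if_neg (by omega), if_pos h1, if_neg (by omega), if_pos h3]
      · rw [if_neg (by omega), if_pos h1, if_neg (by omega), if_neg (by omega)]
        exact hh _ h3 (by omega)
      · omega
      · omega
      · rw [if_neg (by omega), if_neg (by omega), if_neg (by omega), if_neg (by omega)]
        exact hs _ _ (by omega) (by omega)
    · ext e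
      simp only [mem_image, mem_Iio, mem_insert_iff]
      constructor
      · rintro ⟨p', hp', rfl⟩
        rcases lt_trichotomy p' p with h1 | rfl | h1
        · rw [if_pos h1]; exact .inr ⟨p', by omega, rfl⟩
        · simp
        · rw [if_neg (by omega), if_neg (by omega)]; exact .inr ⟨p' - 1, by omega, rfl⟩
      · rintro (rfl | ⟨p', hp', rfl⟩)
        · exact ⟨p, by omega, by simp⟩
        · by_cases h1 : p' < p
          · exact ⟨p', by omega, by rw [if_pos h1]⟩
          · exact ⟨p' + 1, by omega, by
              rw [if_neg (by omega), if_neg (by omega), Nat.add_sub_cancel]⟩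

end CurveTask

namespace CurveTask

open Expr

variable {d N : ℕ} (P : CurveTask d N)

/-! ### Computing the breakpoints on an edge -/

/-- Computes a breakpoint for the update point in register `13`. -/
def splitProg (d m : ℕ) : Prog :=
  .seq (.assign 14 (clampE (max 0 (mem (locAE d (reg 13)) + 2 - ofNat (m / 6)))))
    (.seq (search (reg 8 + 1) fun e =>
        boundaryE d (ptsE d (reg 13)) (reg 14) (gridE (e - 1)) (Fin.ofNat 6 m))
      (.seq (.assign 22 (reg 30)) (insertProg d)))

/-- Computes all breakpoints for the update point in register `13`. -/
def splitsProg (d : ℕ) : Prog :=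
  .seq (.assign 22 0) (.seq (insertProg d) (.rep (splitProg d) 36))

/-- Computes the sorted list of all breakpoints on the edge in register `7`. -/
def allSplitsProg (d : ℕ) : Prog :=
  .seq (.assign 12 0) (.seq (.assign 13 0)
    (.while (lt (reg 13) (reg 6)) (.seq (splitsProg d) (.assign 13 (reg 13 + 1)))))

/-- Only the registers from `12` on and the list of breakpoints have been changed. -/
structure EvFrame (σ σ' : Store) : Prop where
  reg : ∀ x < 12, σ'.reg x = σ.reg x
  mem : ∀ a, a < P.evA 0 ∨ P.recA 0 ≤ a → σ'.mem a = σ.mem a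

/-- The set `E` of pairs of a breakpoint and an update point is complete for the first `k` update
points. -/
def AllSplits (j k : ℕ) (E : Set (ℕ × ℕ)) : Prop :=
  ∀ k' < k, (0, k') ∈ E ∧
    P.S.HasSplits P.Δ (P.pts k') j (P.loc k') {p | (p, k') ∈ E}

/-- The first `k` update points have been treated. -/
def SplitState (j k : ℕ) (σ : Store) : Prop :=
  ∃ n ev, n ≤ 37 * k ∧ P.EvList n ev σ ∧
    (∀ e ∈ ev '' Iio n, e.2 < k ∧ e.1 ≤ P.S.gridCount P.Δ j) ∧ P.AllSplits j k (ev '' Iio n)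

/-- The `m`-th test for the `k`-th update point. -/
def splitTest (j k m a : ℕ) : Prop :=
  P.S.boundaryTest P.Δ (P.pts k) j (Min.min (N - 1) (P.loc k + 2 - m / 6)) (Fin.ofNat 6 m)
    (P.S.gridVal P.Δ j a)

/-- The first `m` tests for the `k`-th update point have been treated. -/
def PartialState (j k m : ℕ) (σ : Store) : Prop :=
  ∃ n ev, n ≤ 37 * k + 1 + m ∧ P.EvList n ev σ ∧
    (∀ e ∈ ev '' Iio n, e.2 < k + 1 ∧ e.1 ≤ P.S.gridCount P.Δ j) ∧
    P.AllSplits j k (ev '' Iio n) ∧ (0, k) ∈ ev '' Iio n ∧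
    ∀ m' < m, ∃ p, (p, k) ∈ ev '' Iio n ∧
      PolygonalCurve.IsSplit (P.splitTest j k m') (P.S.gridCount P.Δ j) p

variable {P}

theorem EvFrame.trans {σ σ' σ'' : Store} (h : P.EvFrame σ σ') (h' : P.EvFrame σ' σ'') :
    P.EvFrame σ σ'' :=
  ⟨fun x hx => (h'.reg x hx).trans (h.reg x hx), fun a ha => (h'.mem a ha).trans (h.mem a ha)⟩

theorem EvFrame.edgeEnv {σ σ' : Store} {j : ℕ} (h : P.EvFrame σ σ') (he : P.EdgeEnv j σ) :
    P.EdgeEnv j σ' :=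
  he.congr (fun x _ h2 => h.reg x (by omega)) fun a ha => h.mem a (.inl (by
    simp only [flagA, evA] at *; omega))

theorem AllSplits.mono {j k : ℕ} {E E' : Set (ℕ × ℕ)} (h : P.AllSplits j k E) (hE : E ⊆ E') :
    P.AllSplits j k E' := fun k' hk' =>
  ⟨hE (h k' hk').1, fun w h1 h2 h3 i =>
    let ⟨p, hp, hs⟩ := (h k' hk').2 w h1 h2 h3 i
    ⟨p, hE hp, hs⟩⟩

theorem run_splitProg {X l j k m : ℕ} {σ₀ σ : Store} (hj : j < N) (h₀ : P.EdgeEnv j σ₀)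
    (hk : k < P.q) (hm : m < 36) (hl : P.S.gridCount P.Δ j + 1 ≤ 2 ^ l)
    (hX : P.maxEv + l + 2 ≤ X) (hfr : P.EvFrame σ₀ σ) (h13 : σ.reg 13 = k)
    (hp : P.PartialState j k m σ) :
    Run P.memSize (splitProg d m) X σ fun σ' =>
      P.EvFrame σ₀ σ' ∧ σ'.reg 13 = k ∧ P.PartialState j k (m + 1) σ' := by
  obtain ⟨n, ev, hn, hev, hE, hall, h0, hpart⟩ := hp
  have hX0 : 0 < X := by omega
  have hq := P.q_le
  set w := Min.min (N - 1) (P.loc k + 2 - m / 6) with hw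
  have hwN : w < N := (min_le_left _ _).trans_lt (Nat.sub_lt P.S.edges_pos one_pos)
  have henv : P.EdgeEnv j σ := hfr.edgeEnv h₀
  have e13 : Ev P.memSize σ (reg 13) (k : ℕ) := .reg_of h13
  refine .seq (.assign hX0 (v := (w : ℝ)) (henv.ev_clamp
    (((henv.ev_loc e13 hk).natAdd Ev.nat2).natTruncSub (.nat _))) ?_)
  set σ1 := σ.setReg 14 w with hσ1
  have hs1 : ∀ a b x, x ≠ 14 → x ≠ 30 → x ≠ 31 → (σ1.setSearch a b).reg x = σ.reg x := by
    intro a b x h1 h2 h3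
    rw [Store.setSearch_reg _ _ _ h2 h3, hσ1, Store.setReg_reg, if_neg h1]
  have hf1 : ∀ a b, P.EvFrame σ₀ (σ1.setSearch a b) := fun a b =>
    hfr.trans ⟨fun x hx => hs1 a b x (by omega) (by omega) (by omega), fun _ _ => rfl⟩
  have h14 : ∀ a b, (σ1.setSearch a b).reg 14 = w := by
    intro a b
    rw [Store.setSearch_reg _ _ _ (by omega) (by omega), hσ1]; simp
  have h13' : ∀ a b, (σ1.setSearch a b).reg 13 = k := fun a b =>
    (hs1 a b 13 (by omega) (by omega) (by omega)).trans h13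
  -- The search starts at `0` without testing it. Shifting the test by one index turns its result
  -- `r` into a split: the test holds at `r - 1` unless `r = 0`, and fails at `r` unless `r` is the
  -- grid size.
  refine .seq (run_search (l := l) (T' := fun r => P.splitTest j k m (r - 1))
    (v := (P.S.gridCount P.Δ j + 1 : ℕ)) (by omega) (by exact_mod_cast hl)
    (fun a b => Ev.natAdd (.reg_of ((hf1 a b).edgeEnv h₀).reg8) Ev.nat1) ?_ ?_)
  · intro a b e r hr _ he
    have henv' := (hf1 a b).edgeEnv h₀
    exact henv'.ev_boundary hj (.reg_of (h14 a b)) hwN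
      (henv'.ev_pts (.reg_of (h13' a b)) hk) (henv'.ev_grid (he.natSub Ev.nat1 hr)) _
  · intro r b hr1 hr2
    rw [Nat.cast_lt] at hr1
    have hr2' : P.S.gridCount P.Δ j ≤ r ∨ ¬ P.splitTest j k m r := by
      rcases hr2 with hr2 | hr2
      · left
        have : P.S.gridCount P.Δ j + 1 ≤ r + 1 := by exact_mod_cast hr2
        omega
      · right; simpa using hr2
    have hsplit : PolygonalCurve.IsSplit (P.splitTest j k m) (P.S.gridCount P.Δ j) r := by
      refine ⟨?_, hr1.imp_right And.right, hr2'.imp_left fun h => ?_⟩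
      · rcases hr1 with rfl | hr1 <;> omega
      · rcases hr1 with rfl | hr1 <;> omega
    refine .seq (.assign hX0 (Ev.reg_of (x := (r : ℝ)) (by simp)) ?_)
    set σ2 := (σ1.setSearch r b).setReg 22 r with hσ2
    have hs2 : ∀ x, x ≠ 14 → x ≠ 22 → x ≠ 30 → x ≠ 31 → σ2.reg x = σ.reg x := by
      intro x h1 h2 h3 h4
      rw [hσ2, Store.setReg_reg, if_neg h2, hs1 _ _ _ h1 h3 h4]
    have hf2 : P.EvFrame σ₀ σ2 :=
      hfr.trans ⟨fun x hx => hs2 x (by omega) (by omega) (by omega) (by omega), fun _ _ => rfl⟩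
    have hnm : n < P.maxEv := by simp only [maxEv]; omega
    refine run_insert (v := r) (k := k) (hf2.edgeEnv h₀)
      (hev.congr (hs2 12 (by omega) (by omega) (by omega) (by omega)) hnm.le fun _ _ _ => rfl) hnm
      (by omega) (by simp [hσ2])
      ((hs2 13 (by omega) (by omega) (by omega) (by omega)).trans h13) ?_
    intro σ' ev' hr hm' hev' himg
    have hsub : ev '' Iio n ⊆ ev' '' Iio (n + 1) := himg ▸ subset_insert _ _
    refine ⟨hf2.trans ⟨fun x hx => hr x (by omega) (by omega), hm'⟩,
      (hr 13 (by omega) (by omega)).trans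
        ((hs2 13 (by omega) (by omega) (by omega) (by omega)).trans h13),
      n + 1, ev', by omega, hev', ?_, hall.mono hsub, hsub h0, ?_⟩
    · rw [himg]
      rintro e (rfl | he)
      · exact ⟨by simp only; omega, hsplit.1⟩
      · exact hE e he
    · intro m' hm2
      rcases Nat.lt_succ_iff_lt_or_eq.1 hm2 with hm2 | rfl
      · obtain ⟨p, hp1, hp2⟩ := hpart m' hm2
        exact ⟨p, hsub hp1, hp2⟩
      · exact ⟨r, himg ▸ mem_insert _ _, hsplit⟩

theorem run_splitsProg {X l j k : ℕ} {σ₀ σ : Store} (hj : j < N) (h₀ : P.EdgeEnv j σ₀)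
    (hk : k < P.q) (hl : P.S.gridCount P.Δ j + 1 ≤ 2 ^ l)
    (hX : P.maxEv + l + 2 ≤ X) (hfr : P.EvFrame σ₀ σ) (h13 : σ.reg 13 = k)
    (hs : P.SplitState j k σ) :
    Run P.memSize (splitsProg d) X σ fun σ' =>
      P.EvFrame σ₀ σ' ∧ σ'.reg 13 = k ∧ P.SplitState j (k + 1) σ' := by
  obtain ⟨n, ev, hn, hev, hE, hall⟩ := hs
  have hX0 : 0 < X := by omega
  have hq := P.q_le
  refine .seq (.assign hX0 .zero (.seq ?_))
  set σ1 := σ.setReg 22 0 with hσ1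
  have hs1 : ∀ x, x ≠ 22 → σ1.reg x = σ.reg x := fun x hx => by
    rw [hσ1, Store.setReg_reg, if_neg hx]
  have hf1 : P.EvFrame σ₀ σ1 := hfr.trans ⟨fun x hx => hs1 x (by omega), fun _ _ => rfl⟩
  have hnm : n < P.maxEv := by simp only [maxEv]; omega
  -- The extra breakpoint `0` forces the factor of this update point to be computed at the start of
  -- every row. It is the 37th besides the 36 boundaries.
  refine run_insert (v := 0) (k := k) (hf1.edgeEnv h₀)
      (hev.congr (hs1 12 (by omega)) hnm.le fun _ _ _ => rfl) hnm
      (by omega) (by simp [hσ1]) ((hs1 13 (by omega)).trans h13) ?_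
  intro σ2 ev' hr hm' hev' himg
  have hsub : ev '' Iio n ⊆ ev' '' Iio (n + 1) := himg ▸ subset_insert _ _
  refine (Run.rep hX0 (fun m σ' => P.EvFrame σ₀ σ' ∧ σ'.reg 13 = k ∧ P.PartialState j k m σ')
    ⟨hf1.trans ⟨fun x hx => hr x (by omega) (by omega), hm'⟩,
      (hr 13 (by omega) (by omega)).trans ((hs1 13 (by omega)).trans h13),
      n + 1, ev', by omega, hev', ?_, hall.mono hsub, himg ▸ mem_insert _ _,
      fun _ h => absurd h (Nat.not_lt_zero _)⟩
    fun m hm σ' ⟨h1, h2, h3⟩ => run_splitProg hj h₀ hk hm hl hX h1 h2 h3).imp ?_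
  · rw [himg]
    rintro e (rfl | he)
    · exact ⟨by simp only; omega, Nat.zero_le _⟩
    · have := hE e he
      exact ⟨by omega, this.2⟩
  · rintro σ3 ⟨h1, h2, n', ev'', hn', hev'', hE', hall', h0', hpart⟩
    refine ⟨h1, h2, n', ev'', by omega, hev'', hE', fun k' hk' => ?_⟩
    rcases Nat.lt_succ_iff_lt_or_eq.1 hk' with hk' | rfl
    · exact hall' k' hk'
    · refine ⟨h0', fun w hw1 hw2 hw3 i => ?_⟩
      -- The number of a test encodes the edge, counted down from `loc + 2`, in its quotient by `6`
      -- and the kind of boundary in its remainder. It is below `36` because `loc ≤ w + 3`.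
      obtain ⟨p, hp1, hp2⟩ := hpart (6 * (P.loc k' + 2 - w) + i) (by omega)
      refine ⟨p, hp1, ?_⟩
      have e1 : (6 * (P.loc k' + 2 - w) + (i : ℕ)) / 6 = P.loc k' + 2 - w := by omega
      have e2 : Fin.ofNat 6 (6 * (P.loc k' + 2 - w) + i) = i := by
        ext; simp only [Fin.ofNat]; omega
      have e3 : Min.min (N - 1) (P.loc k' + 2 - (P.loc k' + 2 - w)) = w := by omega
      unfold splitTest at hp2
      rwa [e1, e2, e3] at hp2

theorem run_allSplitsProg {X l j : ℕ} {σ : Store} (hj : j < N) (h₀ : P.EdgeEnv j σ)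
    (hl : P.S.gridCount P.Δ j + 1 ≤ 2 ^ l) (hX : (P.i + 2) * (P.maxEv + l + 2) ≤ X) :
    Run P.memSize (allSplitsProg d) X σ fun σ' => P.EvFrame σ σ' ∧ P.SplitState j P.q σ' := by
  have hX0 : 0 < X := by
    refine lt_of_lt_of_le ?_ hX
    positivity
  refine .seq (.assign hX0 .zero (.seq (.assign hX0 .zero ?_)))
  have hq := P.q_le
  refine Run.for_loop (Y := P.maxEv + l + 2)
    (fun k σ' => P.EvFrame σ σ' ∧ σ'.reg 13 = k ∧ P.SplitState j k σ') P.q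
    ((Nat.mul_le_mul_right _ (by omega)).trans hX) (by omega) ?_ ?_ ?_ ?_
  · refine ⟨⟨fun x hx => ?_, fun _ _ => rfl⟩, by simp, 0, fun _ => (0, 0), by simp,
      ⟨by simp, by simp, by simp, by simp⟩, by simp, fun k' hk' => absurd hk' (Nat.not_lt_zero _)⟩
    simp only [Store.setReg_reg]
    rw [if_neg (by omega), if_neg (by omega)]
  · rintro k σ' hk ⟨h1, h2, h3⟩
    exact ((Ev.reg_of h2).lt (Ev.reg_of (h1.edgeEnv h₀).reg6)).congr
      (ind_congr Nat.cast_lt)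
  · rintro k σ' hk ⟨h1, h2, h3⟩
    refine .seq ((run_splitsProg hj h₀ hk hl le_rfl h1 h2 h3).imp ?_)
    rintro σ'' ⟨h1', h2', n, ev, h3', h4', h5'⟩
    refine .assign (by omega) (Ev.natAdd (.reg_of h2') Ev.nat1) ⟨h1'.trans
      ⟨fun x hx => ?_, fun _ _ => rfl⟩, by simp, n, ev, h3', h4'.congr (by simp) ?_ fun _ _ _ => rfl, h5'⟩
    · rw [Store.setReg_reg, if_neg (by omega)]
    · simp only [maxEv]; omega
  · rintro σ' ⟨h1, -, h2⟩
    exact ⟨h1, h2⟩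

end CurveTask

/-! ### Records -/

/-- A block of candidates on the `j`-th edge: the first endpoint has a grid index in `[x, x + w)`,
the second one in `[y, y + h)`; all these candidates have the weight `wt`. -/
structure Rec where
  (j x y w h : ℕ)
  wt : ℝ

namespace Rec

/-- The candidates of a block, as triples of an edge and two grid indices. -/
def cells (R : Rec) : Set (ℕ × ℕ × ℕ) :=
  {z | z.1 = R.j ∧ (R.x ≤ z.2.1 ∧ z.2.1 < R.x + R.w) ∧ R.y ≤ z.2.2 ∧ z.2.2 < R.y + R.h}

/-- The total weight of a block. -/
noncomputable def mass (R : Rec) : ℝ := R.w * R.h * R.wt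

end Rec

/-- The total weight of the first `q` blocks. -/
noncomputable def prefixMass (rec : ℕ → Rec) (q : ℕ) : ℝ := ∑ p ∈ Finset.range q, (rec p).mass

namespace CurveTask

open Expr

variable {d N : ℕ} (P : CurveTask d N)

/-- The candidate with an edge and two grid indices `z` is in the `k`-th feasible set. -/
def Cov (k : ℕ) (z : ℕ × ℕ × ℕ) : Prop :=
  P.S.Covers P.Δ (P.pts k) z.1 (P.S.gridVal P.Δ z.1 z.2.1) (P.S.gridVal P.Δ z.1 z.2.2)

/-- The weight of a candidate. -/
noncomputable def wt (z : ℕ × ℕ × ℕ) : ℝ := ∏ k ∈ Finset.range P.q, (1 + ind (P.Cov k z))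

/-- The triples of an edge and two grid indices. -/
def valid : Set (ℕ × ℕ × ℕ) :=
  {z | z.1 < N ∧ z.2.1 < P.S.gridCount P.Δ z.1 ∧ z.2.2 < P.S.gridCount P.Δ z.1}

/-- The contents of the memory cells of the `q`-th record. -/
noncomputable def field (rec : ℕ → Rec) (q : ℕ) : ℕ → ℝ
  | 0 => prefixMass rec q
  | 1 => (rec q).wt
  | 2 => (rec q).x
  | 3 => (rec q).y
  | 4 => (rec q).w
  | 5 => (rec q).h
  | 6 => (rec q).j
  | _ => P.S.step P.Δ (rec q).j

/-- The memory contains the records `rec 0, …, rec (M - 1)`. -/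
structure Table (M : ℕ) (rec : ℕ → Rec) (σ : Store) : Prop where
  reg10 : σ.reg 10 = M
  reg11 : σ.reg 11 = prefixMass rec M
  field : ∀ q < M, ∀ f < 8, σ.mem (P.recA q + f) = P.field rec q f

/-- The blocks `rec 0, …, rec (M - 1)` form a partition of `D`, with the right weights. -/
structure Partition (M : ℕ) (rec : ℕ → Rec) (D : Set (ℕ × ℕ × ℕ)) : Prop where
  sub : ∀ q < M, ∀ z ∈ (rec q).cells, z ∈ D ∧ (rec q).wt = P.wt z
  cover : ∀ z ∈ D, ∃ q < M, z ∈ (rec q).cells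
  disj : ∀ q < M, ∀ q' < M, ∀ z, z ∈ (rec q).cells → z ∈ (rec q').cells → q = q'

variable {P}

theorem Partition.congr {M : ℕ} {rec : ℕ → Rec} {D D' : Set (ℕ × ℕ × ℕ)}
    (h : P.Partition M rec D) (hD : ∀ z, z ∈ D ↔ z ∈ D') : P.Partition M rec D' := by
  rwa [show D' = D from (Set.ext hD).symm]

theorem Partition.add {M : ℕ} {rec : ℕ → Rec} {D D' : Set (ℕ × ℕ × ℕ)} {R : Rec}
    (h : P.Partition M rec D) (hD : ∀ z, z ∈ D' ↔ z ∈ D ∨ z ∈ R.cells)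
    (hR : ∀ z ∈ R.cells, z ∉ D ∧ R.wt = P.wt z) :
    P.Partition (M + 1) (Function.update rec M R) D' where
  sub q hq z hz := by
    rcases Nat.lt_succ_iff_lt_or_eq.1 hq with hq | rfl
    · rw [Function.update_of_ne hq.ne] at hz ⊢
      have := h.sub q hq z hz
      exact ⟨(hD z).2 (.inl this.1), this.2⟩
    · rw [Function.update_self] at hz ⊢
      exact ⟨(hD z).2 (.inr hz), (hR z hz).2⟩
  cover z hz := by
    rcases (hD z).1 hz with hz | hz
    · obtain ⟨q, hq, hz⟩ := h.cover z hz
      exact ⟨q, by omega, by rwa [Function.update_of_ne hq.ne]⟩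
    · exact ⟨M, by omega, by rwa [Function.update_self]⟩
  disj q hq q' hq' z hz hz' := by
    rcases Nat.lt_succ_iff_lt_or_eq.1 hq with hq | rfl <;>
      rcases Nat.lt_succ_iff_lt_or_eq.1 hq' with hq' | rfl
    · rw [Function.update_of_ne hq.ne] at hz
      rw [Function.update_of_ne hq'.ne] at hz'
      exact h.disj q hq q' hq' z hz hz'
    · rw [Function.update_of_ne hq.ne] at hz
      rw [Function.update_self] at hz'
      exact absurd (h.sub q hq z hz).1 (hR z hz').1
    · rw [Function.update_of_ne hq'.ne] at hz'
      rw [Function.update_self] at hz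
      exact absurd (h.sub q' hq' z hz').1 (hR z hz).1
    · rfl

theorem prefixMass_update {M q : ℕ} (rec : ℕ → Rec) (R : Rec) (hq : q ≤ M) :
    prefixMass (Function.update rec M R) q = prefixMass rec q :=
  Finset.sum_congr rfl fun p hp => by
    rw [Function.update_of_ne]; have := Finset.mem_range.1 hp; omega

theorem field_update {M q : ℕ} (rec : ℕ → Rec) (R : Rec) (hq : q < M) (f : ℕ) :
    P.field (Function.update rec M R) q f = P.field rec q f := by
  unfold field
  rw [prefixMass_update rec R hq.le, Function.update_of_ne hq.ne]

theorem Table.congr {M : ℕ} {rec : ℕ → Rec} {σ σ' : Store} (h : P.Table M rec σ)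
    (h10 : σ'.reg 10 = σ.reg 10) (h11 : σ'.reg 11 = σ.reg 11)
    (hm : ∀ a, P.recA 0 ≤ a → σ'.mem a = σ.mem a) : P.Table M rec σ' where
  reg10 := h10.trans h.reg10
  reg11 := h11.trans h.reg11
  field q hq f hf := (hm _ (by simp only [recA]; omega)).trans (h.field q hq f hf)

variable (P)

/-! ### The cells of an edge -/

/-- `ev 0, …, ev (n - 1)` is a complete sorted list of the breakpoints on the `j`-th edge. -/
structure Cuts (j n : ℕ) (ev : ℕ → ℕ × ℕ) : Prop where
  le_maxEv : n ≤ P.maxEv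
  sorted : ∀ p p', p ≤ p' → p' < n → (ev p).1 ≤ (ev p').1
  own_lt : ∀ p < n, (ev p).2 < P.q
  val_le : ∀ p < n, (ev p).1 ≤ P.S.gridCount P.Δ j
  splits : P.AllSplits j P.q (ev '' Iio n)

/-- The end of the `p`-th interval between breakpoints. -/
noncomputable def cut (j n : ℕ) (ev : ℕ → ℕ × ℕ) (p : ℕ) : ℕ :=
  if p < n then (ev p).1 else P.S.gridCount P.Δ j

/-- The start of the `p`-th interval between breakpoints. -/
noncomputable def cutStart (j n : ℕ) (ev : ℕ → ℕ × ℕ) (p : ℕ) : ℕ :=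
  if p = 0 then 0 else P.cut j n ev (p - 1)

/-- The factors `fl` are those of the candidates that start at `x` and end at the last breakpoint
before the `s`-th one. -/
def FlagsOK (j : ℕ) (ev : ℕ → ℕ × ℕ) (x s : ℕ) (fl : ℕ → ℝ) : Prop :=
  ∀ k < P.q, ∀ p < s, (ev p).2 = k → (∀ p', p < p' → p' < s → (ev p').2 ≠ k) →
    fl k = 1 + ind (P.Cov k (j, x, (ev p).1))

variable {P}

section

variable {j n : ℕ} {ev : ℕ → ℕ × ℕ}

theorem Cuts.cut_mono (h : P.Cuts j n ev) : Monotone (P.cut j n ev) := by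
  intro p p' hp
  unfold cut
  split_ifs with h1 h2 h2
  · exact h.sorted p p' hp h2
  · exact h.val_le p h1
  · omega
  · exact le_rfl

theorem Cuts.cut_le (h : P.Cuts j n ev) (p : ℕ) : P.cut j n ev p ≤ P.S.gridCount P.Δ j := by
  unfold cut
  split_ifs with h1
  · exact h.val_le p h1
  · exact le_rfl

@[simp] theorem cutStart_zero : P.cutStart j n ev 0 = 0 := rfl

@[simp] theorem cutStart_succ (p : ℕ) : P.cutStart j n ev (p + 1) = P.cut j n ev p := rfl

theorem Cuts.cutStart_le (h : P.Cuts j n ev) (p : ℕ) : P.cutStart j n ev p ≤ P.cut j n ev p := by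
  rcases p with _ | p
  · exact Nat.zero_le _
  · exact h.cut_mono (Nat.le_succ p)

/-- No breakpoint lies after the start of an interval and at or before one of its points. -/
theorem Cuts.lt_of_le (h : P.Cuts j n ev) {r p x : ℕ} (hp : p < n)
    (hx : x < P.cut j n ev r) (hpx : (ev p).1 ≤ x) :
    p < r ∧ (ev p).1 ≤ P.cutStart j n ev r := by
  have hpr : p < r := by
    by_contra hcon
    have := h.cut_mono (not_lt.1 hcon)
    rw [cut, cut, if_pos hp] at this
    rw [cut] at hx
    omega
  obtain ⟨r, rfl⟩ : ∃ r', r = r' + 1 := ⟨r - 1, by omega⟩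
  refine ⟨hpr, ?_⟩
  have := h.cut_mono (show p ≤ r by omega)
  rw [cut, if_pos hp] at this
  rwa [cutStart_succ]

/-- A stored factor is outdated but still right: it was computed at the last breakpoint of its own
update point, and since then only breakpoints of other points have been passed. So the point of
evaluation and the current candidate are in the same cells with respect to the breakpoints of `k`,
and `HasSplits.covers_iff` applies. The breakpoint `0` ensures that the factor has been computed at
all. -/
theorem Cuts.flag_eq (h : P.Cuts j n ev) {r s x y k : ℕ} {fl : ℕ → ℝ}
    (hs : s ≤ n) (hx : P.cutStart j n ev r ≤ x) (hx' : x < P.cut j n ev r)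
    (hy : P.cutStart j n ev s ≤ y) (hy' : y < P.cut j n ev s) (hk : k < P.q)
    (hfl : P.FlagsOK j ev (P.cutStart j n ev r) s fl) :
    fl k = 1 + ind (P.Cov k (j, x, y)) := by
  classical
  obtain ⟨⟨p₀, hp₀, hp0⟩, hsp⟩ := h.splits k hk
  have hex : ∃ p, p < s ∧ (ev p).2 = k :=
    ⟨p₀, (h.lt_of_le hp₀ hy' (by rw [hp0]; exact Nat.zero_le _)).1, by rw [hp0]⟩
  obtain ⟨p, ⟨hps, hpk⟩, hlast⟩ : ∃ p, (p < s ∧ (ev p).2 = k) ∧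
      ∀ p', p < p' → p' < s → (ev p').2 ≠ k := by
    obtain ⟨p₁, hp₁⟩ := hex
    let p := Nat.findGreatest (fun p => p < s ∧ (ev p).2 = k) s
    have hspec : p < s ∧ (ev p).2 = k :=
      Nat.findGreatest_spec (P := fun p => p < s ∧ (ev p).2 = k) hp₁.1.le hp₁
    exact ⟨p, hspec, fun p' h1 h2 h3 =>
      Nat.findGreatest_is_greatest (P := fun p => p < s ∧ (ev p).2 = k) h1 h2.le ⟨h2, h3⟩⟩
  rw [hfl k hk p hps hpk hlast]
  congr 1
  refine ind_congr ?_
  have hpy : (ev p).1 ≤ y := by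
    refine le_trans ?_ hy
    obtain ⟨s, rfl⟩ : ∃ s', s = s' + 1 := ⟨s - 1, by omega⟩
    have := h.cut_mono (show p ≤ s by omega)
    rwa [cut, if_pos (by omega)] at this
  have hxc := hx'.trans_le (h.cut_le r)
  have hyc := hy'.trans_le (h.cut_le s)
  refine hsp.covers_iff P.Δ_pos (P.isLoc_loc hk) ?_ ?_ (hx.trans_lt hxc) hxc (hpy.trans_lt hyc) hyc
  · rintro b ⟨p', hp', hb⟩
    refine ⟨fun hle => hle.trans hx, fun hle => ?_⟩
    have := (h.lt_of_le hp' hx' (by rw [hb]; exact hle)).2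
    rwa [hb] at this
  · rintro b ⟨p', hp', hb⟩
    refine ⟨fun hle => hle.trans hpy, fun hle => ?_⟩
    have h1 := (h.lt_of_le hp' hy' (by rw [hb]; exact hle)).1
    have h2 : p' ≤ p := by
      by_contra hcon
      exact hlast p' (not_le.1 hcon) h1 (by rw [hb])
    have := h.sorted p' p h2 (by omega)
    rwa [hb] at this

/-- Passing a breakpoint requires only the factor of its owner to be recomputed. -/
theorem FlagsOK.step {x s k : ℕ} {fl : ℕ → ℝ} (h : P.FlagsOK j ev x s fl) (hk : (ev s).2 = k) :
    P.FlagsOK j ev x (s + 1)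
      (Function.update fl k (1 + ind (P.Cov k (j, x, (ev s).1)))) := by
  intro k' hk' p hp hpk hlast
  by_cases hkk : k' = k
  · subst hkk
    rw [Function.update_self]
    have : p = s := by
      by_contra hne
      exact hlast s (by omega) (by omega) hk
    rw [this]
  · rw [Function.update_of_ne hkk]
    have hps : p ≠ s := by rintro rfl; exact hkk (hpk.symm.trans hk)
    exact h k' hk' p (by omega) hpk fun p' h1 h2 => hlast p' h1 (by omega)

end

end CurveTask

namespace CurveTask

open Expr

variable {d N : ℕ} (P : CurveTask d N)

/-! ### Computing the cells of an edge -/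

/-- The entries of a record. -/
def recE : ℕ → Expr
  | 0 => reg 11
  | 1 => reg 20
  | 2 => reg 17
  | 3 => reg 19
  | 4 => reg 24
  | 5 => reg 21 - reg 19
  | 6 => reg 7
  | _ => reg 9

/-- Stores a record. -/
def recProg (d : ℕ) : Prog :=
  .rep (fun f => .store (recAE d (reg 10) + ofNat f) (recE f)) 8

/-- Updates the weight when the breakpoint with the number in register `18` is passed. -/
def flagProg (d : ℕ) : Prog :=
  .seq (.assign 13 (mem (evAE d (reg 18) + 1)))
    (.seq (.assign 25 (1 + coversE d (ptsE d (reg 13)) (mem (locAE d (reg 13)))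
        (gridE (reg 17)) (gridE (reg 21))))
      (.seq (.assign 20 (reg 20 / mem (flagAE d (reg 13)) * reg 25))
        (.store (flagAE d (reg 13)) (reg 25))))

/-- Treats a cell. -/
def cellProg (d : ℕ) : Prog :=
  .seq (.assign 21 (mem (evAE d (reg 18)))) (.seq (recProg d)
    (.seq (.assign 11 (reg 11 + reg 24 * (reg 21 - reg 19) * reg 20))
      (.seq (.assign 10 (reg 10 + 1)) (.seq (.ite (lt (reg 18) (reg 12)) (flagProg d) .skip)
        (.seq (.assign 19 (reg 21)) (.assign 18 (reg 18 + 1)))))))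

/-- Treats a row of cells. -/
def rowProg (d : ℕ) : Prog :=
  .seq (.assign 24 (mem (evAE d (reg 16)) - reg 17)) (.seq (.assign 13 0)
    (.seq (.while (lt (reg 13) (reg 6))
        (.seq (.store (flagAE d (reg 13)) 1) (.assign 13 (reg 13 + 1))))
      (.seq (.assign 20 1) (.seq (.assign 18 0) (.seq (.assign 19 0)
        (.seq (.while (le (reg 18) (reg 12)) (cellProg d))
          (.seq (.assign 17 (reg 17 + reg 24)) (.assign 16 (reg 16 + 1)))))))))

/-- Treats all cells of an edge. -/
def cellsProg (d : ℕ) : Prog :=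
  .seq (.store (evAE d (reg 12)) (reg 8)) (.seq (.assign 16 0) (.seq (.assign 17 0)
    (.while (le (reg 16) (reg 12)) (rowProg d))))

/-- The breakpoints on the `j`-th edge are in place. -/
structure CutsEnv (j n : ℕ) (ev : ℕ → ℕ × ℕ) (σ : Store) : Prop extends P.EdgeEnv j σ where
  reg12 : σ.reg 12 = n
  val : ∀ p ≤ n, σ.mem (P.evA p) = P.cut j n ev p
  own : ∀ p < n, σ.mem (P.evA p + 1) = (ev p).2
  cuts : P.Cuts j n ev

/-- Only the registers from `10` on except register `12`, the factors and the records have been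
changed. -/
structure CellFrame (σ σ' : Store) : Prop where
  reg : ∀ x, x < 10 ∨ x = 12 → σ'.reg x = σ.reg x
  mem : ∀ a, a < P.flagA 0 ∨ P.evA 0 ≤ a ∧ a < P.recA 0 → σ'.mem a = σ.mem a

/-- The rows before the `r`-th one have been treated. -/
def rowDone (j n : ℕ) (ev : ℕ → ℕ × ℕ) (r : ℕ) : Set (ℕ × ℕ × ℕ) :=
  {z | z ∈ P.valid ∧ (z.1 < j ∨ z.1 = j ∧ z.2.1 < P.cutStart j n ev r)}

/-- The rows before the `r`-th one and the cells before the `s`-th one in that row have been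
treated. -/
def cellDone (j n : ℕ) (ev : ℕ → ℕ × ℕ) (r s : ℕ) : Set (ℕ × ℕ × ℕ) :=
  {z | z ∈ P.valid ∧ (z.1 < j ∨ z.1 = j ∧ (z.2.1 < P.cutStart j n ev r ∨
    z.2.1 < P.cut j n ev r ∧ z.2.2 < P.cutStart j n ev s))}

/-- The `s`-th cell in the `r`-th row is going to be treated. -/
structure CellState (j n : ℕ) (ev : ℕ → ℕ × ℕ) (M : ℕ) (rec : ℕ → Rec) (fl : ℕ → ℝ) (r s : ℕ)
    (σ : Store) : Prop where
  reg16 : σ.reg 16 = r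
  reg17 : σ.reg 17 = P.cutStart j n ev r
  reg18 : σ.reg 18 = s
  reg19 : σ.reg 19 = P.cutStart j n ev s
  reg20 : σ.reg 20 = ∏ k ∈ Finset.range P.q, fl k
  reg24 : σ.reg 24 = P.cut j n ev r - P.cutStart j n ev r
  flag : ∀ k < P.q, σ.mem (P.flagA k) = fl k ∧ fl k ≠ 0
  flagsOK : s ≤ n → P.FlagsOK j ev (P.cutStart j n ev r) s fl
  table : P.Table M rec σ
  part : P.Partition M rec (P.cellDone j n ev r s)

variable {P}

theorem CellFrame.refl (σ : Store) : P.CellFrame σ σ := ⟨fun _ _ => rfl, fun _ _ => rfl⟩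

theorem CellFrame.trans {σ σ' σ'' : Store} (h : P.CellFrame σ σ') (h' : P.CellFrame σ' σ'') :
    P.CellFrame σ σ'' :=
  ⟨fun x hx => (h'.reg x hx).trans (h.reg x hx), fun a ha => (h'.mem a ha).trans (h.mem a ha)⟩

theorem CellFrame.setReg {σ : Store} {x : ℕ} {v : ℝ} (hx : 10 ≤ x) (hx' : x ≠ 12) :
    P.CellFrame σ (σ.setReg x v) :=
  ⟨fun y hy => by rw [Store.setReg_reg, if_neg (by omega)], fun _ _ => rfl⟩

theorem CellFrame.setFlag {σ : Store} {k : ℕ} {v : ℝ} (hk : k < P.i + 1) :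
    P.CellFrame σ (σ.setMem (P.flagA k) v) :=
  ⟨fun y hy => rfl, fun a ha => by
    rw [Store.setMem_mem, if_neg]; simp only [flagA, evA] at *; omega⟩

theorem CellFrame.cutsEnv {σ σ' : Store} {j n : ℕ} {ev : ℕ → ℕ × ℕ} (h : P.CellFrame σ σ')
    (he : P.CutsEnv j n ev σ) : P.CutsEnv j n ev σ' where
  toEdgeEnv := he.toEdgeEnv.congr (fun x _ h2 => h.reg x (.inl h2)) fun a ha => h.mem a (.inl ha)
  reg12 := (h.reg 12 (.inr rfl)).trans he.reg12
  val p hp := (h.mem _ (.inr (by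
    have := he.cuts.le_maxEv; simp only [evA, recA, maxEv] at *; omega))).trans (he.val p hp)
  own p hp := (h.mem _ (.inr (by
    have := he.cuts.le_maxEv; simp only [evA, recA, maxEv] at *; omega))).trans (he.own p hp)
  cuts := he.cuts

theorem run_recProg {X M : ℕ} {σ : Store} {rec : ℕ → Rec} (hX : 0 < X) (h : P.Env σ)
    (hM : M < P.maxRec) (h10 : σ.reg 10 = M)
    (hE : ∀ f < 8, ∀ σ', σ'.reg = σ.reg → Ev P.memSize σ' (recE f) (P.field rec M f)) :
    Run P.memSize (recProg d) X σ fun σ' => σ'.reg = σ.reg ∧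
      (∀ a, a < P.recA M ∨ P.recA M + 8 ≤ a → σ'.mem a = σ.mem a) ∧
      ∀ f < 8, σ'.mem (P.recA M + f) = P.field rec M f := by
  refine Run.rep hX (fun m σ' => σ'.reg = σ.reg ∧
      (∀ a, a < P.recA M ∨ P.recA M + 8 ≤ a → σ'.mem a = σ.mem a) ∧
      ∀ f < m, σ'.mem (P.recA M + f) = P.field rec M f) ⟨rfl, fun _ _ => rfl, by simp⟩ ?_
  rintro m hm σ' ⟨h1, h2, h3⟩
  have henv : P.Env σ' := h.congr (fun x _ _ => by rw [h1]) fun a ha => h2 a (.inl (by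
    simp only [locA, recA] at *; omega))
  have hlt := P.maxRec_le_memSize M hM
  refine .store hX ((henv.ev_recA (.reg_of (by rw [h1]; exact h10))).natAdd (.nat m)) (by omega)
    (hE m hm σ' h1) ⟨h1, fun a ha => ?_, fun f hf => ?_⟩
  · rw [Store.setMem_mem, if_neg (by omega)]
    exact h2 a ha
  · rw [Store.setMem_mem]
    by_cases hfm : f = m
    · rw [if_pos (by omega), hfm]
    · rw [if_neg (by omega)]
      exact h3 f (by omega)

theorem Table.add {M : ℕ} {rec : ℕ → Rec} {R : Rec} {σ σ' : Store} (h : P.Table M rec σ)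
    (h10 : σ'.reg 10 = M + 1) (h11 : σ'.reg 11 = prefixMass rec M + R.mass)
    (hm : ∀ a, P.recA 0 ≤ a → a < P.recA M ∨ P.recA M + 8 ≤ a → σ'.mem a = σ.mem a)
    (hf : ∀ f < 8, σ'.mem (P.recA M + f) = P.field (Function.update rec M R) M f) :
    P.Table (M + 1) (Function.update rec M R) σ' where
  reg10 := by rw [h10]; push_cast; rfl
  reg11 := by
    change _ = ∑ p ∈ Finset.range (M + 1), (Function.update rec M R p).mass
    rw [h11, Finset.sum_range_succ, Function.update_self]
    exact congrArg (· + R.mass) (prefixMass_update rec R le_rfl).symm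
  field q hq f hf' := by
    rcases Nat.lt_succ_iff_lt_or_eq.1 hq with hq | rfl
    · rw [field_update rec R hq, hm _ (by simp only [recA]; omega) (.inl (by
        simp only [recA] at *; omega))]
      exact h.field q hq f hf'
    · exact hf f hf'

section

variable {j n : ℕ} {ev : ℕ → ℕ × ℕ}

/-- The record of a cell. -/
noncomputable def cellRec (P : CurveTask d N) (j n : ℕ) (ev : ℕ → ℕ × ℕ) (fl : ℕ → ℝ)
    (r s : ℕ) : Rec where
  j := j
  x := P.cutStart j n ev r
  y := P.cutStart j n ev s
  w := P.cut j n ev r - P.cutStart j n ev r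
  h := P.cut j n ev s - P.cutStart j n ev s
  wt := ∏ k ∈ Finset.range P.q, fl k

/-- Cells are treated in row-major order, so a new block is disjoint from the earlier ones. Its
weight is right at each of its candidates by `flag_eq`; an empty cell gives an empty block. -/
theorem Cuts.partition_step (h : P.Cuts j n ev) (hj : j < N) {M r s : ℕ} {rec : ℕ → Rec}
    {fl : ℕ → ℝ} (hs : s ≤ n) (hfl : P.FlagsOK j ev (P.cutStart j n ev r) s fl)
    (hp : P.Partition M rec (P.cellDone j n ev r s)) :
    P.Partition (M + 1) (Function.update rec M (P.cellRec j n ev fl r s))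
      (P.cellDone j n ev r (s + 1)) := by
  have h1 := h.cutStart_le r
  have h2 := h.cutStart_le s
  have h3 := h.cut_le r
  have h4 := h.cut_le s
  refine hp.add ?_ ?_
  · rintro ⟨a, b, c⟩
    simp only [cellDone, valid, Rec.cells, cellRec, mem_ofPred_eq, cutStart_succ]
    constructor
    · omega
    · rintro (h5 | h5)
      · omega
      · obtain ⟨rfl, h5⟩ := h5
        omega
  · rintro ⟨a, b, c⟩ hz
    simp only [Rec.cells, cellRec, mem_ofPred_eq] at hz
    obtain ⟨rfl, h5, h6⟩ := hz
    constructor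
    · simp only [cellDone, mem_ofPred_eq]
      omega
    · exact Finset.prod_congr rfl fun k hk =>
        h.flag_eq hs h5.1 (by omega) h6.1 (by omega) (Finset.mem_range.1 hk) hfl

/-- The factors are nonzero, so the product is updated by dividing out the old factor. This takes
constant time, whereas recomputing the product would cost a factor `i` for each cell. -/
theorem run_flagProg {X M k : ℕ} {rec : ℕ → Rec} {fl : ℕ → ℝ} {r s : ℕ} {σ : Store} (hj : j < N)
    (hX : 0 < X) (h : P.CutsEnv j n ev σ) (hs : s < n) (hk : (ev s).2 = k)
    (h17 : σ.reg 17 = P.cutStart j n ev r) (h18 : σ.reg 18 = s)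
    (h20 : σ.reg 20 = ∏ k ∈ Finset.range P.q, fl k) (h21 : σ.reg 21 = P.cut j n ev s)
    (hfl : ∀ k < P.q, σ.mem (P.flagA k) = fl k ∧ fl k ≠ 0)
    (ht : P.Table M rec σ) :
    Run P.memSize (flagProg d) X σ fun σ' => ∃ fl', P.CellFrame σ σ' ∧
      (∀ x, x ≠ 13 → x ≠ 20 → x ≠ 25 → σ'.reg x = σ.reg x) ∧
      σ'.reg 20 = ∏ k ∈ Finset.range P.q, fl' k ∧
      (∀ k < P.q, σ'.mem (P.flagA k) = fl' k ∧ fl' k ≠ 0) ∧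
      P.Table M rec σ' ∧ fl' = Function.update fl k
        (1 + ind (P.Cov k (j, P.cutStart j n ev r, (ev s).1))) := by
  have hkq : k < P.q := hk ▸ h.cuts.own_lt s hs
  have hq := P.q_le
  have hn := h.cuts.le_maxEv
  have hfB : P.flagA k < P.memSize := by simp only [flagA, memSize, recA]; omega
  have hcut : P.cut j n ev s = (ev s).1 := if_pos hs
  refine .seq (.assign hX (v := (k : ℝ)) (((h.ev_evA (.reg_of h18)).natAdd Ev.nat1).mem_of
    (by simp only [evA, memSize, recA, maxEv] at *; omega) ((h.own s hs).trans (by rw [hk]))) ?_)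
  set σ1 := σ.setReg 13 k with hσ1
  have hf1 : P.CellFrame σ σ1 := .setReg (by omega) (by omega)
  have henv1 := hf1.cutsEnv h
  have e13 : Ev P.memSize σ1 (reg 13) (k : ℕ) := .reg_of (by simp [hσ1])
  set c : ℝ := 1 + ind (P.Cov k (j, P.cutStart j n ev r, (ev s).1)) with hc
  have hc0 : c ≠ 0 := by have := ind_nonneg (P.Cov k (j, P.cutStart j n ev r, (ev s).1)); positivity
  refine .seq (.assign hX (v := c) (Ev.one.add (henv1.ev_covers hj (P.isLoc_loc hkq)
    (henv1.ev_loc e13 hkq) (henv1.ev_pts e13 hkq)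
    (henv1.ev_grid (n := P.cutStart j n ev r) (.reg_of (by simp [hσ1, h17])))
    (henv1.ev_grid (n := (ev s).1) (.reg_of (by simp [hσ1, h21, hcut]))))) ?_)
  set σ2 := σ1.setReg 25 c with hσ2
  have hf2 : P.CellFrame σ1 σ2 := .setReg (by omega) (by omega)
  have henv2 := hf2.cutsEnv henv1
  have e13 : Ev P.memSize σ2 (reg 13) (k : ℕ) := .reg_of (by simp [hσ2, hσ1])
  refine .seq (.assign hX (v := (∏ k ∈ Finset.range P.q, fl k) / fl k * c) ((Ev.div
    (.reg_of (by simp [hσ2, hσ1, h20])) ((henv2.ev_flagA e13).mem_of hfB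
      (hfl k hkq).1) (hfl k hkq).2).mul (.reg_of (by simp [hσ2]))) ?_)
  set σ3 := σ2.setReg 20 ((∏ k ∈ Finset.range P.q, fl k) / fl k * c) with hσ3
  have hf3 : P.CellFrame σ2 σ3 := .setReg (by omega) (by omega)
  have henv3 := hf3.cutsEnv henv2
  have e13 : Ev P.memSize σ3 (reg 13) (k : ℕ) := .reg_of (by simp [hσ3, hσ2, hσ1])
  refine .store hX (henv3.ev_flagA e13) hfB (v := c) (.reg_of (by simp [hσ3, hσ2]))
    ⟨_, (hf1.trans (hf2.trans hf3)).trans (.setFlag (by omega)), fun x h1 h2 h3 => ?_, ?_,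
      fun k' hk' => ?_, ht.congr ?_ ?_ fun a ha => ?_, rfl⟩
  · simp [hσ3, hσ2, hσ1, h1, h2, h3]
  · have hmem : k ∈ Finset.range P.q := Finset.mem_range.2 hkq
    rw [Finset.prod_update_of_mem hmem]
    simp only [Store.setMem_reg, hσ3, Store.setReg_reg, if_true]
    rw [← Finset.mul_prod_erase _ _ hmem, mul_div_cancel_left₀ _ (hfl k hkq).2, mul_comm,
      Finset.sdiff_singleton_eq_erase]
  · by_cases hkk : k' = k
    · subst hkk
      simp [hc0]
    · rw [Function.update_of_ne hkk, Store.setMem_mem, if_neg (by simp only [flagA]; omega)]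
      exact hfl k' hk'
  · simp [hσ3, hσ2, hσ1]
  · simp [hσ3, hσ2, hσ1]
  · rw [Store.setMem_mem, if_neg]
    · rfl
    · simp only [flagA, recA] at *; omega

theorem run_cellProg {X M : ℕ} {rec : ℕ → Rec} {fl : ℕ → ℝ} {r s : ℕ} {σ : Store} (hj : j < N)
    (hX : 0 < X) (h : P.CutsEnv j n ev σ) (hs : s ≤ n) (hM : M < P.maxRec)
    (hc : P.CellState j n ev M rec fl r s σ) :
    Run P.memSize (cellProg d) X σ fun σ' => P.CellFrame σ σ' ∧
      ∃ rec' fl', P.CellState j n ev (M + 1) rec' fl' r (s + 1) σ' := by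
  have hn := h.cuts.le_maxEv
  have hr := h.cuts.cutStart_le r
  have hs' := h.cuts.cutStart_le s
  have hmB := P.maxRec_le_memSize M hM
  set c := P.cut j n ev s with hcs
  set R := P.cellRec j n ev fl r s with hR
  have hRw : (R.w : ℝ) = P.cut j n ev r - P.cutStart j n ev r := Nat.cast_sub hr
  have hRh : (R.h : ℝ) = c - P.cutStart j n ev s := Nat.cast_sub hs'
  refine .seq (.assign hX (v := (c : ℝ)) ((h.ev_evA (.reg_of hc.reg18)).mem_of
    (by simp only [evA, memSize, recA, maxEv] at *; omega) (h.val s hs)) ?_)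
  set σ1 := σ.setReg 21 c with hσ1
  have hf1 : P.CellFrame σ σ1 := .setReg (by omega) (by omega)
  have henv1 := hf1.cutsEnv h
  refine .seq ((run_recProg (rec := Function.update rec M R) hX henv1.toEnv hM
    (by simp [hσ1, hc.table.reg10]) ?_).imp ?_)
  · intro f hf σ' hσ'
    have hreg : ∀ x, σ'.reg x = if x = 21 then (c : ℝ) else σ.reg x := fun x => by
      rw [hσ', hσ1, Store.setReg_reg]
    interval_cases f
    · refine .reg_of ?_
      rw [hreg, if_neg (by omega), hc.table.reg11]
      exact (prefixMass_update rec R le_rfl).symm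
    all_goals simp only [field, Function.update_self]
    · exact .reg_of (by rw [hreg, if_neg (by omega), hc.reg20, hR]; rfl)
    · exact .reg_of (by rw [hreg, if_neg (by omega), hc.reg17, hR]; rfl)
    · exact .reg_of (by rw [hreg, if_neg (by omega), hc.reg19, hR]; rfl)
    · exact .reg_of (by rw [hreg, if_neg (by omega), hc.reg24, hRw])
    · rw [hRh]
      exact Ev.sub (.reg_of (by rw [hreg, if_pos rfl]))
        (.reg_of (by rw [hreg, if_neg (by omega), hc.reg19]))
    · exact .reg_of (by rw [hreg, if_neg (by omega), h.reg7, hR]; rfl)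
    · exact .reg_of (by rw [hreg, if_neg (by omega), h.reg9, hR]; rfl)
  rintro σ2 ⟨hg2, hm2, hfield⟩
  have hreg2 : ∀ x, x ≠ 21 → σ2.reg x = σ.reg x := fun x hx => by
    rw [hg2, hσ1, Store.setReg_reg, if_neg hx]
  have h21 : σ2.reg 21 = c := by rw [hg2, hσ1]; simp
  refine .seq (.assign hX (v := prefixMass rec M + R.mass) ?_ ?_)
  · refine ((Ev.reg_of ((hreg2 11 (by omega)).trans hc.table.reg11)).add
      (((Ev.reg_of ((hreg2 24 (by omega)).trans hc.reg24)).mul ((Ev.reg_of h21).sub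
        (.reg_of ((hreg2 19 (by omega)).trans hc.reg19)))).mul
        (.reg_of ((hreg2 20 (by omega)).trans hc.reg20)))).congr ?_
    rw [Rec.mass, hRw, hRh]
    rfl
  refine .seq (.assign hX (v := (M + 1 : ℝ)) (Ev.add (.reg_of (by
    rw [Store.setReg_reg, if_neg (by omega), hreg2 10 (by omega), hc.table.reg10])) .one) ?_)
  set σ3 := (σ2.setReg 11 (prefixMass rec M + R.mass)).setReg 10 (M + 1) with hσ3
  have hreg3 : ∀ x, x ≠ 10 → x ≠ 11 → x ≠ 21 → σ3.reg x = σ.reg x := fun x h1 h2 h3 => by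
    simp [hσ3, h1, h2, hreg2 x h3]
  have hm3 : ∀ a, a < P.recA M ∨ P.recA M + 8 ≤ a → σ3.mem a = σ.mem a := hm2
  have hf3 : P.CellFrame σ σ3 := ⟨fun x hx => hreg3 x (by omega) (by omega) (by omega),
    fun a ha => hm3 a (.inl (by simp only [flagA, recA] at *; omega))⟩
  have henv3 := hf3.cutsEnv h
  have hT3 : P.Table (M + 1) (Function.update rec M R) σ3 :=
    hc.table.add (by simp [hσ3]) (by simp [hσ3]) (fun a _ ha => hm3 a ha) hfield
  have hpart := h.cuts.partition_step hj hs (hc.flagsOK hs) hc.part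
  have h21 : σ3.reg 21 = c := by simp [hσ3, h21]
  have hflag : ∀ k < P.q, σ3.mem (P.flagA k) = fl k ∧ fl k ≠ 0 := fun k hk =>
    ⟨(hm3 _ (.inl (by have := P.q_le; simp only [flagA, recA]; omega))).trans (hc.flag k hk).1,
      (hc.flag k hk).2⟩
  have hfin : ∀ σ4 fl', P.CellFrame σ3 σ4 →
      (∀ x, x ≠ 13 → x ≠ 20 → x ≠ 25 → σ4.reg x = σ3.reg x) →
      σ4.reg 20 = ∏ k ∈ Finset.range P.q, fl' k →
      (∀ k < P.q, σ4.mem (P.flagA k) = fl' k ∧ fl' k ≠ 0) →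
      P.Table (M + 1) (Function.update rec M R) σ4 →
      (s + 1 ≤ n → P.FlagsOK j ev (P.cutStart j n ev r) (s + 1) fl') →
      Run P.memSize (.seq (.assign 19 (reg 21)) (.assign 18 (reg 18 + 1))) X σ4 fun σ' =>
        P.CellFrame σ σ' ∧ ∃ rec' fl', P.CellState j n ev (M + 1) rec' fl' r (s + 1) σ' := by
    intro σ4 fl' hf4 hreg4 h20 hfl4 hT4 hOK
    have hreg : ∀ x, x ≠ 10 → x ≠ 11 → x ≠ 13 → x ≠ 20 → x ≠ 21 → x ≠ 25 → σ4.reg x = σ.reg x :=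
      fun x h1 h2 h3 h4 h5 h6 => (hreg4 x h3 h4 h6).trans (hreg3 x h1 h2 h5)
    have h21 : σ4.reg 21 = c := (hreg4 21 (by omega) (by omega) (by omega)).trans h21
    refine .seq (.assign hX (Ev.reg_of h21) (.assign hX (v := ((s + 1 : ℕ) : ℝ))
      (Ev.natAdd (.reg_of (by simp [hreg 18, hc.reg18])) Ev.nat1)
      ⟨(hf3.trans hf4).trans ((CellFrame.setReg (by omega) (by omega)).trans
        (.setReg (by omega) (by omega))), Function.update rec M R, fl', ?_⟩))
    constructor
    · simp [hreg 16, hc.reg16]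
    · simp [hreg 17, hc.reg17]
    · simp
    · simp [hcs]
    · simp [h20]
    · simp [hreg 24, hc.reg24]
    · exact hfl4
    · exact hOK
    · exact hT4.congr (by simp) (by simp) fun a _ => rfl
    · exact hpart
  -- The last cell of a row ends at the end of the grid and not at a breakpoint, so no factor
  -- changes after it.
  refine .seq (.ite hX (P := s < n) (((Ev.reg_of ((hreg3 18 (by omega) (by omega) (by
    omega)).trans hc.reg18)).lt (Ev.reg_of henv3.reg12)).congr (ind_congr Nat.cast_lt))
    (fun hsn => ?_) fun hsn => ?_)
  · refine (run_flagProg hj hX henv3 hsn rfl ((hreg3 17 (by omega) (by omega) (by omega)).trans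
      hc.reg17) ((hreg3 18 (by omega) (by omega) (by omega)).trans hc.reg18)
      ((hreg3 20 (by omega) (by omega) (by omega)).trans hc.reg20) h21 hflag hT3).imp ?_
    rintro σ4 ⟨fl', h1, h2, h3, h4, h5, rfl⟩
    exact hfin σ4 _ h1 h2 h3 h4 h5 fun _ => (hc.flagsOK hs).step rfl
  · exact .skip hX (hfin σ3 fl (.refl _) (fun _ _ _ _ => rfl)
      ((hreg3 20 (by omega) (by omega) (by omega)).trans hc.reg20) hflag hT3 fun h => by omega)

theorem rec_lt_maxRec (hj : j < N) (hn : n ≤ P.maxEv) {M r s : ℕ}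
    (hM : M ≤ j * (P.maxEv + 1) ^ 2) (hr : r ≤ n) (hs : s ≤ n) :
    M + r * (n + 1) + s < P.maxRec := by
  have h1 : r * (n + 1) ≤ P.maxEv * (P.maxEv + 1) := Nat.mul_le_mul (by omega) (by omega)
  have h2 : (j + 1) * (P.maxEv + 1) ^ 2 ≤ N * (P.maxEv + 1) ^ 2 := Nat.mul_le_mul_right _ hj
  unfold maxRec
  nlinarith

theorem run_rowProg {X M : ℕ} {rec : ℕ → Rec} {r : ℕ} {σ : Store} (hj : j < N)
    (hX : P.maxEv + 3 ≤ X) (h : P.CutsEnv j n ev σ) (hr : r ≤ n)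
    (hM : M ≤ j * (P.maxEv + 1) ^ 2) (h16 : σ.reg 16 = r) (h17 : σ.reg 17 = P.cutStart j n ev r)
    (hT : P.Table (M + r * (n + 1)) rec σ)
    (hp : P.Partition (M + r * (n + 1)) rec (P.rowDone j n ev r)) :
    Run P.memSize (rowProg d) X σ fun σ' => P.CellFrame σ σ' ∧ σ'.reg 16 = (r + 1 : ℕ) ∧
      σ'.reg 17 = P.cutStart j n ev (r + 1) ∧ ∃ rec', P.Table (M + (r + 1) * (n + 1)) rec' σ' ∧
      P.Partition (M + (r + 1) * (n + 1)) rec' (P.rowDone j n ev (r + 1)) := by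
  have hn := h.cuts.le_maxEv
  have hq := P.q_le
  have hX0 : 0 < X := by omega
  refine .seq (.assign hX0 (v := (P.cut j n ev r - P.cutStart j n ev r : ℝ))
    (((h.ev_evA (.reg_of h16)).mem_of (by simp only [evA, memSize, recA, maxEv] at *; omega)
      (h.val r hr)).sub (.reg_of h17)) (.seq (.assign hX0 .zero (.seq ?_))))
  refine Run.for_loop (Y := 1) (fun k σ' => P.CellFrame σ σ' ∧ σ'.reg 13 = k ∧
    (∀ x, x ≠ 13 → x ≠ 24 → σ'.reg x = σ.reg x) ∧
    σ'.reg 24 = (P.cut j n ev r - P.cutStart j n ev r : ℝ) ∧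
    (∀ a, P.recA 0 ≤ a → σ'.mem a = σ.mem a) ∧ ∀ k' < k, σ'.mem (P.flagA k') = 1) P.q
    (by simp only [maxEv] at hX; omega) one_pos ?_ ?_ ?_ ?_
  · exact ⟨(CellFrame.setReg (by omega) (by omega)).trans (.setReg (by omega) (by omega)),
      by simp, fun x h1 h2 => by simp [h1, h2], by simp, fun _ _ => rfl,
      fun _ h => absurd h (Nat.not_lt_zero _)⟩
  · rintro k σ' hk ⟨h1, h2, -⟩
    exact ((Ev.reg_of h2).lt (Ev.reg_of (h1.cutsEnv h).reg6)).congr (ind_congr Nat.cast_lt)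
  · rintro k σ' hk ⟨h1, h2, h3, h4, h5, h6⟩
    have henv := h1.cutsEnv h
    refine .seq (.store one_pos (henv.ev_flagA (.reg_of h2))
      (by simp only [flagA, memSize, recA]; omega) .one (.assign one_pos (v := ((k + 1 : ℕ) : ℝ))
      (Ev.natAdd (.reg_of h2) Ev.nat1) ⟨(h1.trans (.setFlag (by omega))).trans
        (.setReg (by omega) (by omega)), by simp, fun x h7 h8 => by simp [h7, h3 x h7 h8],
        by simp [h4], fun a ha => ?_, fun k' hk' => ?_⟩))
    · rw [Store.setReg_mem, Store.setMem_mem, if_neg]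
      · exact h5 a ha
      · simp only [recA, flagA] at *; omega
    · rw [Store.setReg_mem, Store.setMem_mem]
      split_ifs with hkk
      · rfl
      · exact h6 k' (by simp only [flagA] at hkk; omega)
  · rintro σ1 ⟨hf1, -, hreg1, h24, hm1, hflag⟩
    refine .seq (.assign hX0 .one (.seq (.assign hX0 .zero (.seq (.assign hX0 .zero (.seq ?_))))))
    set σ2 := ((σ1.setReg 20 1).setReg 18 0).setReg 19 0 with hσ2
    have hf2 : P.CellFrame σ σ2 := hf1.trans ((CellFrame.setReg (by omega) (by omega)).trans
      ((CellFrame.setReg (by omega) (by omega)).trans (.setReg (by omega) (by omega))))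
    refine Run.for_loop (Y := 1) (fun s σ' => P.CellFrame σ σ' ∧ ∃ rec fl,
      P.CellState j n ev (M + r * (n + 1) + s) rec fl r s σ') (n + 1) (by omega) one_pos ?_ ?_ ?_ ?_
    · refine ⟨hf2, rec, fun _ => 1, ?_⟩
      constructor
      · simp [hσ2, hreg1, h16]
      · simp [hσ2, hreg1, h17]
      · simp [hσ2]
      · simp [hσ2]
      · simp [hσ2]
      · simp [hσ2, h24]
      · exact fun k hk => ⟨hflag k hk, one_ne_zero⟩
      -- At the start of a row no breakpoint has been passed, so the initial factors `1` need not be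
      -- right. The breakpoints `0` correct them before the first nonempty cell.
      · intro _ k _ p hp; omega
      · exact hT.congr (by simp [hσ2, hreg1]) (by simp [hσ2, hreg1]) hm1
      · refine hp.congr fun z => ?_
        simp only [rowDone, cellDone, valid, mem_ofPred_eq, cutStart_zero]
        omega
    · rintro s σ' hs ⟨h1, rec', fl, h2⟩
      exact ((Ev.reg_of h2.reg18).le (Ev.reg_of (h1.cutsEnv h).reg12)).congr
        (ind_congr (by rw [Nat.cast_le]; omega))
    · rintro s σ' hs ⟨h1, rec', fl, h2⟩
      exact (run_cellProg hj one_pos (h1.cutsEnv h) (by omega)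
        (rec_lt_maxRec hj hn hM hr (by omega)) h2).imp fun σ'' ⟨h3, h4⟩ => ⟨h1.trans h3, h4⟩
    · rintro σ3 ⟨h1, rec', fl, h2⟩
      refine .seq (.assign hX0 (v := (P.cutStart j n ev (r + 1) : ℝ)) ((Ev.add
        (.reg_of h2.reg17) (.reg_of h2.reg24)).congr (by rw [cutStart_succ]; ring))
        (.assign hX0 (v := ((r + 1 : ℕ) : ℝ)) (Ev.natAdd (.reg_of (by simp [h2.reg16])) Ev.nat1)
        ⟨h1.trans ((CellFrame.setReg (by omega) (by omega)).trans (.setReg (by omega) (by omega))),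
          by simp, by simp, rec', ?_⟩))
      rw [show M + (r + 1) * (n + 1) = M + r * (n + 1) + (n + 1) by ring]
      refine ⟨h2.table.congr (by simp) (by simp) fun a _ => rfl, h2.part.congr ?_⟩
      rintro ⟨a, b, c⟩
      have := h.cuts.cutStart_le r
      simp only [rowDone, cellDone, mem_ofPred_eq, cutStart_succ, valid, cut, if_neg (lt_irrefl n)]
        at this ⊢
      constructor
      · omega
      -- The last cell of the row ends at `gridCount`, so every valid second index has been covered.
      · rintro ⟨⟨h3, h4, h5⟩, h6⟩
        refine ⟨⟨h3, h4, h5⟩, ?_⟩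
        rcases h6 with h6 | ⟨rfl, h6⟩
        · exact .inl h6
        · exact .inr ⟨rfl, .inr ⟨h6, h5⟩⟩

/-- The candidates on the edges before the `j`-th one. -/
def edgesDone (P : CurveTask d N) (j : ℕ) : Set (ℕ × ℕ × ℕ) := {z | z ∈ P.valid ∧ z.1 < j}

theorem run_cellsProg {X M : ℕ} {rec : ℕ → Rec} {σ : Store} (hj : j < N)
    (hX : (P.maxEv + 3) ^ 2 ≤ X) (h : P.EdgeEnv j σ) (hev : P.EvList n ev σ)
    (hc : P.Cuts j n ev) (hM : M ≤ j * (P.maxEv + 1) ^ 2) (hT : P.Table M rec σ)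
    (hp : P.Partition M rec (P.edgesDone j)) :
    Run P.memSize (cellsProg d) X σ fun σ' => (∀ x < 10, σ'.reg x = σ.reg x) ∧
      (∀ a < P.flagA 0, σ'.mem a = σ.mem a) ∧ ∃ M' rec', M' ≤ (j + 1) * (P.maxEv + 1) ^ 2 ∧
        P.Table M' rec' σ' ∧ P.Partition M' rec' (P.edgesDone (j + 1)) := by
  have hn := hc.le_maxEv
  have hX0 : 0 < X := lt_of_lt_of_le (by positivity) hX
  -- The grid size serves as a sentinel after the list, so that the last row and the last column
  -- need no special treatment; the array has room for it.
  refine .seq (.store hX0 (h.ev_evA (.reg_of hev.reg12))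
    (by simp only [evA, memSize, recA, maxEv] at *; omega) (.reg_of h.reg8) ?_)
  set σ1 := σ.setMem (P.evA n) (P.S.gridCount P.Δ j) with hσ1
  have henv1 : P.CutsEnv j n ev σ1 :=
    { toEdgeEnv := h.congr (fun _ _ _ => rfl) fun a ha => by
        rw [hσ1, Store.setMem_mem, if_neg]; simp only [flagA, evA] at *; omega
      reg12 := hev.reg12
      val := fun p hp => by
        rw [hσ1, Store.setMem_mem, cut]
        by_cases hpn : p < n
        · rw [if_neg (by simp only [evA]; omega), if_pos hpn, hev.val p hpn]
        · rw [if_pos (by simp only [evA]; omega), if_neg hpn]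
      own := fun p hp => by
        rw [hσ1, Store.setMem_mem, if_neg (by simp only [evA]; omega), hev.own p hp]
      cuts := hc }
  refine .seq (.assign hX0 .zero (.seq (.assign hX0 .zero ?_)))
  refine Run.for_loop (Y := P.maxEv + 3) (fun r σ' => P.CellFrame σ1 σ' ∧ σ'.reg 16 = r ∧
    σ'.reg 17 = P.cutStart j n ev r ∧ ∃ rec', P.Table (M + r * (n + 1)) rec' σ' ∧
      P.Partition (M + r * (n + 1)) rec' (P.rowDone j n ev r)) (n + 1) (by nlinarith) (by omega)
      ?_ ?_ ?_ ?_
  · refine ⟨(CellFrame.setReg (by omega) (by omega)).trans (.setReg (by omega) (by omega)),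
      by simp, by simp, rec, ?_, ?_⟩
    · rw [Nat.zero_mul, Nat.add_zero]
      refine hT.congr (by simp [hσ1]) (by simp [hσ1]) fun a ha => ?_
      simp only [Store.setReg_mem, hσ1, Store.setMem_mem]
      rw [if_neg]
      simp only [evA, recA, maxEv] at *; omega
    · rw [Nat.zero_mul, Nat.add_zero]
      refine hp.congr fun z => ?_
      simp only [rowDone, edgesDone, valid, mem_ofPred_eq, cutStart_zero]
      omega
  · rintro r σ' hr ⟨h1, h2, -⟩
    exact ((Ev.reg_of h2).le (Ev.reg_of (h1.cutsEnv henv1).reg12)).congr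
      (ind_congr (by rw [Nat.cast_le]; omega))
  · rintro r σ' hr ⟨h1, h2, h3, rec', h4, h5⟩
    exact (run_rowProg hj le_rfl (h1.cutsEnv henv1) (by omega) hM h2 h3 h4 h5).imp
      fun σ'' ⟨h6, h7⟩ => ⟨h1.trans h6, h7⟩
  · rintro σ' ⟨h1, -, -, rec', h4, h5⟩
    refine ⟨fun x hx => (h1.reg x (.inl hx)).trans rfl, fun a ha => ?_, _, rec', ?_, h4,
      h5.congr ?_⟩
    · rw [h1.mem a (.inl ha), hσ1, Store.setMem_mem, if_neg]
      simp only [flagA, evA] at *; omega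
    · have : (n + 1) * (n + 1) ≤ (P.maxEv + 1) * (P.maxEv + 1) :=
        Nat.mul_le_mul (by omega) (by omega)
      nlinarith
    · rintro ⟨a, b, c⟩
      simp only [rowDone, edgesDone, mem_ofPred_eq, cutStart_succ, valid, cut,
        if_neg (lt_irrefl n)]
      constructor
      · omega
      · rintro ⟨⟨h6, h7, h8⟩, h9⟩
        refine ⟨⟨h6, h7, h8⟩, ?_⟩
        rcases Nat.lt_succ_iff_lt_or_eq.1 h9 with h9 | rfl
        · exact .inl h9
        · exact .inr ⟨rfl, h7⟩

end

end CurveTask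

namespace CurveTask

open Expr

variable {d N : ℕ} (P : CurveTask d N)

/-! ### Building the table of records -/

/-- Computes the edges that contain the update points. -/
def locProg (d : ℕ) : Prog :=
  .seq (.assign 13 0) (.while (lt (reg 13) (reg 6))
    (.seq (.assign 14 0) (.seq
      (.while (lt (reg 14 + 1) (reg 3) * le (parE d (reg 14 + 1)) (ptsE d (reg 13)))
        (.assign 14 (reg 14 + 1)))
      (.seq (.store (locAE d (reg 13)) (reg 14)) (.assign 13 (reg 13 + 1))))))

/-- Treats the edge in register `7`. -/
def edgeProg (d : ℕ) : Prog :=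
  .seq (.assign 9 (stepE d (reg 7)))
    (.seq (search (lenE d (reg 7) / reg 5 + 3) fun a =>
        or (lt ((a - 1) * reg 5) (lenE d (reg 7))) (le a 1))
      (.seq (.assign 8 (reg 30 + 1)) (.seq (allSplitsProg d) (.seq (cellsProg d)
        (.assign 7 (reg 7 + 1))))))

/-- Builds the table of records. -/
def sweepProg (d : ℕ) : Prog :=
  .seq (locProg d) (.seq (.assign 10 0) (.seq (.assign 11 0) (.seq (.assign 7 0)
    (.while (lt (reg 7) (reg 3)) (edgeProg d)))))

/-- The table of records is complete. -/
def Built (σ : Store) : Prop :=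
  ∃ M rec, M ≤ P.maxRec ∧ P.Table M rec σ ∧ P.Partition M rec P.valid

variable {P}

theorem run_locProg {X : ℕ} {σ : Store} (h : P.Env σ) (hX : (P.i + 2) * (N + 1) ≤ X) :
    Run P.memSize (locProg d) X σ fun σ' => (∀ x < 13, σ'.reg x = σ.reg x) ∧
      (∀ a < P.locA 0, σ'.mem a = σ.mem a) ∧ ∀ k < P.q, σ'.mem (P.locA k) = P.loc k := by
  have hq := P.q_le
  have hN := P.S.edges_pos
  refine .seq (.assign (lt_of_lt_of_le (by positivity) hX) .zero ?_)
  refine Run.for_loop (Y := N + 1) (fun k σ' => σ'.reg 13 = k ∧ (∀ x < 13, σ'.reg x = σ.reg x) ∧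
      (∀ a < P.locA 0, σ'.mem a = σ.mem a) ∧ ∀ k' < k, σ'.mem (P.locA k') = P.loc k') P.q
      ((Nat.mul_le_mul_right _ (by omega)).trans hX) (by omega) ?_ ?_ ?_ fun σ' h' => h'.2
  · exact ⟨by simp, fun x hx => by simp [hx.ne], fun _ _ => rfl,
      fun _ h => absurd h (Nat.not_lt_zero _)⟩
  · rintro k σ' hk ⟨h1, h2, -⟩
    exact ((Ev.reg_of h1).lt (.reg_of ((h2 6 (by omega)).trans h.reg6))).congr
      (ind_congr Nat.cast_lt)
  · rintro k σ' hk ⟨h1, h2, h3, h4⟩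
    refine .seq (.assign (by omega) .zero (.seq ?_))
    refine Run.loop (Y := 1) (fun m σ'' => ∃ e : ℕ, e + m + 1 = N ∧ σ''.reg 14 = e ∧
      P.S.par e ≤ P.pts k ∧ (∀ x < 14, σ''.reg x = σ'.reg x) ∧ σ''.mem = σ'.mem) (N - 1)
      (by omega) one_pos ?_ ?_
    · refine ⟨0, by omega, by simp, ?_, fun x hx => by simp [hx.ne], rfl⟩
      rw [P.S.par_zero]
      exact (P.pts_mem k hk).1
    rintro m σ'' ⟨e, he, h5, h6, h7, h8⟩
    have henv : P.Env σ'' := h.congr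
      (fun x _ hx => (h7 x (by omega)).trans (h2 x (by omega))) fun a ha => by rw [h8, h3 a ha]
    have e13 : Ev P.memSize σ'' (reg 13) (k : ℕ) := .reg_of ((h7 13 (by omega)).trans h1)
    have e14 : Ev P.memSize σ'' (reg 14 + 1) ((e + 1 : ℕ) : ℝ) := (Ev.reg_of h5).natAdd Ev.nat1
    refine ⟨e + 1 < N ∧ P.S.par (e + 1) ≤ P.pts k, ((e14.lt henv.ev_N).and
      ((henv.ev_par e14 (by omega)).le (henv.ev_pts e13 hk))).congr
      (ind_congr (by rw [Nat.cast_lt])), fun hc => ?_, fun hc => ?_⟩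
    · exact ⟨m - 1, by omega, .assign one_pos e14 ⟨e + 1, by omega, by simp, hc.2,
        fun x hx => by simp [hx.ne, h7 x hx], h8⟩⟩
    · have hloc : e = P.loc k := PolygonalCurve.IsLoc.unique
        ⟨by omega, h6, by
          by_cases h9 : e + 1 = N
          · exact .inl h9
          · exact .inr (not_le.1 fun h10 => hc ⟨by omega, h10⟩)⟩ (P.isLoc_loc hk)
      refine .seq (.store (by omega) (henv.ev_locA e13) (by simp only [locA, memSize, recA]; omega)
        (Ev.reg_of h5) (.assign (by omega) (v := ((k + 1 : ℕ) : ℝ)) (Ev.natAdd (.reg_of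
          ((h7 13 (by omega)).trans h1)) Ev.nat1) ⟨by simp, fun x hx => ?_, fun a ha => ?_,
          fun k' hk' => ?_⟩))
      · simp [hx.ne, h7 x (by omega), h2 x hx]
      · rw [Store.setReg_mem, Store.setMem_mem, if_neg (by simp only [locA] at *; omega), h8]
        exact h3 a ha
      · rw [Store.setReg_mem, Store.setMem_mem]
        split_ifs with hkk
        · rw [hloc, show k' = k by simp only [locA] at hkk; omega]
        · rw [h8]
          exact h4 k' (by simp only [locA] at hkk; omega)

/-- The number of grid points is a ceiling, found by a search whose range is bounded by the real
number `len / Δ + 3`. The breakpoints dominate the rest: linearly many searches and insertions, then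
quadratically many cells. -/
theorem run_edgeProg {X l j M : ℕ} {rec : ℕ → Rec} {σ : Store} (hj : j < N) (h : P.Env σ)
    (hloc : ∀ k < P.q, σ.mem (P.locA k) = P.loc k) (h7 : σ.reg 7 = j)
    (hl : P.S.maxEdgeLength / P.Δ + 4 ≤ 2 ^ l) (hX : (P.maxEv + 3) * (P.maxEv + l + 3) ≤ X)
    (hM : M ≤ j * (P.maxEv + 1) ^ 2) (hT : P.Table M rec σ)
    (hp : P.Partition M rec (P.edgesDone j)) :
    Run P.memSize (edgeProg d) X σ fun σ' => (∀ x < 7, σ'.reg x = σ.reg x) ∧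
      (∀ a < P.flagA 0, σ'.mem a = σ.mem a) ∧ σ'.reg 7 = (j + 1 : ℕ) ∧
      ∃ M' rec', M' ≤ (j + 1) * (P.maxEv + 1) ^ 2 ∧
        P.Table M' rec' σ' ∧ P.Partition M' rec' (P.edgesDone (j + 1)) := by
  have hΔ := P.Δ_pos
  have hmul : P.maxEv + l + 3 ≤ (P.maxEv + 3) * (P.maxEv + l + 3) :=
    Nat.le_mul_of_pos_left _ (by omega)
  have hX0 : 0 < X := by omega
  refine .seq (.assign hX0 (h.ev_step (.reg_of h7) hj) ?_)
  set σ1 := σ.setReg 9 (P.S.step P.Δ j) with hσ1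
  have hreg : ∀ a b x, x ≠ 9 → x ≠ 30 → x ≠ 31 → (σ1.setSearch a b).reg x = σ.reg x := by
    intro a b x h1 h2 h3
    rw [Store.setSearch_reg _ _ _ h2 h3, hσ1, Store.setReg_reg, if_neg h1]
  have henv : ∀ a b, P.Env (σ1.setSearch a b) := fun a b => h.congr
    (fun x _ hx => hreg a b x (by omega) (by omega) (by omega)) fun _ _ => rfl
  have hlen : ∀ a b, Ev P.memSize (σ1.setSearch a b) (lenE d (reg 7)) (P.S.len j) := fun a b =>
    (henv a b).ev_len (.reg_of ((hreg a b 7 (by omega) (by omega) (by omega)).trans h7)) hj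
  have hv : P.S.len j / P.Δ + 3 ≤ 2 ^ l := by
    have := div_le_div_of_nonneg_right (P.S.len_le hj) hΔ.le
    linarith
  refine .seq (run_search (l := l) (v := P.S.len j / P.Δ + 3)
    (T' := fun n => ((n : ℝ) - 1) * P.Δ < P.S.len j ∨ (n : ℝ) ≤ 1) (by omega) hv
    (fun a b => ((hlen a b).div (.reg_of (henv a b).reg5) hΔ.ne').add (Ev.ofNat 3)) ?_ ?_)
  · intro a b e n _ _ he
    exact (((he.sub .one).mul (.reg_of (henv a b).reg5)).lt (hlen a b)).or (he.le .one)
  intro r b hr1 hr2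
  -- If the search ends at its bound, then `r ≥ len / Δ + 2`, so the test fails at `r + 1` in any
  -- case and the bound cuts nothing off.
  have hcount : P.S.gridCount P.Δ j = r + 1 := by
    refine P.S.gridCount_eq _ hΔ (hr1.imp id fun h => h.2) ?_
    rcases hr2 with hr2 | hr2
    · have h1 : P.S.len j / P.Δ + 2 ≤ r := by linarith
      have h2 : 0 ≤ P.S.len j / P.Δ := div_nonneg (P.S.len_nonneg _) hΔ.le
      have h3 : P.S.len j / P.Δ * P.Δ = P.S.len j := div_mul_cancel₀ _ hΔ.ne'
      push_cast
      rintro (h4 | h4)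
      · nlinarith
      · linarith
    · push_cast at hr2 ⊢
      exact hr2
  refine .seq (.assign hX0 (v := (P.S.gridCount P.Δ j : ℝ))
    ((Ev.natAdd (.reg_of (Store.setSearch_reg30 _ _ _)) Ev.nat1).congr (by rw [hcount])) ?_)
  set σ2 := (σ1.setSearch r b).setReg 8 (P.S.gridCount P.Δ j) with hσ2
  have hreg2 : ∀ x, x ≠ 8 → x ≠ 9 → x ≠ 30 → x ≠ 31 → σ2.reg x = σ.reg x := by
    intro x h1 h2 h3 h4
    rw [hσ2, Store.setReg_reg, if_neg h1, hreg _ _ x h2 h3 h4]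
  have henv2 : P.EdgeEnv j σ2 :=
    { toEnv := h.congr (fun x _ hx => hreg2 x (by omega) (by omega) (by omega) (by omega))
        fun _ _ => rfl
      loc := hloc
      reg7 := (hreg2 7 (by omega) (by omega) (by omega) (by omega)).trans h7
      reg8 := by simp [hσ2]
      reg9 := by
        rw [hσ2, Store.setReg_reg, if_neg (by omega), Store.setSearch_reg _ _ _ (by omega)
          (by omega), hσ1]
        simp }
  have hgl : P.S.gridCount P.Δ j + 1 ≤ 2 ^ l := by
    have : ((P.S.gridCount P.Δ j + 1 : ℕ) : ℝ) ≤ ((2 ^ l : ℕ) : ℝ) := by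
      push_cast
      linarith [P.S.gridCount_le hΔ hj]
    exact_mod_cast this
  have hi : P.i + 2 ≤ P.maxEv + 3 := by simp only [maxEv]; omega
  refine .seq ((run_allSplitsProg hj henv2 hgl ((Nat.mul_le_mul hi (by omega)).trans hX)).imp ?_)
  rintro σ3 ⟨hf3, n, ev, hn, hev, hE, hall⟩
  have henv3 := hf3.edgeEnv henv2
  have hq := P.q_le
  have hcuts : P.Cuts j n ev :=
    { le_maxEv := by simp only [maxEv]; omega
      sorted := hev.sorted
      own_lt := fun p hp => (hE (ev p) ⟨p, hp, rfl⟩).1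
      val_le := fun p hp => (hE (ev p) ⟨p, hp, rfl⟩).2
      splits := hall }
  have hT3 : P.Table M rec σ3 := hT.congr
    ((hf3.reg 10 (by omega)).trans (hreg2 10 (by omega) (by omega) (by omega) (by omega)))
    ((hf3.reg 11 (by omega)).trans (hreg2 11 (by omega) (by omega) (by omega) (by omega)))
    fun a ha => hf3.mem a (.inr ha)
  refine .seq ((run_cellsProg hj (by nlinarith) henv3 hev hcuts hM hT3 hp).imp ?_)
  rintro σ4 ⟨hreg4, hmem4, M', rec', hM', hT', hp'⟩
  refine .assign hX0 (v := ((j + 1 : ℕ) : ℝ)) (Ev.natAdd (.reg_of ((hreg4 7 (by omega)).trans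
    henv3.reg7)) Ev.nat1) ⟨fun x hx => ?_, fun a ha => ?_, by simp, M', rec', hM',
      hT'.congr (by simp) (by simp) fun _ _ => rfl, hp'⟩
  · rw [Store.setReg_reg, if_neg (by omega), hreg4 x (by omega), hf3.reg x (by omega)]
    exact hreg2 x (by omega) (by omega) (by omega) (by omega)
  · rw [Store.setReg_mem, hmem4 a ha]
    exact hf3.mem a (.inl (by simp only [flagA, evA] at *; omega))

theorem run_sweepProg {X l : ℕ} {σ : Store} (h : P.Env σ)
    (hl : P.S.maxEdgeLength / P.Δ + 4 ≤ 2 ^ l)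
    (hX : (N + 1) * ((P.maxEv + 3) * (P.maxEv + l + 3)) ≤ X) :
    Run P.memSize (sweepProg d) X σ fun σ' => (∀ x < 7, σ'.reg x = σ.reg x) ∧
      (∀ a < P.locA 0, σ'.mem a = σ.mem a) ∧ P.Built σ' := by
  have hX0 : 0 < X := lt_of_lt_of_le (by positivity) hX
  refine .seq ((run_locProg h (le_trans ?_ hX)).imp ?_)
  · rw [mul_comm]
    refine Nat.mul_le_mul_left _ ?_
    have : P.i + 2 ≤ P.maxEv + 3 := by simp only [maxEv]; omega
    nlinarith [Nat.zero_le (P.maxEv * (P.maxEv + l + 3))]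
  rintro σ1 ⟨hr1, hm1, hloc⟩
  refine .seq (.assign hX0 .zero (.seq (.assign hX0 .zero (.seq (.assign hX0 .zero ?_)))))
  refine Run.for_loop (Y := (P.maxEv + 3) * (P.maxEv + l + 3)) (fun j σ' =>
    (∀ x < 7, σ'.reg x = σ.reg x) ∧ (∀ a < P.locA 0, σ'.mem a = σ.mem a) ∧ σ'.reg 7 = j ∧
    (∀ k < P.q, σ'.mem (P.locA k) = P.loc k) ∧ ∃ M rec, M ≤ j * (P.maxEv + 1) ^ 2 ∧
      P.Table M rec σ' ∧ P.Partition M rec (P.edgesDone j)) N hX (by positivity) ?_ ?_ ?_ ?_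
  · refine ⟨fun x hx => ?_, hm1, by simp, hloc, 0, fun _ => ⟨0, 0, 0, 0, 0, 0⟩, by simp,
      ⟨by simp, by simp [prefixMass], by simp⟩, ⟨by simp, ?_, by simp⟩⟩
    · simp only [Store.setReg_reg]
      rw [if_neg (by omega), if_neg (by omega), if_neg (by omega)]
      exact hr1 x (by omega)
    · rintro z ⟨-, hz⟩
      omega
  · rintro j σ' hj ⟨h1, -, h2, -⟩
    exact ((Ev.reg_of h2).lt (.reg_of ((h1 3 (by omega)).trans h.reg3))).congr
      (ind_congr Nat.cast_lt)
  · rintro j σ' hj ⟨h1, h2, h3, h4, M, rec, h5, h6, h7⟩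
    refine (run_edgeProg hj (h.congr (fun x _ hx => h1 x hx) h2) h4 h3 hl le_rfl h5 h6 h7).imp ?_
    rintro σ'' ⟨h1', h2', h3', h4'⟩
    refine ⟨fun x hx => (h1' x hx).trans (h1 x hx), fun a ha => (h2' a ?_).trans (h2 a ha), h3',
      fun k hk => (h2' _ ?_).trans (h4 k hk), h4'⟩
    · simp only [locA, flagA] at *; omega
    · have := P.q_le
      simp only [locA, flagA] at *; omega
  · rintro σ' ⟨h1, h2, -, -, M, rec, h5, h6, h7⟩
    exact ⟨h1, h2, M, rec, h5, h6, h7.congr fun z => ⟨fun hz => hz.1, fun hz => ⟨hz, hz.1⟩⟩⟩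

end CurveTask

/-! ### Sampling from the table of records -/

namespace Rec

/-- The start of the interval of the candidate `(x + a, y + b)` of the block, relative to the start
of the interval of the block. -/
noncomputable def offset (R : Rec) (a b : ℕ) : ℝ := a * (R.h * R.wt) + b * R.wt

end Rec

/-- Position `v` is in the interval of the `b`-th candidate of the `a`-th row of the `q`-th
block. -/
structure Hits (M : ℕ) (rec : ℕ → Rec) (v : ℝ) (q a b : ℕ) : Prop where
  block : q < M
  row : a < (rec q).w
  col : b < (rec q).h
  le : prefixMass rec q + (rec q).offset a b ≤ v
  lt : v < prefixMass rec q + (rec q).offset a b + (rec q).wt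

/-- Half-open intervals of length `c` starting at different multiples of `c` are disjoint; that `c`
is positive follows from the first two inequalities. -/
theorem eq_of_mul_le_of_lt {a a' : ℕ} {c x : ℝ} (h₁ : a * c ≤ x) (h₂ : x < a * c + c)
    (h₁' : a' * c ≤ x) (h₂' : x < a' * c + c) : a = a' := by
  have hc : 0 < c := by linarith
  refine le_antisymm ?_ ?_ <;> rw [← Nat.lt_succ_iff, ← Nat.cast_lt (α := ℝ)] <;> push_cast <;>
    nlinarith

theorem prefixMass_succ (rec : ℕ → Rec) (q : ℕ) :
    prefixMass rec (q + 1) = prefixMass rec q + (rec q).mass := Finset.sum_range_succ _ _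

namespace CurveTask

open Expr

variable {d N : ℕ} {P : CurveTask d N}

theorem wt_pos (z : ℕ × ℕ × ℕ) : 0 < P.wt z :=
  Finset.prod_pos fun k _ => by have := ind_nonneg (P.Cov k z); positivity

theorem Partition.cell {M : ℕ} {rec : ℕ → Rec} {D : Set (ℕ × ℕ × ℕ)} (h : P.Partition M rec D)
    {q a b : ℕ} (hq : q < M) (ha : a < (rec q).w) (hb : b < (rec q).h) :
    ((rec q).j, (rec q).x + a, (rec q).y + b) ∈ D ∧
      (rec q).wt = P.wt ((rec q).j, (rec q).x + a, (rec q).y + b) :=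
  h.sub q hq _ ⟨rfl, ⟨by simp, by simpa using ha⟩, by simp, by simpa using hb⟩

theorem Partition.wt_pos {M : ℕ} {rec : ℕ → Rec} {D : Set (ℕ × ℕ × ℕ)} (h : P.Partition M rec D)
    {q : ℕ} (hq : q < M) (hw : 0 < (rec q).w) (hh : 0 < (rec q).h) : 0 < (rec q).wt := by
  rw [(h.cell hq hw hh).2]
  exact CurveTask.wt_pos _

theorem Partition.mass_nonneg {M : ℕ} {rec : ℕ → Rec} {D : Set (ℕ × ℕ × ℕ)}
    (h : P.Partition M rec D) {q : ℕ} (hq : q < M) : 0 ≤ (rec q).mass := by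
  unfold Rec.mass
  rcases Nat.eq_zero_or_pos (rec q).w with hw | hw
  · simp [hw]
  rcases Nat.eq_zero_or_pos (rec q).h with hh | hh
  · simp [hh]
  have := h.wt_pos hq hw hh
  positivity

theorem Partition.prefixMass_mono {M : ℕ} {rec : ℕ → Rec} {D : Set (ℕ × ℕ × ℕ)}
    (h : P.Partition M rec D) {q q' : ℕ} (hqq : q ≤ q') (hq : q' ≤ M) :
    prefixMass rec q ≤ prefixMass rec q' := by
  induction q', hqq using Nat.le_induction with
  | base => exact le_rfl
  | succ q' _ ih =>
    rw [prefixMass_succ]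
    linarith [ih (by omega), h.mass_nonneg (q := q') (by omega)]

theorem Partition.offset_le {M : ℕ} {rec : ℕ → Rec} {D : Set (ℕ × ℕ × ℕ)}
    (h : P.Partition M rec D) {q a b : ℕ} (hq : q < M) (ha : a < (rec q).w) (hb : b < (rec q).h) :
    0 ≤ (rec q).offset a b ∧ (rec q).offset a b + (rec q).wt ≤ (rec q).mass := by
  have hw := h.wt_pos hq (by omega) (by omega)
  have ha' : (a : ℝ) + 1 ≤ (rec q).w := by exact_mod_cast ha
  have hb' : (b : ℝ) + 1 ≤ (rec q).h := by exact_mod_cast hb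
  unfold Rec.offset Rec.mass
  refine ⟨by positivity, ?_⟩
  have h1 : ((a : ℝ) * (rec q).h + b + 1) ≤ (rec q).w * (rec q).h := by
    have : (0 : ℝ) ≤ (rec q).h := Nat.cast_nonneg _
    nlinarith
  nlinarith

/-- The intervals of different blocks are separated by the prefix masses, those of different rows by
multiples of `h * wt`, and those within a row by multiples of `wt`. -/
theorem Hits.unique {M : ℕ} {rec : ℕ → Rec} {D : Set (ℕ × ℕ × ℕ)} {v : ℝ} {q a b q' a' b' : ℕ}
    (hp : P.Partition M rec D) (h : Hits M rec v q a b) (h' : Hits M rec v q' a' b') :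
    q = q' ∧ a = a' ∧ b = b' := by
  obtain ⟨h1, h2, h3, h4, h5⟩ := h
  obtain ⟨h1', h2', h3', h4', h5'⟩ := h'
  have ho := hp.offset_le h1 h2 h3
  have ho' := hp.offset_le h1' h2' h3'
  have hs := prefixMass_succ rec q
  have hs' := prefixMass_succ rec q'
  obtain rfl : q = q' := by
    by_contra hne
    rcases Nat.lt_or_gt_of_ne hne with hlt | hlt
    · linarith [hp.prefixMass_mono hlt h1'.le]
    · linarith [hp.prefixMass_mono hlt h1.le]
  have hw := hp.wt_pos h1 (by omega) (by omega)
  have hb : (b : ℝ) + 1 ≤ (rec q).h := by exact_mod_cast h3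
  have hb' : (b' : ℝ) + 1 ≤ (rec q).h := by exact_mod_cast h3'
  unfold Rec.offset at *
  have hbw := mul_le_mul_of_nonneg_right hb hw.le
  have hbw' := mul_le_mul_of_nonneg_right hb' hw.le
  have hbn : 0 ≤ b * (rec q).wt := by positivity
  have hbn' : 0 ≤ b' * (rec q).wt := by positivity
  obtain rfl : a = a' := eq_of_mul_le_of_lt (c := (rec q).h * (rec q).wt)
    (x := v - prefixMass rec q) (by linarith) (by linarith) (by linarith) (by linarith)
  refine ⟨rfl, rfl, eq_of_mul_le_of_lt (c := (rec q).wt)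
    (x := v - prefixMass rec q - a * ((rec q).h * (rec q).wt)) ?_ ?_ ?_ ?_⟩ <;> linarith

/-- The position that is selected by the random number `u`. -/
noncomputable def position (W u : ℝ) : ℝ := open Classical in if u * W < W then u * W else 0

/-- The program that turns the random number in register `40` into a candidate. -/
def selectProg (d : ℕ) : Prog :=
  .seq (.assign 41 (ife (lt (reg 40 * reg 11) (reg 11)) (reg 40 * reg 11) 0))
    (.seq (search (reg 10) fun a => le (mem (recAE d a + ofNat 0)) (reg 41))
    (.seq (.assign 42 (reg 30))
    (.seq (.assign 43 (reg 41 - mem (recAE d (reg 42) + ofNat 0)))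
    (.seq (search (mem (recAE d (reg 42) + ofNat 4)) fun a =>
      le (a * (mem (recAE d (reg 42) + ofNat 5) * mem (recAE d (reg 42) + ofNat 1))) (reg 43))
    (.seq (.assign 44 (reg 30))
    (.seq (.assign 43 (reg 43 -
      reg 44 * (mem (recAE d (reg 42) + ofNat 5) * mem (recAE d (reg 42) + ofNat 1))))
    (.seq (search (mem (recAE d (reg 42) + ofNat 5)) fun b =>
      le (b * mem (recAE d (reg 42) + ofNat 1)) (reg 43))
    (.seq (.assign 0 (mem (recAE d (reg 42) + ofNat 6)))
    (.seq (.assign 1 (min 1 ((mem (recAE d (reg 42) + ofNat 2) + reg 44) *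
      mem (recAE d (reg 42) + ofNat 7))))
    (.assign 2 (min 1 ((mem (recAE d (reg 42) + ofNat 3) + reg 30) *
      mem (recAE d (reg 42) + ofNat 7)))))))))))))

/-- The program for the first query. -/
def sampleProg (d : ℕ) : Prog := .seq (.rand 40) (selectProg d)

/-- The store outputs the candidate with an edge and two grid indices `z`. -/
def Outputs (P : CurveTask d N) (z : ℕ × ℕ × ℕ) (σ : Store) : Prop :=
  σ.reg 0 = z.1 ∧ σ.reg 1 = P.S.gridVal P.Δ z.1 z.2.1 ∧ σ.reg 2 = P.S.gridVal P.Δ z.1 z.2.2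

theorem Env.ev_field {σ : Store} {M n f : ℕ} {rec : ℕ → Rec} {e : Expr} (h : P.Env σ)
    (hT : P.Table M rec σ) (hM : M ≤ P.maxRec) (hn : n < M) (hf : f < 8)
    (he : Ev P.memSize σ e n) :
    Ev P.memSize σ (mem (recAE d e + ofNat f)) (P.field rec n f) :=
  ((h.ev_recA he).natAdd (.nat f)).mem_of
    (by have := P.maxRec_le_memSize n (by omega); omega) (hT.field n hn f hf)

/-- Three searches find the block, the row and the column; each one subtracts what precedes the
interval that is found. -/
theorem run_selectProg {X l M : ℕ} {rec : ℕ → Rec} {σ : Store} {u : ℝ} (h : P.Env σ)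
    (hM : M ≤ P.maxRec) (hT : P.Table M rec σ) (hp : P.Partition M rec P.valid)
    (hW : 0 < prefixMass rec M) (hu : 0 ≤ u) (h40 : σ.reg 40 = u)
    (hl : P.maxRec ≤ 2 ^ l) (hg : ∀ j < N, P.S.gridCount P.Δ j ≤ 2 ^ l) (hX : l + 2 ≤ X) :
    Run P.memSize (selectProg d) X σ fun σ' =>
      (∀ x, 3 ≤ x → x < 12 → σ'.reg x = σ.reg x) ∧ σ'.mem = σ.mem ∧ ∃ q a b,
        Hits M rec (position (prefixMass rec M) u) q a b ∧
        P.Outputs ((rec q).j, (rec q).x + a, (rec q).y + b) σ' := by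
  have hX0 : 0 < X := by omega
  set v := position (prefixMass rec M) u with hv
  have hv0 : 0 ≤ v := by
    rw [hv, position]
    split_ifs
    · positivity
    · exact le_rfl
  have hvW : v < prefixMass rec M := by
    rw [hv, position]
    split_ifs with h1
    · exact h1
    · exact hW
  have hframe : ∀ σ' : Store, (∀ x, 3 ≤ x → x < 12 → σ'.reg x = σ.reg x) → σ'.mem = σ.mem →
      P.Env σ' ∧ P.Table M rec σ' := fun σ' h1 h2 =>
    ⟨h.congr (fun x h3 h4 => h1 x h3 (by omega)) fun a _ => by rw [h2],
      hT.congr (h1 10 (by omega) (by omega)) (h1 11 (by omega) (by omega)) fun a _ => by rw [h2]⟩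
  refine .seq (.assign hX0 (v := v) (((Ev.mul (.reg_of h40) (.reg_of hT.reg11)).lt
    (.reg_of hT.reg11)).ife (Ev.mul (.reg_of h40) (.reg_of hT.reg11)) .zero) ?_)
  set σ1 := σ.setReg 41 v with hσ1
  have hr1 : ∀ a b x, x ≠ 30 → x ≠ 31 → x ≠ 41 → (σ1.setSearch a b).reg x = σ.reg x := by
    intro a b x h1 h2 h3
    rw [Store.setSearch_reg _ _ _ h1 h2, hσ1, Store.setReg_reg, if_neg h3]
  have hf1 := fun a b => hframe (σ1.setSearch a b)
    (fun x _ h2 => hr1 a b x (by omega) (by omega) (by omega)) rfl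
  have hM0 : 0 < M := by
    rcases Nat.eq_zero_or_pos M with rfl | hM0
    · simp [prefixMass] at hW
    · exact hM0
  refine .seq (run_search (l := l) (v := (M : ℝ)) (T' := fun n => prefixMass rec n ≤ v) (by omega)
    (by exact_mod_cast hM.trans hl) (fun a b => .reg_of (hf1 a b).2.reg10)
    (fun a b e n _ hn he => ((hf1 a b).1.ev_field (hf1 a b).2 hM (by exact_mod_cast hn)
      (by omega) he).le (.reg_of ?_)) ?_)
  · rw [Store.setSearch_reg _ _ _ (by omega) (by omega), hσ1]
    simp
  intro q b₁ hq1 hq2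
  have hqM : q < M := by
    rcases hq1 with rfl | hq1
    · exact hM0
    · exact_mod_cast hq1.1
  have hqv : prefixMass rec q ≤ v := by
    rcases hq1 with rfl | hq1
    · simpa [prefixMass] using hv0
    · exact hq1.2
  have hqv' : v < prefixMass rec (q + 1) := by
    rcases hq2 with hq2 | hq2
    · rwa [show q + 1 = M by
        have : M ≤ q + 1 := by exact_mod_cast hq2
        omega]
    · exact not_le.1 hq2
  clear hq1 hq2
  set R := rec q with hR
  have hmass : v - prefixMass rec q < R.mass := by
    rw [prefixMass_succ] at hqv'
    linarith
  -- The position lies strictly below the end of the block, so the block has positive mass and is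
  -- not one of the empty blocks in the table.
  have hrem : 0 ≤ v - prefixMass rec q := sub_nonneg.2 hqv
  have hw : 0 < R.w := by
    by_contra hcon
    rw [Rec.mass, show R.w = 0 by omega] at hmass
    norm_num at hmass
    linarith
  have hh : 0 < R.h := by
    by_contra hcon
    rw [Rec.mass, show R.h = 0 by omega] at hmass
    norm_num at hmass
    linarith
  have hwt : 0 < R.wt := hp.wt_pos hqM hw hh
  -- Validity of the last candidate of the block bounds its width and height by the grid size, hence
  -- by the range of the searches.
  have hlast := (hp.cell hqM (a := R.w - 1) (b := R.h - 1) (by rw [← hR]; omega)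
    (by rw [← hR]; omega)).1
  simp only [valid, mem_ofPred_eq, ← hR] at hlast
  obtain ⟨hjN, hxw, hyh⟩ := hlast
  have hg := hg _ hjN
  refine .seq (.assign hX0 (v := (q : ℝ)) (.reg_of (Store.setSearch_reg30 _ _ _)) ?_)
  set σ2 := (σ1.setSearch q b₁).setReg 42 q with hσ2
  have hr2 : ∀ x, x ≠ 30 → x ≠ 31 → x ≠ 41 → x ≠ 42 → σ2.reg x = σ.reg x := by
    intro x h1 h2 h3 h4
    rw [hσ2, Store.setReg_reg, if_neg h4, hr1 _ _ x h1 h2 h3]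
  have hf2 := hframe σ2
    (fun x _ h2 => hr2 x (by omega) (by omega) (by omega) (by omega)) rfl
  refine .seq (.assign hX0 (v := v - prefixMass rec q) (Ev.sub (.reg_of ?_)
    (hf2.1.ev_field hf2.2 hM hqM (by omega) (.reg_of (by simp [hσ2])))) ?_)
  · rw [hσ2, Store.setReg_reg, if_neg (by omega), Store.setSearch_reg _ _ _ (by omega) (by omega),
      hσ1]
    simp
  set σ3 := σ2.setReg 43 (v - prefixMass rec q) with hσ3
  have hr3 : ∀ a b x, x ≠ 30 → x ≠ 31 → x ≠ 41 → x ≠ 42 → x ≠ 43 →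
      (σ3.setSearch a b).reg x = σ.reg x := by
    intro a b x h1 h2 h3 h4 h5
    rw [Store.setSearch_reg _ _ _ h1 h2, hσ3, Store.setReg_reg, if_neg h5, hr2 x h1 h2 h3 h4]
  have hf3 := fun a b => hframe (σ3.setSearch a b)
    (fun x _ h2 => hr3 a b x (by omega) (by omega) (by omega) (by omega) (by omega)) rfl
  have h42 : ∀ a b, Ev P.memSize (σ3.setSearch a b) (reg 42) (q : ℕ) := fun a b => .reg_of (by
    rw [Store.setSearch_reg _ _ _ (by omega) (by omega), hσ3, hσ2]; simp)
  have hfield := fun a b f (hf : f < 8) =>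
    (hf3 a b).1.ev_field (hf3 a b).2 hM hqM hf (h42 a b)
  refine .seq (run_search (l := l) (v := (R.w : ℝ))
    (T' := fun n => n * (R.h * R.wt) ≤ v - prefixMass rec q) (by omega)
    (by exact_mod_cast (show R.w ≤ 2 ^ l by omega)) (fun a b => hfield a b 4 (by omega))
    (fun a b e n _ hn he => (he.mul ((hfield a b 5 (by omega)).mul (hfield a b 1 (by omega)))).le
      (.reg_of ?_)) ?_)
  · rw [Store.setSearch_reg _ _ _ (by omega) (by omega), hσ3]
    simp
  intro a b₂ ha1 ha2
  have haw : a < R.w := by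
    rcases ha1 with rfl | ha1
    · exact hw
    · exact_mod_cast ha1.1
  have hav : a * (R.h * R.wt) ≤ v - prefixMass rec q := by
    rcases ha1 with rfl | ha1
    · simpa using hrem
    · exact ha1.2
  have hav' : v - prefixMass rec q < (a + 1) * (R.h * R.wt) := by
    rcases ha2 with ha2 | ha2
    · refine hmass.trans_le ?_
      rw [Rec.mass, mul_assoc]
      exact mul_le_mul_of_nonneg_right ha2 (by positivity)
    · push_cast at ha2
      exact not_le.1 ha2
  clear ha1 ha2
  refine .seq (.assign hX0 (v := (a : ℝ)) (.reg_of (Store.setSearch_reg30 _ _ _)) ?_)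
  set σ4 := (σ3.setSearch a b₂).setReg 44 a with hσ4
  have hr4 : ∀ x, x ≠ 30 → x ≠ 31 → x ≠ 41 → x ≠ 42 → x ≠ 43 → x ≠ 44 → σ4.reg x = σ.reg x := by
    intro x h1 h2 h3 h4 h5 h6
    rw [hσ4, Store.setReg_reg, if_neg h6, hr3 _ _ x h1 h2 h3 h4 h5]
  have hf4 := hframe σ4
    (fun x _ h2 => hr4 x (by omega) (by omega) (by omega) (by omega) (by omega) (by omega)) rfl
  have h42' : Ev P.memSize σ4 (reg 42) (q : ℕ) := .reg_of (by
    rw [hσ4, Store.setReg_reg, if_neg (by omega)]; exact (h42 _ _).2)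
  have hfield4 := fun f (hf : f < 8) => hf4.1.ev_field hf4.2 hM hqM hf h42'
  refine .seq (.assign hX0 (v := v - prefixMass rec q - a * (R.h * R.wt)) (Ev.sub (.reg_of ?_)
    (Ev.mul (.reg_of (by simp [hσ4])) ((hfield4 5 (by omega)).mul (hfield4 1 (by omega))))) ?_)
  · rw [hσ4, Store.setReg_reg, if_neg (by omega), Store.setSearch_reg _ _ _ (by omega) (by omega),
      hσ3]
    simp
  set σ5 := σ4.setReg 43 (v - prefixMass rec q - a * (R.h * R.wt)) with hσ5
  have hr5 : ∀ a b x, x ≠ 30 → x ≠ 31 → x ≠ 41 → x ≠ 42 → x ≠ 43 → x ≠ 44 →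
      (σ5.setSearch a b).reg x = σ.reg x := by
    intro a b x h1 h2 h3 h4 h5 h6
    rw [Store.setSearch_reg _ _ _ h1 h2, hσ5, Store.setReg_reg, if_neg h5, hr4 x h1 h2 h3 h4 h5 h6]
  have hf5 := fun a b => hframe (σ5.setSearch a b) (fun x _ h2 =>
    hr5 a b x (by omega) (by omega) (by omega) (by omega) (by omega) (by omega)) rfl
  have h42 : ∀ a b, Ev P.memSize (σ5.setSearch a b) (reg 42) (q : ℕ) := fun a b => .reg_of (by
    rw [Store.setSearch_reg _ _ _ (by omega) (by omega), hσ5, Store.setReg_reg, if_neg (by omega)]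
    exact h42'.2)
  have hfield := fun a b f (hf : f < 8) =>
    (hf5 a b).1.ev_field (hf5 a b).2 hM hqM hf (h42 a b)
  refine .seq (run_search (l := l) (v := (R.h : ℝ))
    (T' := fun n => n * R.wt ≤ v - prefixMass rec q - a * (R.h * R.wt)) (by omega)
    (by exact_mod_cast (show R.h ≤ 2 ^ l by omega)) (fun a b => hfield a b 5 (by omega))
    (fun a b e n _ hn he => (he.mul (hfield a b 1 (by omega))).le (.reg_of ?_)) ?_)
  · rw [Store.setSearch_reg _ _ _ (by omega) (by omega), hσ5]
    simp
  intro b b₃ hb1 hb2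
  have hbh : b < R.h := by
    rcases hb1 with rfl | hb1
    · exact hh
    · exact_mod_cast hb1.1
  have hbv : b * R.wt ≤ v - prefixMass rec q - a * (R.h * R.wt) := by
    rcases hb1 with rfl | hb1
    · simpa using hav
    · exact hb1.2
  have hbv' : v - prefixMass rec q - a * (R.h * R.wt) < (b + 1) * R.wt := by
    rcases hb2 with hb2 | hb2
    · have := mul_le_mul_of_nonneg_right hb2 hwt.le
      linarith
    · push_cast at hb2
      exact not_le.1 hb2
  clear hb1 hb2
  have hhit : Hits M rec v q a b := by
    refine ⟨hqM, haw, hbh, ?_, ?_⟩ <;> rw [← hR, Rec.offset] <;> linarith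
  have h44 : ∀ c e, (σ5.setSearch c e).reg 44 = a := fun c e => by
    rw [Store.setSearch_reg _ _ _ (by omega) (by omega), hσ5, Store.setReg_reg, if_neg (by omega),
      hσ4]
    simp
  refine .seq (.assign hX0 (hfield _ _ 6 (by omega)) ?_)
  set σ6 := (σ5.setSearch b b₃).setReg 0 (P.field rec q 6) with hσ6
  have hr6 : ∀ x, x ≠ 0 → σ6.reg x = (σ5.setSearch b b₃).reg x := fun x hx => by simp [hσ6, hx]
  have hf6 := hframe σ6 (fun x h1 h2 => (hr6 x (by omega)).trans
    (hr5 _ _ x (by omega) (by omega) (by omega) (by omega) (by omega) (by omega))) rfl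
  have hfield6 := fun f (hf : f < 8) => hf6.1.ev_field hf6.2 hM hqM hf
    (.reg_of ((hr6 42 (by omega)).trans (h42 b b₃).2))
  refine .seq (.assign hX0 (v := P.S.gridVal P.Δ R.j (R.x + a)) ?_ ?_)
  · refine (Ev.one.min (((hfield6 2 (by omega)).add (.reg_of ((hr6 44 (by omega)).trans
      (h44 b b₃)))).mul (hfield6 7 (by omega)))).congr ?_
    rw [PolygonalCurve.gridVal]
    push_cast
    rfl
  set σ7 := σ6.setReg 1 (P.S.gridVal P.Δ R.j (R.x + a)) with hσ7
  have hr7 : ∀ x, x ≠ 0 → x ≠ 1 → σ7.reg x = (σ5.setSearch b b₃).reg x := fun x hx hx' => by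
    simp [hσ7, hx', hr6 x hx]
  have hf7 := hframe σ7 (fun x h1 h2 => (hr7 x (by omega) (by omega)).trans
    (hr5 _ _ x (by omega) (by omega) (by omega) (by omega) (by omega) (by omega))) rfl
  have hfield7 := fun f (hf : f < 8) => hf7.1.ev_field hf7.2 hM hqM hf
    (.reg_of ((hr7 42 (by omega) (by omega)).trans (h42 b b₃).2))
  refine .assign hX0 (v := P.S.gridVal P.Δ R.j (R.y + b)) ?_ ⟨fun x h1 h2 => ?_, rfl, q, a, b, hhit,
    ?_, ?_, ?_⟩
  · refine (Ev.one.min (((hfield7 3 (by omega)).add (.reg_of ((hr7 30 (by omega) (by omega)).trans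
      (Store.setSearch_reg30 _ _ _)))).mul (hfield7 7 (by omega)))).congr ?_
    rw [PolygonalCurve.gridVal]
    push_cast
    rfl
  · rw [Store.setReg_reg, if_neg (by omega), hr7 x (by omega) (by omega)]
    exact hr5 _ _ x (by omega) (by omega) (by omega) (by omega) (by omega) (by omega)
  · rw [Store.setReg_reg, if_neg (by omega), hσ7, Store.setReg_reg, if_neg (by omega), hσ6]
    simp only [Store.setReg_reg, if_true]
    rfl
  · rw [Store.setReg_reg, if_neg (by omega), hσ7]
    simp [hR]
  · simp [hR]

end CurveTask

namespace CurveTask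

open Expr

variable {d N : ℕ} (P : CurveTask d N)

/-! ### Construction and decision -/

/-- The structure has been built. -/
def Ready (σ : Store) : Prop := P.Env σ ∧ P.Built σ

/-- The program for the construction. -/
def buildProg (d : ℕ) : Prog :=
  .seq (.assign 3 (reg 0 - 1)) (.seq (.assign 4 (reg 1)) (.seq (.assign 5 (reg 2))
    (.seq (.assign 6 (reg 1)) (sweepProg d))))

/-- The program for the second query. -/
def decideProg (d : ℕ) : Prog :=
  .seq (.store (inputE d + (reg 3 + 1) + reg 4) (reg 0)) (.seq (.assign 6 (reg 4 + 1))
    (.seq (sweepProg d) (.seq (.assign 2 (reg 11)) (.seq (.assign 6 (reg 4))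
      (.seq (sweepProg d) (.assign 0 (le (reg 1 * (reg 2 - reg 11)) (reg 11))))))))

/-- The task for the curve and the update points of the input. -/
noncomputable def ofInput (S : PolygonalCurve d N) {i : ℕ} (ts : Fin i → ℝ) (Δ : ℝ)
    (hts : ∀ k, ts k ∈ Icc (0 : ℝ) 1) (hΔ : 0 < Δ) : CurveTask d N where
  S := S
  Δ := Δ
  Δ_pos := hΔ
  i := i
  q := i
  q_le := Nat.le_succ i
  pts k := if h : k < i then ts ⟨k, h⟩ else 0
  pts_mem k hk := by rw [dif_pos hk]; exact hts _

/-- The task with a further update point. -/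
def addPoint (h : P.q = P.i) (t : ℝ) (ht : t ∈ Icc (0 : ℝ) 1) : CurveTask d N where
  S := P.S
  Δ := P.Δ
  Δ_pos := P.Δ_pos
  i := P.i
  q := P.i + 1
  q_le := le_rfl
  pts := Function.update P.pts P.i t
  pts_mem k hk := by
    rcases Nat.lt_succ_iff_lt_or_eq.1 hk with hk | rfl
    · rw [Function.update_of_ne hk.ne]
      exact P.pts_mem k (by omega)
    · rwa [Function.update_self]

/-- The triples of an edge and two grid indices. -/
noncomputable def validFinset : Finset (ℕ × ℕ × ℕ) := (Finset.range N).biUnion fun j =>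
  {j} ×ˢ Finset.range (P.S.gridCount P.Δ j) ×ˢ Finset.range (P.S.gridCount P.Δ j)

/-- The total weight of all candidates. -/
noncomputable def total : ℝ := ∑ z ∈ P.validFinset, P.wt z

variable {P}

theorem mem_validFinset {z : ℕ × ℕ × ℕ} : z ∈ P.validFinset ↔ z ∈ P.valid := by
  simp only [validFinset, Finset.mem_biUnion, Finset.mem_product, Finset.mem_range,
    Finset.mem_singleton, valid, mem_ofPred_eq]
  constructor
  · rintro ⟨j, hj, rfl, h⟩
    exact ⟨hj, h⟩
  · rintro ⟨hj, h⟩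
    exact ⟨_, hj, rfl, h⟩

theorem total_pos : 0 < P.total := by
  refine Finset.sum_pos (fun z _ => wt_pos z) ⟨(0, 0, 0), mem_validFinset.2 ⟨P.S.edges_pos, ?_, ?_⟩⟩
  all_goals exact Nat.succ_pos _

/-- The blocks partition the valid triples and the weight is constant on each of them, so the sum
over triples can be taken block by block. -/
theorem Partition.prefixMass_eq {M : ℕ} {rec : ℕ → Rec} (h : P.Partition M rec P.valid) :
    prefixMass rec M = P.total := by
  classical
  let C : ℕ → Finset (ℕ × ℕ × ℕ) := fun q => {(rec q).j} ×ˢ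
    Finset.Ico (rec q).x ((rec q).x + (rec q).w) ×ˢ Finset.Ico (rec q).y ((rec q).y + (rec q).h)
  have hC : ∀ q z, z ∈ C q ↔ z ∈ (rec q).cells := by
    intro q z
    simp only [C, Finset.mem_product, Finset.mem_singleton, Finset.mem_Ico, Rec.cells,
      mem_ofPred_eq]
  have hU : P.validFinset = (Finset.range M).biUnion C := by
    ext z
    simp only [mem_validFinset, Finset.mem_biUnion, Finset.mem_range, hC]
    exact ⟨h.cover z, fun ⟨q, hq, hz⟩ => (h.sub q hq z hz).1⟩
  rw [total, hU, Finset.sum_biUnion]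
  · refine Finset.sum_congr rfl fun q hq => ?_
    rw [Finset.sum_congr rfl fun z hz =>
      (h.sub q (Finset.mem_range.1 hq) z ((hC q z).1 hz)).2.symm]
    simp [C, Rec.mass, mul_assoc]
  · intro q hq q' hq' hne
    refine Finset.disjoint_left.2 fun z hz hz' => hne ?_
    exact h.disj q (by simpa using hq) q' (by simpa using hq') z ((hC q z).1 hz) ((hC q' z).1 hz')

/-- The new point multiplies each weight by `1 + ind`, so the increase of the total is the total
weight of its feasible set. -/
theorem total_addPoint (h : P.q = P.i) (t : ℝ) (ht : t ∈ Icc (0 : ℝ) 1) :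
    (P.addPoint h t ht).total = P.total + ∑ z ∈ P.validFinset, ind (P.S.Covers P.Δ t z.1
      (P.S.gridVal P.Δ z.1 z.2.1) (P.S.gridVal P.Δ z.1 z.2.2)) * P.wt z := by
  rw [total, total, ← Finset.sum_add_distrib]
  refine Finset.sum_congr rfl fun z _ => ?_
  have : (P.addPoint h t ht).wt z = P.wt z * (1 + ind (P.S.Covers P.Δ t z.1
      (P.S.gridVal P.Δ z.1 z.2.1) (P.S.gridVal P.Δ z.1 z.2.2))) := by
    change ∏ k ∈ Finset.range (P.i + 1), (1 + ind ((P.addPoint h t ht).Cov k z)) = _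
    rw [Finset.prod_range_succ, wt, h]
    congr 1
    · refine Finset.prod_congr rfl fun k hk => ?_
      simp only [Cov, addPoint, Function.update_of_ne (Finset.mem_range.1 hk).ne]
    · simp only [Cov, addPoint, Function.update_self]
  rw [this]
  ring

theorem run_buildProg {X l i : ℕ} {S : PolygonalCurve d N} {ts : Fin i → ℝ} {Δ : ℝ}
    (hts : ∀ k, ts k ∈ Icc (0 : ℝ) 1) (hΔ : 0 < Δ) {σ : Store} (h : IsInput S ts Δ σ)
    (hP : P = ofInput S ts Δ hts hΔ) (hl : S.maxEdgeLength / Δ + 4 ≤ 2 ^ l)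
    (hX : (N + 1) * ((P.maxEv + 3) * (P.maxEv + l + 3)) ≤ X) :
    Run P.memSize (buildProg d) X σ P.Ready := by
  have hX0 : 0 < X := lt_of_lt_of_le (by positivity) hX
  refine .seq (.assign hX0 (v := (N : ℝ)) (((Ev.reg_of h.size).sub .one).congr (by ring))
    (.seq (.assign hX0 (v := (i : ℝ)) (.reg_of (by simp [h.updates])) (.seq (.assign hX0 (v := Δ)
      (.reg_of (by simp [h.delta])) (.seq (.assign hX0 (v := (i : ℝ))
        (.reg_of (by simp [h.updates])) ?_)))))))
  subst hP
  set P := ofInput S ts Δ hts hΔ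
  set σ1 := (((σ.setReg 3 N).setReg 4 i).setReg 5 Δ).setReg 6 i with hσ1
  have henv : P.Env σ1 :=
    { reg3 := by simp [hσ1]
      reg4 := by simp [hσ1]; rfl
      reg5 := by simp [hσ1]; rfl
      reg6 := by simp [hσ1]; rfl
      vert := fun v hv c => by
        refine (h.vertex ⟨v, by omega⟩ c).trans ?_
        rw [← S.vert_eq]
        rfl
      par := fun v hv => by
        refine (h.param ⟨v, by omega⟩).trans ?_
        rw [← S.par_eq]
        rfl
      pts := fun k hk => by
        refine (h.update ⟨k, hk⟩).trans ?_
        simp only [P, ofInput]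
        rw [dif_pos (show k < i from hk)] }
  exact (run_sweepProg henv hl hX).imp fun σ' ⟨h1, h2, h3⟩ =>
    ⟨henv.congr (fun x _ hx => h1 x hx) h2, h3⟩

/-- With the totals `W'` and `W` with and without `t`, the probability is `(W' - W) / W`, so the
test is `r * (W' - W) ≤ W`. The sweep without `t` comes second: it computes `W` and at the same time
restores the table. The first total survives in register `2`, which sweeps do not touch. -/
theorem run_decideProg {X l : ℕ} (hq : P.q = P.i) {σ : Store} (h : P.Ready σ)
    (hl : P.S.maxEdgeLength / P.Δ + 4 ≤ 2 ^ l)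
    (hX : (N + 1) * ((P.maxEv + 3) * (P.maxEv + l + 3)) ≤ X) {t r : ℝ}
    (ht : t ∈ Icc (0 : ℝ) 1) :
    Run P.memSize (decideProg d) X ((σ.setReg 0 t).setReg 1 r) fun σ' => P.Ready σ' ∧
      σ'.reg 0 = ind (r * ∑ z ∈ P.validFinset, ind (P.S.Covers P.Δ t z.1
        (P.S.gridVal P.Δ z.1 z.2.1) (P.S.gridVal P.Δ z.1 z.2.2)) * P.wt z ≤ P.total) := by
  have hX0 : 0 < X := lt_of_lt_of_le (by positivity) hX
  set σ0 := (σ.setReg 0 t).setReg 1 r with hσ0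
  have henv0 : P.Env σ0 := h.1.congr (fun x h1 h2 => by
    simp [hσ0, show x ≠ 0 by omega, show x ≠ 1 by omega]) fun _ _ => rfl
  refine .seq (.store hX0 (henv0.ev_ptsA (.reg_of henv0.reg4)) (by
    simp only [ptsA, memSize, recA]; omega) (.reg_of (x := t) (by simp [hσ0]))
    (.seq (.assign hX0 (v := ((P.i + 1 : ℕ) : ℝ)) (Ev.natAdd (.reg_of henv0.reg4) Ev.nat1)
      (.seq ?_))))
  set σ1 := (σ0.setMem (P.ptsA P.i) t).setReg 6 ((P.i + 1 : ℕ) : ℝ) with hσ1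
  set P' := P.addPoint hq t ht with hP'
  have hne : ∀ a, a ≠ P.ptsA P.i → σ1.mem a = σ0.mem a := fun a ha => by
    rw [hσ1, Store.setReg_mem, Store.setMem_mem, if_neg ha]
  have henv1 : P'.Env σ1 :=
    { reg3 := by simp [hσ1, henv0.reg3]
      reg4 := by simp [hσ1, henv0.reg4]; rfl
      reg5 := by simp [hσ1, henv0.reg5]; rfl
      reg6 := by simp [hσ1]; simp [hP', addPoint]
      vert := fun v hv c => (hne _ (by have := vert_lt hv c; simp only [ptsA]; omega)).trans
        (henv0.vert v hv c)
      par := fun v hv => (hne _ (by simp only [parA, ptsA]; omega)).trans (henv0.par v hv)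
      pts := fun k hk => by
        change σ1.mem (P.ptsA k) = Function.update P.pts P.i t k
        rcases Nat.lt_succ_iff_lt_or_eq.1 hk with hk | rfl
        · rw [Function.update_of_ne hk.ne, hne _ (by simp only [ptsA]; omega)]
          exact henv0.pts k (by omega)
        · rw [Function.update_self]
          simp [hσ1] }
  refine (run_sweepProg henv1 hl hX).imp ?_
  rintro σ2 ⟨hr2, hm2, M', rec', -, hT', hp'⟩
  -- The layout depends on `i` and not on the number `q` of points in use, so both tasks have the
  -- same addresses.
  have hm2 : ∀ a < P.locA 0, σ2.mem a = σ1.mem a := hm2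
  have htot' : prefixMass rec' M' = P'.total := hp'.prefixMass_eq
  have hr20 : ∀ x < 6, σ2.reg x = σ0.reg x := fun x hx => by
    rw [hr2 x (by omega), hσ1, Store.setReg_reg, if_neg (by omega)]
    rfl
  refine .seq (.assign hX0 (.reg_of hT'.reg11) (.seq (.assign hX0 (v := (P.i : ℝ))
    (.reg_of (by simp [hr20 4, henv0.reg4])) (.seq ?_))))
  set σ3 := (σ2.setReg 2 (prefixMass rec' M')).setReg 6 P.i with hσ3
  have hr3 : ∀ x, x < 6 → x ≠ 2 → σ3.reg x = σ0.reg x := fun x hx hx' => by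
    simp [hσ3, hx', show x ≠ 6 by omega, hr20 x hx]
  have hm3 : ∀ a < P.locA 0, a ≠ P.ptsA P.i → σ3.mem a = σ0.mem a := fun a ha ha' =>
    (hm2 a ha).trans (hne a ha')
  have henv3 : P.Env σ3 :=
    { reg3 := (hr3 3 (by omega) (by omega)).trans henv0.reg3
      reg4 := (hr3 4 (by omega) (by omega)).trans henv0.reg4
      reg5 := (hr3 5 (by omega) (by omega)).trans henv0.reg5
      reg6 := by simp [hσ3, hq]
      vert := fun v hv c => (hm3 _ (by have := vert_lt hv c; simp only [locA]; omega)
        (by have := vert_lt hv c; simp only [ptsA]; omega)).trans (henv0.vert v hv c)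
      par := fun v hv => (hm3 _ (by simp only [parA, locA]; omega)
        (by simp only [parA, ptsA]; omega)).trans (henv0.par v hv)
      pts := fun k hk => (hm3 _ (by simp only [ptsA, locA]; omega)
        (by simp only [ptsA]; omega)).trans (henv0.pts k hk) }
  refine (run_sweepProg henv3 hl hX).imp ?_
  rintro σ4 ⟨hr4, hm4, M, rec, hM, hT, hp⟩
  have htot : prefixMass rec M = P.total := hp.prefixMass_eq
  refine .assign hX0 (Ev.le (Ev.mul (.reg_of (x := r) ?_) (Ev.sub (.reg_of (x := P'.total) ?_)
    (.reg_of (hT.reg11.trans htot)))) (.reg_of (hT.reg11.trans htot))) ⟨⟨henv3.congr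
      (fun x h1 h2 => ?_) hm4, M, rec, hM, hT.congr (by simp) (by simp) fun _ _ => rfl, hp⟩, ?_⟩
  · rw [hr4 1 (by omega), hr3 1 (by omega) (by omega)]
    simp [hσ0]
  · rw [hr4 2 (by omega), ← htot']
    simp [hσ3]
  · rw [Store.setReg_reg, if_neg (by omega), hr4 x h2]
  · rw [hP', total_addPoint]
    simp

end CurveTask

namespace CurveTask

variable {d N : ℕ} {P : CurveTask d N}

/-! ### The distribution of the samples -/

/-- The candidate with an edge and two grid indices `z`. -/
noncomputable def toCandidate (P : CurveTask d N) (z : ℕ × ℕ × ℕ) : Candidate N :=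
  (P.S.gridVal P.Δ z.1 z.2.1, P.S.gridVal P.Δ z.1 z.2.2,
    if h : z.1 < N then ⟨z.1, h⟩ else ⟨0, P.S.edges_pos⟩)

theorem toCandidate_edge {z : ℕ × ℕ × ℕ} (hz : z.1 < N) : (P.toCandidate z).2.2 = ⟨z.1, hz⟩ := by
  simp only [toCandidate]
  rw [dif_pos hz]

/-- Distinct grid indices give distinct parameters, so counting triples does not count a candidate
twice. -/
theorem toCandidate_injOn : InjOn P.toCandidate P.valid := by
  rintro ⟨j, a, b⟩ ⟨hj, ha, hb⟩ ⟨j', a', b'⟩ ⟨hj', ha', hb'⟩ h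
  simp only [toCandidate, Prod.mk.injEq] at *
  obtain ⟨h1, h2, h3⟩ := h
  rw [dif_pos hj, dif_pos hj', Fin.mk.injEq] at h3
  subst h3
  exact ⟨rfl, P.S.gridVal_inj j P.Δ_pos ha ha' h1, P.S.gridVal_inj j P.Δ_pos hb hb' h2⟩

theorem approxCandidates_eq : P.S.approxCandidates P.Δ = P.toCandidate '' P.valid := by
  ext ⟨x, y, k⟩
  simp only [PolygonalCurve.approxCandidates, mem_ofPred_eq, P.S.grid_eq P.Δ_pos, mem_image]
  constructor
  · rintro ⟨⟨a, ha, rfl⟩, b, hb, rfl⟩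
    exact ⟨(k, a, b), ⟨k.2, ha, hb⟩, by simp [toCandidate]⟩
  · rintro ⟨⟨j, a, b⟩, ⟨hj, ha, hb⟩, h⟩
    simp only [toCandidate, Prod.mk.injEq] at *
    obtain ⟨rfl, rfl, h3⟩ := h
    rw [dif_pos hj] at h3
    subst h3
    exact ⟨⟨a, ha, rfl⟩, b, hb, rfl⟩

theorem mem_feasibleSet_iff {z : ℕ × ℕ × ℕ} (hz : z ∈ P.valid) (t : ℝ) :
    P.toCandidate z ∈ P.S.feasibleSet P.Δ t ↔ P.S.Covers P.Δ t z.1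
      (P.S.gridVal P.Δ z.1 z.2.1) (P.S.gridVal P.Δ z.1 z.2.2) := by
  have hmem : P.toCandidate z ∈ P.S.approxCandidates P.Δ := by
    rw [approxCandidates_eq]
    exact mem_image_of_mem _ hz
  have h : P.toCandidate z = (P.S.gridVal P.Δ z.1 z.2.1, P.S.gridVal P.Δ z.1 z.2.2, ⟨z.1, hz.1⟩) :=
    Prod.ext rfl (Prod.ext rfl (toCandidate_edge hz.1))
  rw [h] at hmem ⊢
  exact P.S.mem_feasibleSet_iff P.Δ_pos ⟨z.1, hz.1⟩ (P.S.gridVal_mem _ P.Δ_pos _)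
    (P.S.gridVal_mem _ P.Δ_pos _) hmem

theorem finsum_candidates (A : Set (Candidate N)) (f : Candidate N → ℝ) :
    ∑ᶠ z ∈ A ∩ P.S.approxCandidates P.Δ, f z =
      ∑ z ∈ P.validFinset, ind (P.toCandidate z ∈ A) * f (P.toCandidate z) := by
  classical
  have h : A ∩ P.S.approxCandidates P.Δ =
      P.toCandidate '' (P.validFinset.filter fun z => P.toCandidate z ∈ A : Finset _) := by
    rw [approxCandidates_eq]
    ext c
    simp only [mem_inter_iff, mem_image, Finset.mem_coe, Finset.mem_filter, mem_validFinset]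
    constructor
    · rintro ⟨hc, z, hz, rfl⟩
      exact ⟨z, ⟨hz, hc⟩, rfl⟩
    · rintro ⟨z, ⟨hz, hc⟩, rfl⟩
      exact ⟨hc, z, hz, rfl⟩
  rw [h, finsum_mem_image, finsum_mem_coe_finset, Finset.sum_filter]
  · refine Finset.sum_congr rfl fun z _ => ?_
    split_ifs with hz
    · rw [ind_true hz, one_mul]
    · rw [ind_false hz, zero_mul]
  · refine toCandidate_injOn.mono fun z hz => ?_
    simp only [Finset.mem_coe, Finset.mem_filter, mem_validFinset] at hz
    exact hz.1

/-! ### Weights and probabilities as sums over grid indices -/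

section

variable {i : ℕ} (S : PolygonalCurve d N) (ts : Fin i → ℝ) (Δ : ℝ)
  (hts : ∀ k, ts k ∈ Icc (0 : ℝ) 1) (hΔ : 0 < Δ)

theorem weight_toCandidate {z : ℕ × ℕ × ℕ} (hz : z ∈ (ofInput S ts Δ hts hΔ).valid) :
    S.weight Δ ts ((ofInput S ts Δ hts hΔ).toCandidate z) = (ofInput S ts Δ hts hΔ).wt z := by
  classical
  set P := ofInput S ts Δ hts hΔ with hP
  have h1 : P.wt z = ∏ k : Fin i, (1 + ind (P.toCandidate z ∈ S.feasibleSet Δ (ts k))) := by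
    change ∏ k ∈ Finset.range i, (1 + ind (P.Cov k z)) = _
    rw [Finset.prod_range]
    refine Finset.prod_congr rfl fun k _ => ?_
    have hiff : P.toCandidate z ∈ S.feasibleSet Δ (ts k) ↔ _ := mem_feasibleSet_iff hz (ts k)
    rw [ind_congr hiff, Cov]
    congr 2
    simp [P, ofInput]
  have h2 : ∀ k, (1 + ind (P.toCandidate z ∈ S.feasibleSet Δ (ts k))) =
      if P.toCandidate z ∈ S.feasibleSet Δ (ts k) then (2 : ℝ) else 1 := by
    intro k
    split_ifs with h
    · rw [ind_true h]; norm_num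
    · rw [ind_false h]; norm_num
  rw [h1, Finset.prod_congr rfl fun k _ => h2 k, Finset.prod_ite, Finset.prod_const,
    Finset.prod_const_one, mul_one, PolygonalCurve.weight, Nat.card_eq_fintype_card,
    Fintype.card_subtype]

theorem prob_eq (A : Set (Candidate N)) : S.prob Δ ts A =
    (∑ z ∈ (ofInput S ts Δ hts hΔ).validFinset,
      ind ((ofInput S ts Δ hts hΔ).toCandidate z ∈ A) * (ofInput S ts Δ hts hΔ).wt z) /
      (ofInput S ts Δ hts hΔ).total := by
  have key : ∀ A : Set (Candidate N), ∑ᶠ z ∈ A ∩ S.approxCandidates Δ, S.weight Δ ts z =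
      ∑ z ∈ (ofInput S ts Δ hts hΔ).validFinset,
        ind ((ofInput S ts Δ hts hΔ).toCandidate z ∈ A) * (ofInput S ts Δ hts hΔ).wt z := by
    intro A
    refine (finsum_candidates (P := ofInput S ts Δ hts hΔ) A (S.weight Δ ts)).trans ?_
    refine Finset.sum_congr rfl fun z hz => ?_
    rw [weight_toCandidate S ts Δ hts hΔ (mem_validFinset.1 hz)]
  have h := key univ
  rw [univ_inter] at h
  rw [PolygonalCurve.prob, key A, h, total]
  congr 1
  exact Finset.sum_congr rfl fun z _ => by rw [ind_true (mem_univ _), one_mul]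

end

/-- Up to the point `u = 1`, `position W` is multiplication by `W`, so the preimage of an interval
of length `w` in `[0, W]` is an interval of length `w / W`. -/
theorem volume_position {W s w : ℝ} (hW : 0 < W) (hs : 0 ≤ s) (hsw : s + w ≤ W) :
    volume {u : unitInterval | s ≤ position W u ∧ position W u < s + w} =
      ENNReal.ofReal (w / W) := by
  have hvol : volume (Ico (s / W) ((s + w) / W)) = ENNReal.ofReal (w / W) := by
    rw [Real.volume_Ico]
    congr 1
    ring
  have hlt : ∀ u : ℝ, u < 1 → position W u = u * W := fun u hu => by
    rw [position, if_pos]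
    nlinarith
  rw [Measure.Subtype.volume_def, comap_subtype_coe_apply measurableSet_Icc]
  refine le_antisymm ?_ ?_
  -- At `u = 1` the position is redirected to `0`; adding this single point does not change the
  -- measure.
  · calc _ ≤ volume (Ico (s / W) ((s + w) / W) ∪ {1}) := measure_mono ?_
      _ ≤ volume (Ico (s / W) ((s + w) / W)) + volume {(1 : ℝ)} := measure_union_le _ _
      _ = _ := by rw [hvol, Real.volume_singleton, add_zero]
    rintro _ ⟨u, ⟨h1, h2⟩, rfl⟩
    rcases u.2.2.lt_or_eq with hu | hu
    · rw [hlt _ hu] at h1 h2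
      exact .inl ⟨(div_le_iff₀ hW).2 h1, (lt_div_iff₀ hW).2 h2⟩
    · exact .inr hu
  · rw [← hvol]
    refine measure_mono fun u ⟨h1, h2⟩ => ?_
    rw [div_le_iff₀ hW] at h1
    rw [lt_div_iff₀ hW] at h2
    have hu0 : 0 ≤ u := nonneg_of_mul_nonneg_left (hs.trans h1) hW
    have hu1 : u < 1 := by nlinarith
    exact ⟨⟨u, hu0, hu1.le⟩, ⟨by simpa only [hlt u hu1] using h1, by simpa only [hlt u hu1] using h2⟩,
      rfl⟩

theorem measurable_position (W : ℝ) : Measurable (position W) := by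
  unfold position
  exact Measurable.ite (measurableSet_lt (by fun_prop) measurable_const) (by fun_prop)
    measurable_const

/-- By determinism the event is the preimage of `A` under the first coordinate of the tape, which is
uniformly distributed. -/
theorem outputProb_eq {B : ℕ} {p : Prog} {σ : Store} {post : Store → Prop} {A : Set unitInterval}
    (hA : MeasurableSet A)
    (h : ∀ ω : Tape, ∃ T σ' ω', Exec B p σ ω T σ' ω' ∧ (post σ' ↔ ω 0 ∈ A)) :
    outputProb B p σ post = volume A := by
  have hset : {ω : Tape | ∃ T σ' ω', Exec B p σ ω T σ' ω' ∧ post σ'} =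
      Function.eval 0 ⁻¹' A := by
    ext ω
    obtain ⟨T, σ', ω', h1, h2⟩ := h ω
    simp only [mem_ofPred_eq, mem_preimage, Function.eval]
    rw [← h2]
    constructor
    · rintro ⟨T₂, σ₂, ω₂, h3, h4⟩
      rwa [(h1.deterministic h3).1]
    · exact fun h => ⟨T, σ', ω', h1, h⟩
  rw [outputProb, hset, tapeMeasure]
  exact (measurePreserving_eval_infinitePi _ 0).measure_preimage hA.nullMeasurableSet

theorem outputsCandidate_iff {z : ℕ × ℕ × ℕ} (hz : z.1 < N) {σ : Store} :
    OutputsCandidate (P.toCandidate z) σ ↔ P.Outputs z σ := by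
  unfold OutputsCandidate
  rw [toCandidate_edge hz]
  rfl

theorem Outputs.unique {z z' : ℕ × ℕ × ℕ} {σ : Store} (hz : z ∈ P.valid) (hz' : z' ∈ P.valid)
    (h : P.Outputs z σ) (h' : P.Outputs z' σ) : z = z' := by
  obtain ⟨j, a, b⟩ := z
  obtain ⟨j', a', b'⟩ := z'
  obtain ⟨h1, h2, h3⟩ := h
  obtain ⟨h1', h2', h3'⟩ := h'
  obtain rfl : j = j' := by exact_mod_cast h1.symm.trans h1'
  rw [Prod.mk.injEq, Prod.mk.injEq]
  exact ⟨rfl, P.S.gridVal_inj _ P.Δ_pos hz.2.1 hz'.2.1 (h2.symm.trans h2'),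
    P.S.gridVal_inj _ P.Δ_pos hz.2.2 hz'.2.2 (h3.symm.trans h3')⟩

theorem exec_sampleProg {X l M : ℕ} {rec : ℕ → Rec} {σ : Store} (h : P.Env σ)
    (hM : M ≤ P.maxRec) (hT : P.Table M rec σ) (hp : P.Partition M rec P.valid)
    (hl : P.maxRec ≤ 2 ^ l) (hg : ∀ j < N, P.S.gridCount P.Δ j ≤ 2 ^ l) (hX : l + 2 ≤ X)
    (ω : Tape) :
    ∃ T σ' ω', Exec P.memSize (sampleProg d) σ ω T σ' ω' ∧ T ≤ (sampleProg d).size * X ∧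
      P.Ready σ' ∧ ∃ q a b, Hits M rec (position P.total (ω 0)) q a b ∧
        P.Outputs ((rec q).j, (rec q).x + a, (rec q).y + b) σ' := by
  have hreg : ∀ x < 12, (σ.setReg 40 (ω 0)).reg x = σ.reg x := fun x hx => by
    rw [Store.setReg_reg, if_neg (by omega)]
  have hW := hp.prefixMass_eq
  obtain ⟨T, σ', h1, h2, h3, h4, h5⟩ := run_selectProg (σ := σ.setReg 40 (ω 0)) (u := ω 0)
    (h.congr (fun x _ hx => hreg x (by omega)) fun _ _ => rfl) hM
    (hT.congr (hreg 10 (by omega)) (hreg 11 (by omega)) fun _ _ => rfl) hp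
    (hW ▸ total_pos) (ω 0).2.1 (by simp) hl hg hX fun k => ω (k + 1)
  rw [hW] at h5
  have hr : ∀ x, 3 ≤ x → x < 12 → σ'.reg x = σ.reg x := fun x hx hx' =>
    (h3 x hx hx').trans (hreg x hx')
  have hm : σ'.mem = σ.mem := h4
  refine ⟨1 + T, σ', _, .seq _ _ _ _ _ _ _ _ _ _ (.rand 40 σ ω) h1, ?_,
    ⟨h.congr (fun x hx hx' => hr x hx (by omega)) fun _ _ => by rw [hm], M, rec, hM,
      hT.congr (hr 10 (by omega) (by omega)) (hr 11 (by omega) (by omega)) fun _ _ => by rw [hm],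
      hp⟩, h5⟩
  simp only [sampleProg, Prog.size]
  nlinarith

/-- A candidate lies in exactly one block, and by `Hits.unique` it is output exactly when the
position is in its own interval, of length `wt z`. -/
theorem outputProb_sampleProg {l : ℕ} {σ : Store} (h : P.Ready σ)
    (hl : P.maxRec ≤ 2 ^ l) (hg : ∀ j < N, P.S.gridCount P.Δ j ≤ 2 ^ l) {z : ℕ × ℕ × ℕ}
    (hz : z ∈ P.valid) :
    outputProb P.memSize (sampleProg d) σ (OutputsCandidate (P.toCandidate z)) =
      ENNReal.ofReal (P.wt z / P.total) := by
  obtain ⟨henv, M, rec, hM, hT, hp⟩ := h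
  obtain ⟨q₀, hq₀, hz₀⟩ := hp.cover z hz
  obtain ⟨a₀, b₀, ha₀, hb₀, hzeq⟩ : ∃ a b, a < (rec q₀).w ∧ b < (rec q₀).h ∧
      z = ((rec q₀).j, (rec q₀).x + a, (rec q₀).y + b) := by
    obtain ⟨j, x, y⟩ := z
    obtain ⟨rfl, ⟨h1, h2⟩, h3, h4⟩ := hz₀
    simp only at h1 h2 h3 h4
    refine ⟨x - (rec q₀).x, y - (rec q₀).y, by omega, by omega, ?_⟩
    rw [Prod.mk.injEq, Prod.mk.injEq]
    exact ⟨rfl, by omega, by omega⟩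
  have hwt : (rec q₀).wt = P.wt z := (hp.sub q₀ hq₀ z hz₀).2
  have hoff := hp.offset_le hq₀ ha₀ hb₀
  have hmono := hp.prefixMass_mono (q := q₀ + 1) hq₀ le_rfl
  have hnonneg := hp.prefixMass_mono (Nat.zero_le q₀) hq₀.le
  rw [show prefixMass rec 0 = 0 from Finset.sum_range_zero _] at hnonneg
  rw [prefixMass_succ, hp.prefixMass_eq] at hmono
  rw [← volume_position (s := prefixMass rec q₀ + (rec q₀).offset a₀ b₀) total_pos
    (by linarith) (by linarith)]
  refine outputProb_eq ?_ fun ω => ?_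
  · have hm : Measurable fun u : unitInterval => position P.total u :=
      (measurable_position P.total).comp measurable_subtype_coe
    exact (measurableSet_le measurable_const hm).inter (measurableSet_lt hm measurable_const)
  · obtain ⟨T, σ', ω', h1, -, -, q, a, b, h2, h3⟩ :=
      exec_sampleProg henv hM hT hp hl hg le_rfl ω
    refine ⟨T, σ', ω', h1, ?_⟩
    rw [outputsCandidate_iff hz.1]
    constructor
    · intro h4
      have hcell := hp.cell h2.block h2.row h2.col
      have heq := Outputs.unique hz hcell.1 h4 h3
      obtain rfl : q₀ = q := hp.disj q₀ hq₀ q h2.block z hz₀ (by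
        rw [heq]
        exact ⟨rfl, ⟨by simp, by simpa using h2.row⟩, by simp, by simpa using h2.col⟩)
      rw [hzeq, Prod.mk.injEq, Prod.mk.injEq] at heq
      obtain rfl : a₀ = a := by omega
      obtain rfl : b₀ = b := by omega
      exact ⟨h2.le, by rw [← hwt]; exact h2.lt⟩
    · rintro ⟨h4, h5⟩
      obtain ⟨rfl, rfl, rfl⟩ := Hits.unique hp h2 ⟨hq₀, ha₀, hb₀, h4, by rw [hwt]; exact h5⟩
      rwa [hzeq]

end CurveTask

/-! ### Bounds -/

/-- The exponent is the rounded binary logarithm; the factor `2` comes from `log 2 ≥ 1 / 2`. -/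
theorem exists_le_two_pow {x : ℝ} (hx : 1 ≤ x) :
    ∃ l : ℕ, x ≤ 2 ^ l ∧ (l : ℝ) ≤ 2 * Real.log x + 1 := by
  have h2 : (0 : ℝ) < Real.log 2 := Real.log_pos one_lt_two
  have hlog : 0 ≤ Real.log x := Real.log_nonneg hx
  refine ⟨⌈Real.log x / Real.log 2⌉₊, ?_, ?_⟩
  · rw [← Real.log_le_log_iff (by linarith) (by positivity), Real.log_pow, ← div_le_iff₀ h2]
    exact Nat.le_ceil _
  · have h3 := Nat.ceil_lt_add_one (div_nonneg hlog h2.le)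
    have h4 : Real.log x / Real.log 2 ≤ 2 * Real.log x := by
      rw [div_le_iff₀ h2]
      nlinarith [Real.log_two_gt_d9]
    linarith

theorem cast_le_of_le_mul {T s X : ℕ} {c K : ℝ} (h : T ≤ s * X) (hX : (X : ℝ) ≤ c)
    (hK : s * c ≤ K) : (T : ℝ) ≤ K :=
  calc (T : ℝ) ≤ ((s * X : ℕ) : ℝ) := by exact_mod_cast h
    _ = s * X := by push_cast; rfl
    _ ≤ s * c := by gcongr
    _ ≤ K := hK

theorem RealRAM.Run.haltsWithin {B X : ℕ} {p : Prog} {σ : Store} {Q : Store → Prop} {c K : ℝ}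
    (h : Run B p X σ Q) (hX : (X : ℝ) ≤ c) (hK : p.size * c ≤ K) (ω : Tape) :
    HaltsWithin B p σ ω K Q := by
  obtain ⟨T, σ', h1, h2, h3⟩ := h ω
  exact ⟨T, σ', ω, h1, cast_le_of_le_mul h2 hX hK, h3⟩

namespace CurveTask

variable {d N : ℕ} (P : CurveTask d N)

/-- `37 (i + 1) + 3 ≤ 37 · 2I + 3I`, which is where `77` comes from; `5929` below is its square. -/
theorem maxEv_add_le {I : ℕ} (h1 : 1 ≤ I) (hi : P.i ≤ I) : P.maxEv + 3 ≤ 77 * I := by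
  simp only [maxEv]
  omega

theorem maxRec_le {I : ℕ} (h1 : 1 ≤ I) (hi : P.i ≤ I) : P.maxRec ≤ 5929 * ((N + 1) * I ^ 2) := by
  have h : (P.maxEv + 1) ^ 2 ≤ (77 * I) ^ 2 :=
    Nat.pow_le_pow_left (by have := P.maxEv_add_le h1 hi; omega) 2
  calc P.maxRec ≤ (N + 1) * (77 * I) ^ 2 := Nat.mul_le_mul (Nat.le_succ N) h
    _ = 5929 * ((N + 1) * I ^ 2) := by ring

theorem memSize_le {I : ℕ} (h1 : 1 ≤ I) (hi : P.i ≤ I) :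
    P.memSize ≤ (d + 50000) * ((N + 1) * I ^ 2) := by
  have h := P.maxRec_le h1 hi
  have h2 : I ≤ (N + 1) * I ^ 2 := by nlinarith [Nat.zero_le (N * I ^ 2)]
  have h3 : N + 1 ≤ (N + 1) * I ^ 2 := Nat.le_mul_of_pos_right _ (by positivity)
  have h4 : (N + 1) * d ≤ d * ((N + 1) * I ^ 2) := by
    rw [mul_comm]
    exact Nat.mul_le_mul_left _ h3
  simp only [memSize, recA]
  rw [Nat.add_mul d]
  omega

end CurveTask

/-! ### The main theorem -/

open CurveTask in
theorem mainTheorem8 (d : ℕ) :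
    -- programs for building the structure and for the two queries; they and `K` depend only on `d`
    ∃ (build sample decide : RealRAM.Prog) (K : ℝ), 0 < K ∧
      ∀ (N : ℕ) (S : PolygonalCurve d N) (i : ℕ) (ts : Fin i → ℝ) (Δ : ℝ) (σ₀ : RealRAM.Store),
        (∀ k, ts k ∈ Set.Icc (0 : ℝ) 1) → 0 < Δ → IsInput S ts Δ σ₀ →
        ∀ m L : ℝ, m = (N + 1) * (max i 1 : ℕ) ^ 2 → L = Real.log (2 + S.maxEdgeLength / Δ) →
        -- `B` cells of memory are used; `V` is the set of the states of the built structure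
        ∃ (B : ℕ) (V : Set RealRAM.Store), (B : ℝ) ≤ K * m ∧
          -- construction
          (∀ ω : RealRAM.Tape, RealRAM.HaltsWithin B build σ₀ ω (K * (m * L)) (· ∈ V)) ∧
          -- (1) sampling; any state is left ready for further queries
          (∀ σ ∈ V,
            (∀ ω : RealRAM.Tape, RealRAM.HaltsWithin B sample σ ω (K * (Real.log m + L))
              fun σ' => σ' ∈ V ∧ ∃ z ∈ S.approxCandidates Δ, OutputsCandidate z σ') ∧
            ∀ z ∈ S.approxCandidates Δ,
              RealRAM.outputProb B sample σ (OutputsCandidate z) =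
                ENNReal.ofReal (S.prob Δ ts {z})) ∧
          -- (2) deciding, for the query point `t` in register `0` and `r` in register `1`
          (∀ σ ∈ V, ∀ t ∈ Set.Icc (0 : ℝ) 1, ∀ r : ℝ, 0 < r → ∀ ω : RealRAM.Tape,
            RealRAM.HaltsWithin B decide ((σ.setReg 0 t).setReg 1 r) ω (K * (m * L))
              fun σ' => σ' ∈ V ∧ OutputsTruth (S.prob Δ ts (S.feasibleSet Δ t) ≤ 1 / r) σ') := by
  obtain ⟨s, hs⟩ : ∃ s : ℕ, s = (buildProg d).size + (sampleProg d).size + (decideProg d).size :=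
    ⟨_, rfl⟩
  -- The first part of the constant is for the memory. The second is for the running times, with `s`
  -- bounding the sizes of all three programs and `12628 = 77 · 164`.
  refine ⟨buildProg d, sampleProg d, decideProg d, (d + 50000) + 12628 * s, by positivity, ?_⟩
  intro N S i ts Δ σ₀ hts hΔ hinput m L hm hL
  set P := ofInput S ts Δ hts hΔ with hP
  set K : ℝ := (d + 50000) + 12628 * s with hK
  set I := max i 1 with hI
  have hI1 : 1 ≤ I := le_max_right _ _
  have hiI : P.i ≤ I := le_max_left _ _
  have hmI : m = (((N + 1) * I ^ 2 : ℕ) : ℝ) := by rw [hm]; push_cast; rfl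
  have hN := S.edges_pos
  have hm1 : 1 ≤ m := by
    rw [hmI]
    exact_mod_cast Nat.mul_pos (Nat.succ_pos N) (by positivity)
  have hlog0 : 0 ≤ Real.log m := Real.log_nonneg hm1
  have hx0 : 0 ≤ S.maxEdgeLength / Δ :=
    div_nonneg ((S.len_nonneg 0).trans (S.len_le hN)) hΔ.le
  set x := S.maxEdgeLength / Δ with hx
  have hlog2 : Real.log 2 ≤ L := by
    rw [hL]
    exact Real.log_le_log two_pos (by linarith)
  have hL1 : 1 ≤ 2 * L := by linarith [Real.log_two_gt_d9]
  -- the bound for the construction and for the decision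
  obtain ⟨l, hl, hlL⟩ := exists_le_two_pow (x := x + 4) (by linarith)
  -- `x + 4 ≤ 2 (2 + x)` gives `log (x + 4) ≤ log 2 + L ≤ 2 L`, and the remaining `1` is at most `2
  -- L`.
  have hlL' : (l : ℝ) ≤ 6 * L := by
    have : Real.log (x + 4) ≤ Real.log (2 * (2 + x)) := Real.log_le_log (by linarith) (by linarith)
    rw [Real.log_mul two_ne_zero (by linarith), ← hL] at this
    linarith
  set X := (N + 1) * ((P.maxEv + 3) * (P.maxEv + l + 3)) with hXdef
  have hX : (X : ℝ) ≤ 12628 * (m * L) := by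
    have h1 : X ≤ (N + 1) * ((77 * I) * (77 * I + l * I)) := by
      have := P.maxEv_add_le hI1 hiI
      have hlI : l ≤ l * I := Nat.le_mul_of_pos_right _ hI1
      exact Nat.mul_le_mul_left _ (Nat.mul_le_mul this (by omega))
    calc (X : ℝ) ≤ (((N + 1) * ((77 * I) * (77 * I + l * I)) : ℕ) : ℝ) := by exact_mod_cast h1
      _ = m * (77 * (77 + l)) := by rw [hmI]; push_cast; ring
      -- `77 ≤ 154 L` and `l ≤ 6 L`.
      _ ≤ m * (77 * (164 * L)) := by gcongr; linarith
      _ = 12628 * (m * L) := by ring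
  have hmL : 0 ≤ m * L := by nlinarith
  -- the bound for sampling
  obtain ⟨l', hl', hlL₂⟩ := exists_le_two_pow (x := 5929 * m + (x + 3)) (by linarith)
  have hlL₂' : (l' : ℝ) ≤ 2 * Real.log m + 30 * L := by
    -- This turns the logarithm of a sum into at most `13 log 2 + log m + L`. The sum itself bounds
    -- the number of records and the grid sizes, so one exponent `l'` serves all three searches.
    have h1 : 5929 * m + (x + 3) ≤ 2 ^ 13 * (m * (2 + x)) := by nlinarith
    have h2 := Real.log_le_log (by linarith) h1
    rw [Real.log_mul (by positivity) (by positivity), Real.log_mul (by positivity)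
      (by positivity), Real.log_pow, ← hL] at h2
    push_cast at h2
    linarith
  have hrec : P.maxRec ≤ 2 ^ l' := by
    have h1 : (P.maxRec : ℝ) ≤ 5929 * m := by
      rw [hmI]
      exact_mod_cast P.maxRec_le hI1 hiI
    have h2 : (P.maxRec : ℝ) ≤ 2 ^ l' := by linarith
    exact_mod_cast h2
  have hgrid : ∀ j < N, P.S.gridCount P.Δ j ≤ 2 ^ l' := by
    intro j hj
    have h1 : ((P.S.gridCount P.Δ j : ℕ) : ℝ) ≤ x + 3 := S.gridCount_le hΔ hj
    have h2 : ((P.S.gridCount P.Δ j : ℕ) : ℝ) ≤ 2 ^ l' := by linarith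
    exact_mod_cast h2
  have hX' : ((l' + 2 : ℕ) : ℝ) ≤ 12628 * (Real.log m + L) := by push_cast; linarith
  have hmem : ∀ c ∈ S.approxCandidates Δ, ∃ z ∈ P.valid, P.toCandidate z = c := by
    intro c hc
    have := approxCandidates_eq (P := P) ▸ hc
    exact this
  have hKb : ∀ (p : Prog) (c : ℝ), 0 ≤ c → p.size ≤ s → p.size * (12628 * c) ≤ K * c := by
    intro p c hc hp
    rw [← mul_assoc]
    refine mul_le_mul_of_nonneg_right ?_ hc
    have : (p.size : ℝ) ≤ s := by exact_mod_cast hp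
    have : (0 : ℝ) ≤ d := Nat.cast_nonneg d
    linarith
  -- The states are all those with intact input and some complete table. Every query leads back to
  -- such a state, though not necessarily to the same store.
  refine ⟨P.memSize, {σ | P.Ready σ}, ?_, fun ω => ?_, fun σ hσ => ⟨fun ω => ?_, fun c hc => ?_⟩,
    fun σ hσ t ht r hr ω => ?_⟩
  · have h1 : (P.memSize : ℝ) ≤ (d + 50000) * m := by
      rw [hmI]
      exact_mod_cast P.memSize_le hI1 hiI
    refine h1.trans (mul_le_mul_of_nonneg_right ?_ (by linarith))
    rw [hK]
    have : (0 : ℝ) ≤ s := Nat.cast_nonneg s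
    linarith
  · exact (run_buildProg hts hΔ hinput hP hl le_rfl).haltsWithin hX
      (hKb _ _ hmL (by omega)) ω
  · obtain ⟨henv, M, rec, hM, hT, hp⟩ := hσ
    obtain ⟨T, σ', ω', h1, h2, h3, q, a, b, h4, h5⟩ :=
      exec_sampleProg henv hM hT hp hrec hgrid le_rfl ω
    have hcell := (hp.cell h4.block h4.row h4.col).1
    refine ⟨T, σ', ω', h1, cast_le_of_le_mul h2 hX' (hKb _ _ (by linarith) (by omega)), h3, _, ?_,
      (outputsCandidate_iff hcell.1).2 h5⟩
    · have : P.toCandidate ((rec q).j, (rec q).x + a, (rec q).y + b) ∈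
          P.S.approxCandidates P.Δ := by
        rw [approxCandidates_eq]
        exact mem_image_of_mem _ hcell
      exact this
  · obtain ⟨z, hz, rfl⟩ := hmem c hc
    rw [outputProb_sampleProg hσ hrec hgrid hz, prob_eq S ts Δ hts hΔ]
    congr 2
    rw [Finset.sum_eq_single_of_mem z (mem_validFinset.2 hz), ind_true (mem_singleton _), one_mul]
    intro z' hz' hne
    rw [ind_false, zero_mul]
    exact fun h => hne (toCandidate_injOn (mem_validFinset.1 hz') hz h)
  · refine ((run_decideProg rfl hσ hl le_rfl ht (r := r)).imp fun σ' h => ⟨h.1, ?_⟩).haltsWithin hX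
      (hKb _ _ hmL (by omega)) ω
    have h2 := h.2
    have hiff : S.prob Δ ts (S.feasibleSet Δ t) ≤ 1 / r ↔
        r * ∑ z ∈ P.validFinset, ind (P.S.Covers P.Δ t z.1
          (P.S.gridVal P.Δ z.1 z.2.1) (P.S.gridVal P.Δ z.1 z.2.2)) * P.wt z ≤ P.total := by
      rw [prob_eq S ts Δ hts hΔ, div_le_div_iff₀ total_pos hr, one_mul, mul_comm]
      have : ∀ z ∈ P.validFinset, ind (P.toCandidate z ∈ S.feasibleSet Δ t) * P.wt z =
          ind (P.S.Covers P.Δ t z.1 (P.S.gridVal P.Δ z.1 z.2.1)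
            (P.S.gridVal P.Δ z.1 z.2.2)) * P.wt z := fun z hz => by
        have h : P.toCandidate z ∈ S.feasibleSet Δ t ↔ _ :=
          mem_feasibleSet_iff (mem_validFinset.1 hz) t
        rw [ind_congr h]
      rw [Finset.sum_congr rfl this]
    by_cases hQ : S.prob Δ ts (S.feasibleSet Δ t) ≤ 1 / r
    · exact .inl ⟨hQ, h2.trans (ind_true (hiff.1 hQ))⟩
    · exact .inr ⟨hQ, h2.trans (ind_false fun h => hQ (hiff.2 h))⟩
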